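/- Consider the two-dimensional Vasicek model: let $0<\lambda_1<\lambda_2$, $\theta_1,\theta_2,\kappa\in\mathbb{R}$, $\sigma_1,\sigma_2>0$, $\rho\in[-1,1]$, let $(B^1,B^2)$ be Brownian motions with $dB^1_t\,dB^2_t=\rho\,dt$ under the risk-neutral measure $\mathbb{Q}$, let $Z=(Z^1,Z^2)$ solve $$dZ^i_t=-\lambda_i(Z^i_t-\theta_i)\,dt+\sigma_i\,dB^i_t,\qquad i=1,2,$$ and let $r_t=\kappa+Z^1_t+Z^2_t$. For a state $z\in\mathbb{R}^2$ and $x>0$ let $$P(x,z)=\mathbb{E}^{\mathbb{Q}}\Big[\exp\Big(-\int_t^{t+x}r_s\,ds\Big)\,\Big|\,Z_t=z\Big]$$ be the bond price (independent of $t$), let $f(x,z)=-\partial_x\log P(x,z)$ be the forward curve and $y(x,z)=-\tfrac1x\log P(x,z)$ the yield curve. Let $g$ be either $f$ or $y$, and write $$F(x,z)=\partial_x g(x,z)=a(x)+b(x)z_1+c(x)z_2,\qquad \ell_x=\{z\in\mathbb{R}^2: F(x,z)=0\}\quad(x>0).$$ Let $\ell_0$ and $\ell_\infty$ be the limiting lines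 of $\ell_x$ as $x\downarrow0$ and $x\to\infty$, that is, the lines given by the limits of the coefficients $(a,b,c)$ after normalization by the positive factor $1/\sqrt{b^2+c^2}$, and let $M$ be their intersection point. The envelope $\eta$ consists of the points $\eta(x)$, $x>0$, where $z=\eta(x)$ is the solution of $F(x,z)=\partial_xF(x,z)=0$. The augmented envelope $\hat\eta$ consists of $\eta$, the segment of $\ell_0$ from $M$ to $\eta(0)=\lim_{x\downarrow0}\eta(x)$, and the segment of $\ell_\infty$ from $\eta(\infty)=\lim_{x\to\infty}\eta(x)$ to $M$; if $\eta$ is unbounded at such an end and approaches the line asymptotically, the segment is replaced by the corresponding ray from $M$. The shape of $x\mapsto g(x,z)$ on $(0,\infty)$ is the finite sequence of its local maxima (humps) and local minima (dips) in increasing order of $x$, together with the information whether the curve is initially strictly increasing or strictly decreasing (which distinguishes the shapes "normal" and "inverse", both without extrema). Then $\mathbb{R}^2\setminus(\hat\eta\cup\ell_0\cup\ell_\infty)$ has only finitely many connected components $R_1,\dots,R_K$, each of them is open, and: 1. On each region $R_i$ the shape of $x\mapsto g(x,z)$ exists and is the same for all $z\in R_i$. 2. If $i\neq j$ and the common boundary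 $\partial R_i\cap\partial R_j$ contains a one-dimensional (topological) submanifold of $\mathbb{R}^2$, then the shapes on $R_i$ and $R_j$ are different; even the sequences of humps and dips are different. -/

import Mathlib

open MeasureTheory ProbabilityTheory Filter Topology
open scoped NNReal

namespace Vasicek

/-! ## The two-dimensional Vasicek model -/

/-- Parameters of the two-dimensional Vasicek model. -/
structure Params where
  lam1 : ℝ
  lam2 : ℝ
  theta1 : ℝ
  theta2 : ℝ
  sigma1 : ℝ
  sigma2 : ℝ
  rho : ℝ
  kappa : ℝ
  lam1_pos : 0 < lam1
  lam1_lt_lam2 : lam1 < lam2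
  sigma1_pos : 0 < sigma1
  sigma2_pos : 0 < sigma2
  neg_one_le_rho : -1 ≤ rho
  rho_le_one : rho ≤ 1

/-- `(B1, B2)` is a two-dimensional Brownian motion whose components have instantaneous
correlation `ρ`, that is, `dB1 dB2 = ρ dt`. -/
structure IsCorrelatedBrownian {Ω : Type*} [MeasurableSpace Ω] (Q : Measure Ω) (ρ : ℝ)
    (B1 B2 : ℝ≥0 → Ω → ℝ) : Prop where
  left : IsBrownianReal B1 Q
  right : IsBrownianReal B2 Q
  jointly_gaussian : IsGaussianProcess (Sum.elim B1 B2) Q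
  covariance : ∀ s t : ℝ≥0, cov[B1 s, B2 t; Q] = ρ * ((min s t : ℝ≥0) : ℝ)

/-- `Z` is a continuous solution, started at `z`, of
`dZⁱ = -λᵢ (Zⁱ - θᵢ) dt + σᵢ dBⁱ`, `i = 1, 2`. The noise is additive, so that the stochastic
integral of the constant `σᵢ` is `σᵢ Bⁱ`. -/
structure IsFactorProcess {Ω : Type*} [MeasurableSpace Ω] (Q : Measure Ω) (p : Params)
    (B1 B2 : ℝ≥0 → Ω → ℝ) (z : ℝ × ℝ) (Z : ℝ≥0 → Ω → ℝ × ℝ) : Prop where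
  continuous_paths : ∀ᵐ ω ∂Q, Continuous fun t : ℝ≥0 => Z t ω
  sde_fst : ∀ᵐ ω ∂Q, ∀ t : ℝ≥0,
    (Z t ω).1 = z.1 - (∫ s in (0 : ℝ)..t, p.lam1 * ((Z s.toNNReal ω).1 - p.theta1))
      + p.sigma1 * B1 t ω
  sde_snd : ∀ᵐ ω ∂Q, ∀ t : ℝ≥0,
    (Z t ω).2 = z.2 - (∫ s in (0 : ℝ)..t, p.lam2 * ((Z s.toNNReal ω).2 - p.theta2))
      + p.sigma2 * B2 t ω

/-- The short rate `r_s = κ + Z¹_s + Z²_s`. -/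
noncomputable def shortRate {Ω : Type*} (p : Params) (Z : ℝ≥0 → Ω → ℝ × ℝ) (s : ℝ) (ω : Ω) : ℝ :=
  p.kappa + (Z s.toNNReal ω).1 + (Z s.toNNReal ω).2

/-- The price of the zero-coupon bond with time to maturity `x` in state `z`, where `Z z` is the
factor process started at `z`. The model is a time-homogeneous Markov process, so this is
`E[exp(-∫ₜᵗ⁺ˣ r ds) | Zₜ = z]` for every `t`. -/
noncomputable def bondPrice {Ω : Type*} [MeasurableSpace Ω] (Q : Measure Ω) (p : Params)
    (Z : ℝ × ℝ → ℝ≥0 → Ω → ℝ × ℝ) (x : ℝ) (z : ℝ × ℝ) : ℝ :=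
  ∫ ω, Real.exp (-∫ s in (0 : ℝ)..x, shortRate p (Z z) s ω) ∂Q

/-- The forward curve `x ↦ -∂ₓ log P`. -/
noncomputable def forwardCurve {Ω : Type*} [MeasurableSpace Ω] (Q : Measure Ω) (p : Params)
    (Z : ℝ × ℝ → ℝ≥0 → Ω → ℝ × ℝ) (x : ℝ) (z : ℝ × ℝ) : ℝ :=
  -deriv (fun y => Real.log (bondPrice Q p Z y z)) x

/-- The yield curve `x ↦ -x⁻¹ log P`. -/
noncomputable def yieldCurve {Ω : Type*} [MeasurableSpace Ω] (Q : Measure Ω) (p : Params)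
    (Z : ℝ × ℝ → ℝ≥0 → Ω → ℝ × ℝ) (x : ℝ) (z : ℝ × ℝ) : ℝ :=
  -(1 / x) * Real.log (bondPrice Q p Z x z)

/-! ## Shapes -/

/-- A local maximum is a hump, a local minimum is a dip. -/
inductive Extremum where
  | hump
  | dip

/-- The shape of a curve on `(0, ∞)`: the sequence of its humps and dips, together with the
information whether the curve is initially increasing (this separates the shapes `normal` and
`inverse`, for which the sequence is empty). -/
structure Shape where
  rising : Bool
  extrema : List Extremum

/-- `Extremum.IsAt e g x`: the curve `g` has at `x` an extremum of kind `e`. -/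
def Extremum.IsAt (e : Extremum) (g : ℝ → ℝ) (x : ℝ) : Prop :=
  match e with
  | .hump => IsLocalMax g x
  | .dip => IsLocalMin g x

/-- The curve `g` on `(0, ∞)` has shape `S`: it is strictly increasing, respectively strictly
decreasing, in a right neighbourhood of `0`, and its local extrema in `(0, ∞)` are exactly
`x 0 < x 1 < ⋯`, of the kinds listed in `S.extrema`. -/
def HasShape (g : ℝ → ℝ) (S : Shape) : Prop :=
  (∃ ε : ℝ, 0 < ε ∧
    (S.rising = true → StrictMonoOn g (Set.Ioo 0 ε)) ∧
    (S.rising = false → StrictAntiOn g (Set.Ioo 0 ε))) ∧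
  ∃ x : Fin S.extrema.length → ℝ, StrictMono x ∧ (∀ k, 0 < x k) ∧
    (∀ k, (S.extrema.get k).IsAt g (x k)) ∧
    ∀ y : ℝ, 0 < y → IsLocalExtr g y → ∃ k, x k = y

/-! ## The family of lines and its envelope

Throughout, `g : ℝ → ℝ × ℝ → ℝ` is a curve `x ↦ g x z` that depends on the state `z`, and its
derivative in `x` is affine in `z`. -/

/-- `F(x, z) = ∂ₓ g(x, z) = a(x) + b(x) z₁ + c(x) z₂`. -/
noncomputable def lineFun (g : ℝ → ℝ × ℝ → ℝ) (x : ℝ) (z : ℝ × ℝ) : ℝ :=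
  deriv (fun y => g y z) x

/-- The coefficient `b(x)` of `z₁` in `F(x, z)`. -/
noncomputable def coeffB (g : ℝ → ℝ × ℝ → ℝ) (x : ℝ) : ℝ :=
  lineFun g x (1, 0) - lineFun g x (0, 0)

/-- The coefficient `c(x)` of `z₂` in `F(x, z)`. -/
noncomputable def coeffC (g : ℝ → ℝ × ℝ → ℝ) (x : ℝ) : ℝ :=
  lineFun g x (0, 1) - lineFun g x (0, 0)

/-- The limit of the lines `ℓₓ = {z | F(x, z) = 0}` along the filter `l`. The positive rescaling
by `1 / |(b(x), c(x))|` does not change `ℓₓ` and makes the coefficients converge to those of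
the limiting line; the rescaled `|F(x, z)|` is the distance from `z` to `ℓₓ`. -/
noncomputable def limitLine (g : ℝ → ℝ × ℝ → ℝ) (l : Filter ℝ) : Set (ℝ × ℝ) :=
  {z | Tendsto (fun x => lineFun g x z / Real.sqrt (coeffB g x ^ 2 + coeffC g x ^ 2)) l (𝓝 0)}

/-- The line `ℓ₀`. -/
noncomputable def lineZero (g : ℝ → ℝ × ℝ → ℝ) : Set (ℝ × ℝ) := limitLine g (𝓝[>] 0)

/-- The line `ℓ_∞`. -/
noncomputable def lineInfty (g : ℝ → ℝ × ℝ → ℝ) : Set (ℝ × ℝ) := limitLine g atTop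

/-- The set of points `z` with `F(x, z) = 0` and `∂ₓF(x, z) = 0`; it is the single point `η(x)`
when `W(b, c)(x) ≠ 0`. -/
noncomputable def envelopeAt (g : ℝ → ℝ × ℝ → ℝ) (x : ℝ) : Set (ℝ × ℝ) :=
  {z | lineFun g x z = 0 ∧ deriv (fun y => lineFun g y z) x = 0}

/-- The envelope `η`. -/
noncomputable def envelope (g : ℝ → ℝ × ℝ → ℝ) : Set (ℝ × ℝ) :=
  ⋃ x ∈ Set.Ioi (0 : ℝ), envelopeAt g x

/-- The limit of the segments from `M` (the common point of `ℓ₀` and `ℓ_∞`) to `η(x)` along the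
filter `l`. It is the segment from `M` to `lim η(x)` if this limit exists in the plane, and the
ray from `M` along the limiting line if `η(x)` approaches that line asymptotically. -/
noncomputable def contactSegment (g : ℝ → ℝ × ℝ → ℝ) (l : Filter ℝ) : Set (ℝ × ℝ) :=
  {z | Tendsto (fun x => Metric.infDist z
    (convexJoin ℝ (lineZero g ∩ lineInfty g) (envelopeAt g x))) l (𝓝 0)}

/-- The (trace of the) augmented envelope: the segment of `ℓ₀` from `M` to `η(0)`, the envelope,
and the segment of `ℓ_∞` from `η(∞)` to `M`. -/
noncomputable def augmentedEnvelope (g : ℝ → ℝ × ℝ → ℝ) : Set (ℝ × ℝ) :=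
  contactSegment g (𝓝[>] 0) ∪ envelope g ∪ contactSegment g atTop

/-- The part of the plane that is off the augmented envelope and off the lines `ℓ₀`, `ℓ_∞`. -/
noncomputable def offCurves (g : ℝ → ℝ × ℝ → ℝ) : Set (ℝ × ℝ) :=
  (augmentedEnvelope g ∪ lineZero g ∪ lineInfty g)ᶜ

/-- The regions into which the plane is cut by the augmented envelope and `ℓ₀`, `ℓ_∞`: the
connected components of the complement. -/
noncomputable def regions (g : ℝ → ℝ × ℝ → ℝ) : Set (Set (ℝ × ℝ)) :=
  {R | ∃ z ∈ offCurves g, R = connectedComponentIn (offCurves g) z}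

/-- The common boundary of `R` and `R'` contains a one-dimensional (topological) submanifold of
the plane, equivalently, a simple arc. -/
def ShareCurve (R R' : Set (ℝ × ℝ)) : Prop :=
  ∃ γ : ℝ → ℝ × ℝ, ContinuousOn γ (Set.Icc 0 1) ∧ Set.InjOn γ (Set.Icc 0 1) ∧
    γ '' Set.Icc 0 1 ⊆ frontier R ∩ frontier R'

end Vasicek

/-! For both curves and x > 0, ∂ₓg(x, z) is a negative factor times G(z, x) = z₁ + z₂ τ(x) + h(x),
where τ is strictly decreasing, h' = q τ', and q has finitely many critical points (`Profile`,
`IsCurve`). Hence ∂ₓG = τ' (z₂ + q): a point z lies on the envelope iff G(z, ·) has a multiple zero,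
and on ℓ₀ or ℓ_∞ iff G(z, ·) tends to 0 at that end. The segments of the augmented envelope lie in
ℓ₀ and ℓ_∞, so the regions are cut out by the envelope and the two full lines (`IsCurve.curves_eq`).

Off these curves every zero of G(z, ·) is simple and none can escape at 0 or ∞, so the number n of
zeros is locally constant (`eventually_ncard_eq`). G changes sign at each zero, so n and the sign of
G near 0 determine the shape: n alternating extrema. Across an envelope point with q' ≠ 0 a double
zero splits on one side and disappears on the other, which changes n (`eventually_ncard_ne`). Across
ℓ₀ or ℓ_∞ the sign of G flips at exactly one end, which changes the parity of n
(`GZero_mul_GInfty_pos`).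

Finiteness of the regions and the existence of a good crossing point are planar facts. Between
critical points of q the envelope is a graph over z₂ with slopes -τ, and the two lines have the
limiting slopes; so any two branches differ by a strictly monotone function
(`Profile.isArrangement`). Cells of such an arrangement are connected, and near all but countably
many of its points it is a single graph (`exists_two_sided`).

The closed form of the curves comes from the Gaussian law of the integrated short rate. For the
yield curve, x² y'(x) = ∫₀ˣ s f'(s) ds, so its lines are weighted averages of those of the forward
curve, and averaging preserves the properties of a profile (`AverageData.profile`). -/

namespace Vasicek

/-! ## Arrangements of finitely many graphs in the plane -/

/-- A set of the plane with interval slices over a preconnected base is preconnected if every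
point of it can be moved slightly in the base direction. -/
theorem isPreconnected_of_slices {T : Set (ℝ × ℝ)} {J : Set ℝ} (hJ : IsPreconnected J)
    (hTJ : ∀ z ∈ T, z.2 ∈ J) (hne : ∀ m ∈ J, ∃ a, (a, m) ∈ T)
    (hslice : ∀ m, {a : ℝ | (a, m) ∈ T}.OrdConnected)
    (hmove : ∀ z ∈ T, ∀ᶠ m in 𝓝[J] z.2, (z.1, m) ∈ T) : IsPreconnected T := by
  -- By `hmove`, relatively open subsets of `T` project to relatively open subsets of `J`. Two open
  -- sets covering `T` then have projections meeting over some `m`, and the interval slice over `m`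
  -- forces them to meet.
  have key : ∀ U : Set (ℝ × ℝ), IsOpen U →
      ∃ U' : Set ℝ, IsOpen U' ∧ {m | ∃ a, (a, m) ∈ T ∩ U} = U' ∩ J := by
    intro U hU
    have h1 : ∀ m : ℝ, (∃ a, (a, m) ∈ T ∩ U) → ∃ V : Set ℝ, IsOpen V ∧ m ∈ V ∧
        ∀ m' ∈ V ∩ J, ∃ a, (a, m') ∈ T ∩ U := by
      rintro m ⟨a, haT, haU⟩
      have hc : ContinuousAt (fun m' : ℝ => ((a, m') : ℝ × ℝ)) m := by fun_prop
      have h2 : ∀ᶠ m' in 𝓝[J] m, (a, m') ∈ U :=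
        (hc.eventually (hU.mem_nhds haU)).filter_mono nhdsWithin_le_nhds
      obtain ⟨V, hV, hmV, hsub⟩ := mem_nhdsWithin.1 ((hmove _ haT).and h2)
      exact ⟨V, hV, hmV, fun m' hm' => ⟨a, hsub hm'⟩⟩
    choose! V hV hmV hsub using h1
    refine ⟨⋃ m ∈ {m | ∃ a, (a, m) ∈ T ∩ U}, V m, isOpen_biUnion fun m hm => hV m hm, ?_⟩
    ext m
    constructor
    · intro hm
      refine ⟨Set.mem_biUnion hm (hmV m hm), ?_⟩
      obtain ⟨a, ha, -⟩ := hm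
      exact hTJ _ ha
    · rintro ⟨hm, hmJ⟩
      obtain ⟨m', hm', hmm⟩ := Set.mem_iUnion₂.1 hm
      exact hsub m' hm' m ⟨hmm, hmJ⟩
  rintro U V hU hV hTUV ⟨zU, hzU⟩ ⟨zV, hzV⟩
  obtain ⟨U', hU', hUe⟩ := key U hU
  obtain ⟨V', hV', hVe⟩ := key V hV
  have hsub : J ⊆ U' ∪ V' := by
    intro m hm
    obtain ⟨a, ha⟩ := hne m hm
    rcases hTUV ha with h | h
    · left
      have : m ∈ {m | ∃ a, (a, m) ∈ T ∩ U} := ⟨a, ha, h⟩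
      rw [hUe] at this
      exact this.1
    · right
      have : m ∈ {m | ∃ a, (a, m) ∈ T ∩ V} := ⟨a, ha, h⟩
      rw [hVe] at this
      exact this.1
  have hU1 : zU.2 ∈ U' ∩ J := hUe ▸ (⟨zU.1, hzU⟩ : ∃ a, (a, zU.2) ∈ T ∩ U)
  have hV1 : zV.2 ∈ V' ∩ J := hVe ▸ (⟨zV.1, hzV⟩ : ∃ a, (a, zV.2) ∈ T ∩ V)
  obtain ⟨m, hmJ, hmU, hmV⟩ := hJ U' V' hU' hV' hsub ⟨_, hU1.2, hU1.1⟩ ⟨_, hV1.2, hV1.1⟩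
  obtain ⟨a, ha⟩ : ∃ a, (a, m) ∈ T ∩ U := by
    have : m ∈ {m | ∃ a, (a, m) ∈ T ∩ U} := hUe ▸ ⟨hmU, hmJ⟩
    exact this
  obtain ⟨b, hb⟩ : ∃ a, (a, m) ∈ T ∩ V := by
    have : m ∈ {m | ∃ a, (a, m) ∈ T ∩ V} := hVe ▸ ⟨hmV, hmJ⟩
    exact this
  have hc : Continuous (fun a : ℝ => ((a, m) : ℝ × ℝ)) := by fun_prop
  obtain ⟨x, hx1, hx2⟩ := (hslice m).isPreconnected _ _ (hU.preimage hc) (hV.preimage hc)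
    (fun a ha => hTUV ha) ⟨a, ha⟩ ⟨b, hb⟩
  exact ⟨(x, m), hx1, hx2⟩

/-- The four positions of a point relative to the graph of `c` over `D`, in the plane with the
graph parametrized by the second coordinate. -/
def side (D : Set ℝ) (c : ℝ → ℝ) : Bool × Bool → Set (ℝ × ℝ)
  | (false, false) => {z | ∀ d ∈ D, z.2 < d}
  | (false, true) => {z | ∀ d ∈ D, d < z.2}
  | (true, false) => {z | z.2 ∈ D ∧ z.1 < c z.2}
  | (true, true) => {z | z.2 ∈ D ∧ c z.2 < z.1}

/-- The second coordinates that occur in a position relative to a graph over `D`. -/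
def sideBase (D : Set ℝ) : Bool × Bool → Set ℝ
  | (false, false) => {m | ∀ d ∈ D, m < d}
  | (false, true) => {m | ∀ d ∈ D, d < m}
  | (true, _) => D

theorem mem_sideBase_of_mem_side {D : Set ℝ} {c : ℝ → ℝ} {b : Bool × Bool} {z : ℝ × ℝ}
    (hz : z ∈ side D c b) : z.2 ∈ sideBase D b := by
  rcases b with ⟨_ | _, _ | _⟩
  exacts [hz, hz, hz.1, hz.1]

theorem ordConnected_sideBase {D : Set ℝ} (hD : D.OrdConnected) (b : Bool × Bool) :
    (sideBase D b).OrdConnected := by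
  rcases b with ⟨_ | _, _ | _⟩
  · exact ⟨fun x _ y hy t ht d hd => ht.2.trans_lt (hy d hd)⟩
  · exact ⟨fun x hx y _ t ht d hd => (hx d hd).trans_le ht.1⟩
  · exact hD
  · exact hD

theorem exists_mem_side {D : Set ℝ} (hD : D.OrdConnected) {c : ℝ → ℝ} {z : ℝ × ℝ}
    (hz : ¬ (z.2 ∈ D ∧ z.1 = c z.2)) : ∃ b, z ∈ side D c b := by
  by_cases hzD : z.2 ∈ D
  · rcases lt_trichotomy z.1 (c z.2) with h | h | h
    · exact ⟨(true, false), hzD, h⟩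
    · exact (hz ⟨hzD, h⟩).elim
    · exact ⟨(true, true), hzD, h⟩
  · by_cases h : ∀ d ∈ D, z.2 < d
    · exact ⟨(false, false), h⟩
    · push Not at h
      obtain ⟨d, hd, hdz⟩ := h
      refine ⟨(false, true), fun e he => ?_⟩
      by_contra hlt
      exact hzD (hD.out hd he ⟨hdz, not_lt.1 hlt⟩)

theorem notMem_graph_of_mem_side {D : Set ℝ} {c : ℝ → ℝ} {b : Bool × Bool} {z : ℝ × ℝ}
    (hz : z ∈ side D c b) : ¬ (z.2 ∈ D ∧ z.1 = c z.2) := by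
  rintro ⟨hD, hc⟩
  rcases b with ⟨_ | _, _ | _⟩
  · exact lt_irrefl _ (hz _ hD)
  · exact lt_irrefl _ (hz _ hD)
  · exact hz.2.ne hc
  · exact hz.2.ne' hc

/-- Beyond an end of `D` the position depends on the second coordinate alone; over `D` it is a
strict inequality between continuous functions. Restricting to `sideBase` allows for end points that
belong to `D`. -/
theorem eventually_mem_side {D : Set ℝ} {c : ℝ → ℝ} (hc : ContinuousOn c D) {b : Bool × Bool}
    {z : ℝ × ℝ} (hz : z ∈ side D c b) :
    ∀ᶠ w in 𝓝[{w | w.2 ∈ sideBase D b}] z, w ∈ side D c b := by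
  rcases b with ⟨_ | _, _ | _⟩
  · exact self_mem_nhdsWithin
  · exact self_mem_nhdsWithin
  all_goals
    have hcz : ContinuousWithinAt (fun w : ℝ × ℝ => c w.2) {w | w.2 ∈ D} z :=
      (hc z.2 hz.1).comp continuousWithinAt_snd fun w hw => hw
    have hfst : ContinuousWithinAt (fun w : ℝ × ℝ => w.1) {w | w.2 ∈ D} z :=
      continuousWithinAt_fst
  · filter_upwards [self_mem_nhdsWithin, hfst.eventually_lt hcz hz.2] with w h1 h2
      using ⟨h1, h2⟩
  · filter_upwards [self_mem_nhdsWithin, hcz.eventually_lt hfst hz.2] with w h1 h2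
      using ⟨h1, h2⟩

section Arrangement

variable {ι : Type*}

/-- The union of the graphs of `c k` over `D k`. -/
def arrangement (D : ι → Set ℝ) (c : ι → ℝ → ℝ) : Set (ℝ × ℝ) :=
  {z | ∃ k, z.2 ∈ D k ∧ z.1 = c k z.2}

/-- The points with prescribed position relative to all graphs of an arrangement. -/
def cell (D : ι → Set ℝ) (c : ι → ℝ → ℝ) (s : ι → Bool × Bool) : Set (ℝ × ℝ) :=
  {z | ∀ k, z ∈ side (D k) (c k) (s k)}

/-- The graphs of an arrangement lie over intervals, and two of them differ by a strictly
monotone function. -/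
structure IsArrangement (D : ι → Set ℝ) (c : ι → ℝ → ℝ) : Prop where
  ordConnected : ∀ k, (D k).OrdConnected
  continuousOn : ∀ k, ContinuousOn (c k) (D k)
  strict : ∀ k l, k ≠ l → StrictMonoOn (fun m => c k m - c l m) (D k ∩ D l) ∨
    StrictAntiOn (fun m => c k m - c l m) (D k ∩ D l)

variable {D : ι → Set ℝ} {c : ι → ℝ → ℝ}

theorem cell_subset (s : ι → Bool × Bool) : cell D c s ⊆ (arrangement D c)ᶜ := by
  rintro z hz ⟨k, hk⟩
  exact notMem_graph_of_mem_side (hz k) hk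

namespace IsArrangement

theorem exists_mem_cell (h : IsArrangement D c) {z : ℝ × ℝ} (hz : z ∉ arrangement D c) :
    ∃ s, z ∈ cell D c s := by
  have : ∀ k, ∃ b, z ∈ side (D k) (c k) b := fun k =>
    exists_mem_side (h.ordConnected k) fun hk => hz ⟨k, hk⟩
  choose s hs using this
  exact ⟨s, hs⟩

/-- The difference of two graphs is monotone on an interval, so it is negative on an interval. -/
theorem ordConnected_lt (h : IsArrangement D c) (k l : ι) :
    {m | m ∈ D k ∧ m ∈ D l ∧ c k m < c l m}.OrdConnected := by
  refine ⟨fun x hx y hy t ht => ?_⟩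
  have hk := (h.ordConnected k).out hx.1 hy.1 ht
  have hl := (h.ordConnected l).out hx.2.1 hy.2.1 ht
  refine ⟨hk, hl, ?_⟩
  have hne : k ≠ l := by
    rintro rfl
    exact lt_irrefl _ hx.2.2
  rcases h.strict k l hne with hs | hs
  · have h1 : c k t - c l t ≤ c k y - c l y := hs.monotoneOn ⟨hk, hl⟩ ⟨hy.1, hy.2.1⟩ ht.2
    have h2 := hy.2.2
    linarith
  · have h1 : c k t - c l t ≤ c k x - c l x := hs.antitoneOn ⟨hx.1, hx.2.1⟩ ⟨hk, hl⟩ ht.1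
    have h2 := hx.2.2
    linarith

/-- Each horizontal slice of a cell is an interval. The cell projects onto the heights at which all
lower bounds stay below all upper bounds, which form an interval by `ordConnected_lt`. -/
theorem isPreconnected_cell [Finite ι] (h : IsArrangement D c) (s : ι → Bool × Bool) :
    IsPreconnected (cell D c s) := by
  classical
  have := Fintype.ofFinite ι
  set J : Set ℝ := (⋂ k, sideBase (D k) (s k)) ∩
    ⋂ k, ⋂ l, {m | s k = (true, true) → s l = (true, false) →
      m ∈ D k ∧ m ∈ D l ∧ c k m < c l m} with hJ
  have hJo : J.OrdConnected := by
    refine (Set.ordConnected_iInter fun k => ordConnected_sideBase (h.ordConnected k) _).inter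
      (Set.ordConnected_iInter fun k => Set.ordConnected_iInter fun l => ?_)
    by_cases hk : s k = (true, true)
    · by_cases hl : s l = (true, false)
      · simpa [hk, hl] using h.ordConnected_lt k l
      · simp [hl, Set.ordConnected_univ]
    · simp [hk, Set.ordConnected_univ]
  refine isPreconnected_of_slices hJo.isPreconnected ?_ ?_ ?_ ?_
  · intro z hz
    refine ⟨Set.mem_iInter.2 fun k => mem_sideBase_of_mem_side (hz k),
      Set.mem_iInter.2 fun k => Set.mem_iInter.2 fun l hk hl => ?_⟩
    have h1 := hz k
    have h2 := hz l
    rw [hk] at h1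
    rw [hl] at h2
    exact ⟨h1.1, h2.1, h1.2.trans h2.2⟩
  · rintro m ⟨hm1, hm2⟩
    rw [Set.mem_iInter] at hm1
    simp only [Set.mem_iInter, Set.mem_ofPred_eq] at hm2
    -- Finitely many lower bounds below finitely many upper bounds leave room for a point, even if
    -- one of the families is empty.
    obtain ⟨a, ha1, ha2⟩ := Order.exists_between_finsets
      ((Finset.univ.filter fun k => s k = (true, true)).image fun k => c k m)
      ((Finset.univ.filter fun k => s k = (true, false)).image fun k => c k m) (by
        simp only [Finset.mem_image, Finset.mem_filter, Finset.mem_univ, true_and]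
        rintro _ ⟨k, hk, rfl⟩ _ ⟨l, hl, rfl⟩
        exact (hm2 k l hk hl).2.2)
    simp only [Finset.mem_image, Finset.mem_filter, Finset.mem_univ, true_and,
      forall_exists_index, and_imp, forall_apply_eq_imp_iff₂] at ha1 ha2
    refine ⟨a, fun k => ?_⟩
    have hb := hm1 k
    have hl := ha1 k
    have hr := ha2 k
    revert hb hl hr
    generalize s k = b
    intro hb hl hr
    rcases b with ⟨_ | _, _ | _⟩
    · exact hb
    · exact hb
    · exact ⟨hb, hr rfl⟩
    · exact ⟨hb, hl rfl⟩
  · intro m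
    have : {a : ℝ | (a, m) ∈ cell D c s} = ⋂ k, {a : ℝ | (a, m) ∈ side (D k) (c k) (s k)} := by
      ext a
      simp [cell]
    rw [this]
    refine Set.ordConnected_iInter fun k => ⟨fun x hx y hy t ht => ?_⟩
    revert hx hy
    generalize s k = b
    intro hx hy
    rcases b with ⟨_ | _, _ | _⟩
    · exact hx
    · exact hx
    · exact ⟨hx.1, ht.2.trans_lt hy.2⟩
    · exact ⟨hx.1, hx.2.trans_le ht.1⟩
  · intro z hz
    have : ∀ k, ∀ᶠ m in 𝓝[J] z.2, (z.1, m) ∈ side (D k) (c k) (s k) := by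
      intro k
      have hcont : Tendsto (fun m : ℝ => ((z.1, m) : ℝ × ℝ)) (𝓝[J] z.2)
          (𝓝[{w | w.2 ∈ sideBase (D k) (s k)}] z) := by
        refine tendsto_nhdsWithin_iff.2 ⟨?_, ?_⟩
        · have : Continuous fun m : ℝ => ((z.1, m) : ℝ × ℝ) := by fun_prop
          exact (this.tendsto z.2).mono_left nhdsWithin_le_nhds
        · filter_upwards [self_mem_nhdsWithin] with m hm
          exact Set.mem_iInter.1 hm.1 k
      exact hcont.eventually (eventually_mem_side (h.continuousOn k) (hz k))
    simpa [cell] using eventually_all.2 this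

/-- A component is determined by any nonempty cell inside it, and there are finitely many position
vectors. The value `∅` only serves the empty cells. -/
theorem finite_components [Finite ι] (h : IsArrangement D c) :
    {R | ∃ z ∈ (arrangement D c)ᶜ, R = connectedComponentIn (arrangement D c)ᶜ z}.Finite := by
  classical
  refine (Set.finite_range fun s : ι → Bool × Bool =>
    if hs : (cell D c s).Nonempty then connectedComponentIn (arrangement D c)ᶜ hs.some
    else ∅).subset ?_
  rintro R ⟨z, hz, rfl⟩
  obtain ⟨s, hs⟩ := h.exists_mem_cell hz
  refine ⟨s, ?_⟩
  have hne : (cell D c s).Nonempty := ⟨z, hs⟩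
  simp only [dif_pos hne]
  exact (connectedComponentIn_eq ((h.isPreconnected_cell s).subset_connectedComponentIn hs
    (cell_subset s) hne.some_mem)).symm

end IsArrangement

/-- Components of an open set of the plane are open. A frontier point inside `O` would have a
component meeting, hence equal to, the given one, and would be an interior point of it. -/
theorem frontier_component_subset {O : Set (ℝ × ℝ)} (hO : IsOpen O) (z : ℝ × ℝ) :
    frontier (connectedComponentIn O z) ⊆ Oᶜ := by
  intro p hp hpO
  have hRo : IsOpen (connectedComponentIn O z) := hO.connectedComponentIn
  have hpo : IsOpen (connectedComponentIn O p) := hO.connectedComponentIn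
  obtain ⟨w, hw1, hw2⟩ := mem_closure_iff.1 hp.1 _ hpo (mem_connectedComponentIn hpO)
  have : p ∈ connectedComponentIn O z := by
    rw [connectedComponentIn_eq hw2, ← connectedComponentIn_eq hw1]
    exact mem_connectedComponentIn hpO
  rw [hRo.frontier_eq] at hp
  exact hp.2 this

end Arrangement

/-- A non-interior point of an interval is its greatest or its least element. -/
theorem countable_diff_interior {S : Set ℝ} (hS : S.OrdConnected) :
    (S \ interior S).Countable := by
  have h1 : {m | IsGreatest S m}.Subsingleton := fun x hx y hy => hx.unique hy
  have h2 : {m | IsLeast S m}.Subsingleton := fun x hx y hy => hx.unique hy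
  refine (h1.countable.union h2.countable).mono ?_
  rintro m ⟨hm, hi⟩
  by_contra hcon
  simp only [Set.mem_union, Set.mem_ofPred_eq, not_or, IsGreatest, IsLeast, hm, true_and,
    mem_upperBounds, mem_lowerBounds, not_forall, not_le] at hcon
  obtain ⟨⟨x, hx, hmx⟩, ⟨y, hy, hym⟩⟩ := hcon
  exact hi (mem_interior_iff_mem_nhds.2 (mem_of_superset (Icc_mem_nhds hym hmx) (hS.out hy hx)))

/-! ### Two components with a large common boundary -/

namespace IsArrangement

variable {ι : Type*} {D : ι → Set ℝ} {c : ι → ℝ → ℝ}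

theorem subsingleton_inter_graphs (h : IsArrangement D c) {k l : ι} (hkl : k ≠ l) :
    {z : ℝ × ℝ | (z.2 ∈ D k ∧ z.1 = c k z.2) ∧ z.2 ∈ D l ∧ z.1 = c l z.2}.Subsingleton := by
  rintro z ⟨⟨hz1, hz2⟩, hz3, hz4⟩ w ⟨⟨hw1, hw2⟩, hw3, hw4⟩
  have hinj : Set.InjOn (fun m => c k m - c l m) (D k ∩ D l) := by
    rcases h.strict k l hkl with hs | hs
    exacts [hs.injOn, hs.injOn]
  have h2 : z.2 = w.2 := hinj ⟨hz1, hz3⟩ ⟨hw1, hw3⟩ (by simp only; linarith)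
  exact Prod.ext (by rw [hz2, hw2, h2]) h2

/-- Two different components of the complement of an arrangement that have uncountably many
common boundary points lie on the two sides of a graph near one of these points. -/
theorem exists_two_sided [Finite ι] (h : IsArrangement D c) (hO : IsOpen (arrangement D c)ᶜ)
    {z z' : ℝ × ℝ}
    (hne : connectedComponentIn (arrangement D c)ᶜ z ≠ connectedComponentIn (arrangement D c)ᶜ z')
    {X : Set (ℝ × ℝ)} (hX : ¬ X.Countable)
    (hXs : X ⊆ frontier (connectedComponentIn (arrangement D c)ᶜ z) ∩
      frontier (connectedComponentIn (arrangement D c)ᶜ z')) :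
    ∃ p ∈ X, ∃ k, (p.2 ∈ D k ∧ p.1 = c k p.2) ∧ (∀ l, l ≠ k → p.2 ∈ D l → p.1 ≠ c l p.2) ∧
      ∃ s : ℝ, (s = 1 ∨ s = -1) ∧ ∀ᶠ ε in 𝓝[>] (0 : ℝ),
        (p.1 + s * ε, p.2) ∈ connectedComponentIn (arrangement D c)ᶜ z ∧
        (p.1 - s * ε, p.2) ∈ connectedComponentIn (arrangement D c)ᶜ z' := by
  classical
  set A := arrangement D c with hA
  set R := connectedComponentIn Aᶜ z with hR
  set R' := connectedComponentIn Aᶜ z' with hR'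
  -- Two countable sets are discarded: crossings of two graphs, and points of a graph at whose
  -- height another graph or the graph itself begins or ends. Any remaining `p` has a neighbourhood
  -- in which a single graph `k` is present and runs through.
  have hB1 : (⋃ k, ⋃ l, ⋃ (_ : k ≠ l),
      {z : ℝ × ℝ | (z.2 ∈ D k ∧ z.1 = c k z.2) ∧ z.2 ∈ D l ∧ z.1 = c l z.2}).Countable :=
    Set.countable_iUnion fun k => Set.countable_iUnion fun l => Set.countable_iUnion fun hkl =>
      (h.subsingleton_inter_graphs hkl).countable
  have hB2 : (⋃ k, ⋃ l, ⋃ b, (fun m => ((c k m, m) : ℝ × ℝ)) ''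
      (sideBase (D l) b \ interior (sideBase (D l) b))).Countable :=
    Set.countable_iUnion fun k => Set.countable_iUnion fun l => Set.countable_iUnion fun b =>
      (countable_diff_interior (ordConnected_sideBase (h.ordConnected l) b)).image _
  obtain ⟨p, hpX, hpB⟩ : ∃ p ∈ X, p ∉ (⋃ k, ⋃ l, ⋃ (_ : k ≠ l),
      {z : ℝ × ℝ | (z.2 ∈ D k ∧ z.1 = c k z.2) ∧ z.2 ∈ D l ∧ z.1 = c l z.2}) ∪
      (⋃ k, ⋃ l, ⋃ b, (fun m => ((c k m, m) : ℝ × ℝ)) ''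
      (sideBase (D l) b \ interior (sideBase (D l) b))) := by
    by_contra hcon
    push Not at hcon
    exact hX ((hB1.union hB2).mono hcon)
  simp only [Set.mem_union, Set.mem_iUnion, not_or, not_exists] at hpB
  obtain ⟨hp1, hp2⟩ := hpB
  have hpA : p ∈ A := by
    have := frontier_component_subset hO z (hXs hpX).1
    rwa [compl_compl] at this
  obtain ⟨k, hk⟩ := hpA
  have huniq : ∀ l, l ≠ k → ¬ (p.2 ∈ D l ∧ p.1 = c l p.2) := fun l hl hpl =>
    hp1 k l hl.symm ⟨hk, hpl⟩
  have hnhds : ∀ l b, p.2 ∈ sideBase (D l) b → {w : ℝ × ℝ | w.2 ∈ sideBase (D l) b} ∈ 𝓝 p := by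
    intro l b hpb
    have h1 : p.2 ∈ interior (sideBase (D l) b) := by
      by_contra hcon
      exact hp2 k l b ⟨p.2, ⟨hpb, hcon⟩, Prod.ext hk.2.symm rfl⟩
    exact continuousAt_snd.preimage_mem_nhds (mem_interior_iff_mem_nhds.1 h1)
  have hs : ∀ l, ∃ b, l ≠ k → p ∈ side (D l) (c l) b := by
    intro l
    by_cases hl : l = k
    · exact ⟨(true, true), fun h => (h hl).elim⟩
    · obtain ⟨b, hb⟩ := exists_mem_side (h.ordConnected l) (huniq l hl)
      exact ⟨b, fun _ => hb⟩
  choose s hs using hs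
  have hev : ∀ᶠ w in 𝓝 p, w.2 ∈ D k ∧ ∀ l, l ≠ k → w ∈ side (D l) (c l) (s l) := by
    have hkD : ∀ᶠ w in 𝓝 p, w.2 ∈ D k := hnhds k (true, true) hk.1
    refine hkD.and (eventually_all.2 fun l => ?_)
    by_cases hl : l = k
    · exact Eventually.of_forall fun w h => (h hl).elim
    · have h1 := eventually_mem_side (h.continuousOn l) (hs l hl)
      rw [nhdsWithin_eq_nhds.2 (hnhds l _ (mem_sideBase_of_mem_side (hs l hl)))] at h1
      exact h1.mono fun w hw _ => hw
  set σ : Bool → ι → Bool × Bool := fun b => Function.update s k (true, b) with hσ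
  have hcell : ∀ (b : Bool) (w : ℝ × ℝ), (∀ l, l ≠ k → w ∈ side (D l) (c l) (s l)) →
      w ∈ side (D k) (c k) (true, b) → w ∈ cell D c (σ b) := by
    intro b w hw hwk l
    by_cases hl : l = k
    · subst hl
      simpa [hσ] using hwk
    · simpa [hσ, hl] using hw l hl
  have hmeet : ∀ y, p ∈ frontier (connectedComponentIn Aᶜ y) →
      ∃ b, cell D c (σ b) ⊆ connectedComponentIn Aᶜ y ∧
        ∃ w ∈ cell D c (σ b), connectedComponentIn Aᶜ y = connectedComponentIn Aᶜ w := by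
    intro y hy
    obtain ⟨w, hw1, hw2⟩ :=
      (mem_closure_iff_frequently.1 hy.1).and_eventually hev |>.exists
    have hwA : w ∉ A := connectedComponentIn_subset _ _ hw1
    have : ∃ b, w ∈ cell D c (σ b) := by
      rcases lt_trichotomy w.1 (c k w.2) with h1 | h1 | h1
      · exact ⟨false, hcell _ _ hw2.2 ⟨hw2.1, h1⟩⟩
      · exact (hwA ⟨k, hw2.1, h1⟩).elim
      · exact ⟨true, hcell _ _ hw2.2 ⟨hw2.1, h1⟩⟩
    obtain ⟨b, hb⟩ := this
    have heq := connectedComponentIn_eq hw1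
    refine ⟨b, ?_, w, hb, heq⟩
    rw [heq]
    exact (h.isPreconnected_cell _).subset_connectedComponentIn hb (cell_subset _)
  have hside : ∀ b : Bool, ∀ᶠ ε in 𝓝[>] (0 : ℝ),
      (p.1 + (if b then 1 else -1) * ε, p.2) ∈ cell D c (σ b) := by
    intro b
    have ht : Tendsto (fun ε : ℝ => ((p.1 + (if b then 1 else -1) * ε, p.2) : ℝ × ℝ))
        (𝓝[>] 0) (𝓝 p) := by
      have hc : Continuous (fun ε : ℝ => ((p.1 + (if b then 1 else -1) * ε, p.2) : ℝ × ℝ)) := by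
        fun_prop
      have := hc.tendsto 0
      simp only [mul_zero, add_zero, Prod.mk.eta] at this
      exact this.mono_left nhdsWithin_le_nhds
    filter_upwards [ht.eventually hev, self_mem_nhdsWithin] with ε hε hpos
    refine hcell _ _ hε.2 ?_
    have hpos' : 0 < ε := hpos
    cases b
    · refine ⟨hk.1, ?_⟩
      simp only [Bool.false_eq_true, if_false]
      linarith [hk.2]
    · refine ⟨hk.1, ?_⟩
      simp only [if_true]
      linarith [hk.2]
  obtain ⟨b, hb, w, hwb, hbw⟩ := hmeet z (hXs hpX).1
  obtain ⟨b', hb', w', hwb', hbw'⟩ := hmeet z' (hXs hpX).2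
  -- If both components contained the same adjacent cell, they would coincide.
  have hbb : b' = !b := by
    by_contra hcon
    have : b' = b := by
      revert hcon
      cases b <;> cases b' <;> simp
    subst this
    refine hne ?_
    have h1 := hb hwb'
    rw [hR, hR', hbw', connectedComponentIn_eq h1]
  refine ⟨p, hpX, k, hk, fun l hl hD he => huniq l hl ⟨hD, he⟩, if b then 1 else -1, ?_, ?_⟩
  · cases b <;> simp
  · filter_upwards [hside b, hside b'] with ε h1 h2
    refine ⟨hb h1, ?_⟩
    have h3 := hb' h2
    rw [hbb] at h3
    cases b <;> simpa [sub_eq_add_neg] using h3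

end IsArrangement

/-! ## One-parameter families of lines -/

/-- The family of lines `z₁ + z₂ τ(x) + h(x) = 0`, `x > 0`, with `τ` strictly decreasing and `h`
having slope `q` with respect to `τ`; `q` has finitely many critical points. -/
structure Profile where
  tau : ℝ → ℝ
  dtau : ℝ → ℝ
  h : ℝ → ℝ
  q : ℝ → ℝ
  dq : ℝ → ℝ
  tauZero : ℝ
  tauInfty : ℝ
  hZero : ℝ
  hInfty : ℝ
  hasDerivAt_tau : ∀ x, 0 < x → HasDerivAt tau (dtau x) x
  dtau_neg : ∀ x, 0 < x → dtau x < 0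
  hasDerivAt_h : ∀ x, 0 < x → HasDerivAt h (q x * dtau x) x
  hasDerivAt_q : ∀ x, 0 < x → HasDerivAt q (dq x) x
  finite_dq : {x | 0 < x ∧ dq x = 0}.Finite
  tendsto_tau_zero : Tendsto tau (𝓝[>] 0) (𝓝 tauZero)
  tendsto_tau_infty : Tendsto tau atTop (𝓝 tauInfty)
  tendsto_h_zero : Tendsto h (𝓝[>] 0) (𝓝 hZero)
  tendsto_h_infty : Tendsto h atTop (𝓝 hInfty)

namespace Profile

variable (P : Profile)

/-- The affine function of `z` whose zero set is the line with parameter `x`. -/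
def G (z : ℝ × ℝ) (x : ℝ) : ℝ := z.1 + z.2 * P.tau x + P.h x

/-- The limit of `G z x` as `x ↓ 0`. -/
def GZero (z : ℝ × ℝ) : ℝ := z.1 + z.2 * P.tauZero + P.hZero

/-- The limit of `G z x` as `x → ∞`. -/
def GInfty (z : ℝ × ℝ) : ℝ := z.1 + z.2 * P.tauInfty + P.hInfty

theorem tendsto_G_zero (z : ℝ × ℝ) : Tendsto (P.G z) (𝓝[>] 0) (𝓝 (P.GZero z)) :=
  ((P.tendsto_tau_zero.const_mul z.2).const_add z.1).add P.tendsto_h_zero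

theorem tendsto_G_infty (z : ℝ × ℝ) : Tendsto (P.G z) atTop (𝓝 (P.GInfty z)) :=
  ((P.tendsto_tau_infty.const_mul z.2).const_add z.1).add P.tendsto_h_infty

/-- The factorization that drives everything: since `dtau` has no zeros, the critical points of `G
z` are the solutions of `z.2 + q x = 0`. -/
theorem hasDerivAt_G (z : ℝ × ℝ) {x : ℝ} (hx : 0 < x) :
    HasDerivAt (P.G z) (P.dtau x * (z.2 + P.q x)) x := by
  have := (((P.hasDerivAt_tau x hx).const_mul z.2).const_add z.1).add (P.hasDerivAt_h x hx)
  exact this.congr_deriv (by ring)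

theorem continuousOn_G (z : ℝ × ℝ) : ContinuousOn (P.G z) (Set.Ioi 0) := fun _ hx =>
  (P.hasDerivAt_G z hx).continuousAt.continuousWithinAt

theorem strictAntiOn_tau : StrictAntiOn P.tau (Set.Ioi 0) := by
  refine strictAntiOn_of_deriv_neg (convex_Ioi 0)
    (fun x hx => (P.hasDerivAt_tau x hx).continuousAt.continuousWithinAt) fun x hx => ?_
  rw [interior_Ioi] at hx
  rw [(P.hasDerivAt_tau x hx).deriv]
  exact P.dtau_neg x hx

theorem tau_lt_tauZero {x : ℝ} (hx : 0 < x) : P.tau x < P.tauZero := by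
  -- The limit alone gives only `≤`; the intermediate point makes the inequality strict.
  have h1 : P.tau x < P.tau (x / 2) :=
    P.strictAntiOn_tau (Set.mem_Ioi.2 (half_pos hx)) hx (half_lt_self hx)
  refine h1.trans_le (ge_of_tendsto P.tendsto_tau_zero ?_)
  filter_upwards [Ioo_mem_nhdsGT (half_pos hx)] with y hy
  exact (P.strictAntiOn_tau hy.1 (Set.mem_Ioi.2 (half_pos hx)) hy.2).le

theorem tauInfty_lt_tau {x : ℝ} (hx : 0 < x) : P.tauInfty < P.tau x := by
  have h1 : P.tau (x + 1) < P.tau x :=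
    P.strictAntiOn_tau hx (Set.mem_Ioi.2 (by linarith)) (lt_add_one x)
  refine lt_of_le_of_lt (le_of_tendsto P.tendsto_tau_infty ?_) h1
  filter_upwards [eventually_gt_atTop (x + 1)] with y hy
  exact (P.strictAntiOn_tau (Set.mem_Ioi.2 (by linarith)) (Set.mem_Ioi.2 (by linarith)) hy).le

/-- The end points of the pieces on which `q` is strictly monotone. -/
def cuts : Set ℝ := insert 0 {x | 0 < x ∧ P.dq x = 0}

instance : Finite P.cuts := (P.finite_dq.insert 0).to_subtype

/-- The piece of `(0, ∞)` between the cut `s` (excluded) and the next cut (included). -/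
def piece (s : ℝ) : Set ℝ := {x | s < x ∧ ∀ r, 0 < r → P.dq r = 0 → s < r → x ≤ r}

variable {P}

theorem cuts_nonneg {s : ℝ} (hs : s ∈ P.cuts) : 0 ≤ s := by
  rcases hs with rfl | hs
  exacts [le_rfl, hs.1.le]

theorem pos_of_mem_piece {s x : ℝ} (hs : s ∈ P.cuts) (hx : x ∈ P.piece s) : 0 < x :=
  (cuts_nonneg hs).trans_lt hx.1

theorem ordConnected_piece (s : ℝ) : (P.piece s).OrdConnected :=
  ⟨fun _ hx _ hy _ ht => ⟨hx.1.trans_le ht.1, fun r h1 h2 h3 => ht.2.trans (hy.2 r h1 h2 h3)⟩⟩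

theorem exists_mem_piece {x : ℝ} (hx : 0 < x) : ∃ s ∈ P.cuts, x ∈ P.piece s := by
  have hfin : {s | s ∈ P.cuts ∧ s < x}.Finite :=
    (P.finite_dq.insert 0).subset fun s hs => hs.1
  -- `s` is the largest cut below `x`. It exists because 0 is a cut.
  obtain ⟨s, hs, hmax⟩ := Set.exists_max_image _ id hfin ⟨0, Or.inl rfl, hx⟩
  refine ⟨s, hs.1, hs.2, fun r h1 h2 h3 => ?_⟩
  by_contra hlt
  exact absurd (hmax r ⟨Or.inr ⟨h1, h2⟩, not_le.1 hlt⟩) (not_le.2 h3)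

theorem dq_ne_zero_of_between {s x y t : ℝ} (hs : s ∈ P.cuts) (hx : x ∈ P.piece s)
    (hy : y ∈ P.piece s) (ht : t ∈ Set.Ioo x y) : P.dq t ≠ 0 := fun h0 =>
  absurd (hy.2 t ((pos_of_mem_piece hs hx).trans ht.1) h0 (hx.1.trans ht.1)) (not_le.2 ht.2)

/-- By Rolle, since the critical points of `q` can only be right end points of pieces. So a piece of
the envelope is a graph over the second coordinate. -/
theorem injOn_q_piece {s : ℝ} (hs : s ∈ P.cuts) : Set.InjOn (fun x => -P.q x) (P.piece s) := by
  have key : ∀ x ∈ P.piece s, ∀ y ∈ P.piece s, x < y → P.q x ≠ P.q y := by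
    intro x hx y hy hxy heq
    have hpos : ∀ t ∈ Set.Icc x y, 0 < t := fun t ht => (pos_of_mem_piece hs hx).trans_le ht.1
    obtain ⟨t, ht, h0⟩ := exists_hasDerivAt_eq_zero hxy
      (fun t ht => (P.hasDerivAt_q t (hpos t ht)).continuousAt.continuousWithinAt) heq
      (fun t ht => P.hasDerivAt_q t (hpos t (Set.Ioo_subset_Icc_self ht)))
    exact dq_ne_zero_of_between hs hx hy ht h0
  intro x hx y hy hxy
  have hxy' : P.q x = P.q y := neg_injective hxy
  rcases lt_trichotomy x y with h | h | h
  · exact (key x hx y hy h hxy').elim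
  · exact h
  · exact (key y hy x hx h hxy'.symm).elim

variable (P)

/-- The first coordinate of the point of the envelope with parameter `x`; the second one is
`-q x`. -/
def env (x : ℝ) : ℝ := P.q x * P.tau x - P.h x

/-- The terms `q τ'` and `h'` cancel. As the second coordinate of the envelope has derivative `-q'`,
its slope over that coordinate is `-τ`: the envelope is tangent to its lines. -/
theorem hasDerivAt_env {x : ℝ} (hx : 0 < x) : HasDerivAt P.env (P.dq x * P.tau x) x := by
  have := ((P.hasDerivAt_q x hx).mul (P.hasDerivAt_tau x hx)).sub (P.hasDerivAt_h x hx)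
  exact this.congr_deriv (by ring)

variable {P} in
/-- On a piece, the envelope has slopes `-τ(t)` with respect to the second coordinate. -/
theorem exists_slope_piece {s x y : ℝ} (hs : s ∈ P.cuts) (hx : x ∈ P.piece s)
    (hy : y ∈ P.piece s) (hxy : x ≠ y) :
    ∃ t ∈ P.piece s, P.env y - P.env x = (P.q y - P.q x) * P.tau t := by
  have key : ∀ x ∈ P.piece s, ∀ y ∈ P.piece s, x < y →
      ∃ t ∈ P.piece s, P.env y - P.env x = (P.q y - P.q x) * P.tau t := by
    intro x hx y hy hxy
    have hpos : ∀ t ∈ Set.Icc x y, 0 < t := fun t ht => (pos_of_mem_piece hs hx).trans_le ht.1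
    obtain ⟨t, ht, h0⟩ := exists_ratio_hasDerivAt_eq_ratio_slope P.q P.dq hxy
      (fun t ht => (P.hasDerivAt_q t (hpos t ht)).continuousAt.continuousWithinAt)
      (fun t ht => P.hasDerivAt_q t (hpos t (Set.Ioo_subset_Icc_self ht)))
      P.env (fun t => P.dq t * P.tau t)
      (fun t ht => (P.hasDerivAt_env (hpos t ht)).continuousAt.continuousWithinAt)
      (fun t ht => P.hasDerivAt_env (hpos t (Set.Ioo_subset_Icc_self ht)))
    refine ⟨t, (ordConnected_piece s).out hx hy (Set.Ioo_subset_Icc_self ht), ?_⟩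
    have hne := dq_ne_zero_of_between hs hx hy ht
    exact mul_right_cancel₀ hne (by linear_combination h0)
  rcases lt_or_gt_of_ne hxy with h | h
  · exact key x hx y hy h
  · obtain ⟨t, ht, h0⟩ := key y hy x hx h
    exact ⟨t, ht, by linear_combination -h0⟩

/-- The intervals over which the branches of the envelope and the two limiting lines are
graphs. -/
def branchDom : P.cuts ⊕ Bool → Set ℝ
  | .inl s => (fun x => -P.q x) '' P.piece s
  | .inr _ => Set.univ

/-- The branches of the envelope and the two limiting lines as graphs. -/
noncomputable def branchVal : P.cuts ⊕ Bool → ℝ → ℝ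
  | .inl s => fun m => P.env (Function.invFunOn (fun x => -P.q x) (P.piece s) m)
  | .inr false => fun m => -(m * P.tauZero + P.hZero)
  | .inr true => fun m => -(m * P.tauInfty + P.hInfty)

/-- The negatives of the slopes of a branch. -/
def branchSlopes : P.cuts ⊕ Bool → Set ℝ
  | .inl s => P.tau '' P.piece s
  | .inr false => {P.tauZero}
  | .inr true => {P.tauInfty}

variable {P}

theorem branchVal_piece (s : P.cuts) {x : ℝ} (hx : x ∈ P.piece s) :
    P.branchVal (.inl s) (-P.q x) = P.env x := by
  have h1 : Function.invFunOn (fun x => -P.q x) (P.piece s) (-P.q x) = x :=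
    (injOn_q_piece s.2).leftInvOn_invFunOn hx
  simp only [branchVal, h1]

theorem exists_slope (k : P.cuts ⊕ Bool) {m m' : ℝ} (hm : m ∈ P.branchDom k)
    (hm' : m' ∈ P.branchDom k) (hne : m ≠ m') :
    ∃ t ∈ P.branchSlopes k, P.branchVal k m' - P.branchVal k m = -(m' - m) * t := by
  rcases k with s | _ | _
  · obtain ⟨x, hx, rfl⟩ := hm
    obtain ⟨y, hy, rfl⟩ := hm'
    obtain ⟨t, ht, h1⟩ := exists_slope_piece s.2 hx hy (fun h => hne (by rw [h]))
    refine ⟨_, ⟨t, ht, rfl⟩, ?_⟩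
    simp only [branchVal_piece s hx, branchVal_piece s hy, h1]
    ring
  · exact ⟨_, rfl, by simp only [branchVal]; ring⟩
  · exact ⟨_, rfl, by simp only [branchVal]; ring⟩

theorem tauInfty_lt_tauZero : P.tauInfty < P.tauZero :=
  (P.tauInfty_lt_tau one_pos).trans (P.tau_lt_tauZero one_pos)

theorem abs_le_of_mem_branchSlopes {k : P.cuts ⊕ Bool} {t : ℝ} (ht : t ∈ P.branchSlopes k) :
    |t| ≤ |P.tauZero| + |P.tauInfty| := by
  have h1 : P.tauInfty ≤ t ∧ t ≤ P.tauZero := by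
    rcases k with s | _ | _
    · obtain ⟨x, hx, rfl⟩ := ht
      have := pos_of_mem_piece s.2 hx
      exact ⟨(P.tauInfty_lt_tau this).le, (P.tau_lt_tauZero this).le⟩
    · rw [Set.mem_singleton_iff.1 ht]
      exact ⟨tauInfty_lt_tauZero.le, le_rfl⟩
    · rw [Set.mem_singleton_iff.1 ht]
      exact ⟨le_rfl, tauInfty_lt_tauZero.le⟩
  rw [abs_le]
  constructor
  · linarith [neg_abs_le P.tauInfty, abs_nonneg P.tauZero]
  · linarith [le_abs_self P.tauZero, abs_nonneg P.tauInfty]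

/-- The pieces are consecutive and `τ` is strictly decreasing, with values strictly between
`tauInfty` and `tauZero`; so the slope sets of different branches lie on different sides of each
other. -/
theorem branchSlopes_separated {k l : P.cuts ⊕ Bool} (hkl : k ≠ l) :
    (∀ t ∈ P.branchSlopes k, ∀ u ∈ P.branchSlopes l, t < u) ∨
      (∀ t ∈ P.branchSlopes k, ∀ u ∈ P.branchSlopes l, u < t) := by
  have hp : ∀ s s' : P.cuts, (s : ℝ) < s' → ∀ t ∈ P.branchSlopes (.inl s),
      ∀ u ∈ P.branchSlopes (.inl s'), u < t := by
    rintro s s' hss _ ⟨x, hx, rfl⟩ _ ⟨y, hy, rfl⟩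
    have h0 : 0 < (s' : ℝ) := (cuts_nonneg s.2).trans_lt hss
    have h1 : P.dq s' = 0 := by
      rcases s'.2 with h | h
      exacts [(h0.ne' h).elim, h.2]
    exact P.strictAntiOn_tau (pos_of_mem_piece s.2 hx) (pos_of_mem_piece s'.2 hy)
      ((hx.2 s' h0 h1 hss).trans_lt hy.1)
  rcases k with s | _ | _ <;> rcases l with s' | _ | _
  · rcases lt_trichotomy (s : ℝ) s' with h | h | h
    · exact Or.inr (hp s s' h)
    · exact (hkl (congrArg _ (Subtype.ext h))).elim
    · exact Or.inl fun t ht u hu => hp s' s h u hu t ht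
  · left
    rintro _ ⟨x, hx, rfl⟩ _ rfl
    exact P.tau_lt_tauZero (pos_of_mem_piece s.2 hx)
  · right
    rintro _ ⟨x, hx, rfl⟩ _ rfl
    exact P.tauInfty_lt_tau (pos_of_mem_piece s.2 hx)
  · right
    rintro _ rfl _ ⟨x, hx, rfl⟩
    exact P.tau_lt_tauZero (pos_of_mem_piece s'.2 hx)
  · exact (hkl rfl).elim
  · right
    rintro _ rfl _ rfl
    exact tauInfty_lt_tauZero
  · left
    rintro _ rfl _ ⟨x, hx, rfl⟩
    exact P.tauInfty_lt_tau (pos_of_mem_piece s'.2 hx)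
  · left
    rintro _ rfl _ rfl
    exact tauInfty_lt_tauZero
  · exact (hkl rfl).elim

variable (P)

/-- Branches are Lipschitz because their slopes are bounded. The difference of two branches has
difference quotients of constant sign because their slopes are separated. -/
theorem isArrangement : IsArrangement P.branchDom P.branchVal where
  ordConnected k := by
    rcases k with s | b
    · refine IsPreconnected.ordConnected
        ((ordConnected_piece (P := P) s).isPreconnected.image _ fun x hx => ?_)
      exact (P.hasDerivAt_q x (pos_of_mem_piece s.2 hx)).continuousAt.neg.continuousWithinAt
    · exact Set.ordConnected_univ
  continuousOn k := by
    have hT : 0 ≤ |P.tauZero| + |P.tauInfty| := by positivity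
    refine LipschitzOnWith.continuousOn (K := ⟨_, hT⟩)
      (LipschitzOnWith.of_dist_le_mul fun m hm m' hm' => ?_)
    rcases eq_or_ne m m' with rfl | hne
    · simp
    · obtain ⟨t, ht, h1⟩ := exists_slope k hm' hm hne.symm
      rw [Real.dist_eq, Real.dist_eq, h1, abs_mul, abs_neg, mul_comm]
      exact mul_le_mul_of_nonneg_right (abs_le_of_mem_branchSlopes ht) (abs_nonneg _)
  strict k l hkl := by
    rcases branchSlopes_separated hkl with h | h
    · left
      intro m hm m' hm' hlt
      obtain ⟨t, ht, h1⟩ := exists_slope k hm.1 hm'.1 hlt.ne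
      obtain ⟨u, hu, h2⟩ := exists_slope l hm.2 hm'.2 hlt.ne
      have := mul_pos (sub_pos.2 hlt) (sub_pos.2 (h t ht u hu))
      simp only
      nlinarith
    · right
      intro m hm m' hm' hlt
      obtain ⟨t, ht, h1⟩ := exists_slope k hm.1 hm'.1 hlt.ne
      obtain ⟨u, hu, h2⟩ := exists_slope l hm.2 hm'.2 hlt.ne
      have := mul_pos (sub_pos.2 hlt) (sub_pos.2 (h t ht u hu))
      simp only
      nlinarith

variable {P}

theorem G_eq_zero_iff {z : ℝ × ℝ} {x : ℝ} (hz : z.2 = -P.q x) :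
    P.G z x = 0 ↔ z.1 = P.env x := by
  simp only [G, env, hz]
  constructor <;> intro h <;> linarith

theorem mem_graph_zero_iff {z : ℝ × ℝ} :
    (z.2 ∈ P.branchDom (.inr false) ∧ z.1 = P.branchVal (.inr false) z.2) ↔ P.GZero z = 0 := by
  simp only [branchDom, branchVal, GZero, Set.mem_univ, true_and]
  constructor <;> intro h <;> linarith

theorem mem_graph_infty_iff {z : ℝ × ℝ} :
    (z.2 ∈ P.branchDom (.inr true) ∧ z.1 = P.branchVal (.inr true) z.2) ↔ P.GInfty z = 0 := by
  simp only [branchDom, branchVal, GInfty, Set.mem_univ, true_and]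
  constructor <;> intro h <;> linarith

theorem mem_graph_piece_iff {z : ℝ × ℝ} {s : P.cuts} :
    (z.2 ∈ P.branchDom (.inl s) ∧ z.1 = P.branchVal (.inl s) z.2) ↔
      ∃ x ∈ P.piece s, P.G z x = 0 ∧ z.2 + P.q x = 0 := by
  constructor
  · rintro ⟨⟨x, hx, hxz⟩, h⟩
    simp only at hxz
    rw [← hxz, branchVal_piece s hx] at h
    exact ⟨x, hx, (G_eq_zero_iff hxz.symm).2 h, by rw [← hxz]; ring⟩
  · rintro ⟨x, hx, h1, h2⟩
    have hq : z.2 = -P.q x := by linarith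
    refine ⟨⟨x, hx, hq.symm⟩, ?_⟩
    rw [(G_eq_zero_iff hq).1 h1]
    rw [hq, branchVal_piece s hx]

theorem mem_arrangement_iff {z : ℝ × ℝ} : z ∈ arrangement P.branchDom P.branchVal ↔
    P.GZero z = 0 ∨ P.GInfty z = 0 ∨ ∃ x, 0 < x ∧ P.G z x = 0 ∧ z.2 + P.q x = 0 := by
  constructor
  · rintro ⟨s | _ | _, h⟩
    · obtain ⟨x, hx, h⟩ := mem_graph_piece_iff.1 h
      exact Or.inr (Or.inr ⟨x, pos_of_mem_piece s.2 hx, h⟩)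
    · exact Or.inl (mem_graph_zero_iff.1 h)
    · exact Or.inr (Or.inl (mem_graph_infty_iff.1 h))
  · rintro (h | h | ⟨x, hx, h⟩)
    · exact ⟨_, mem_graph_zero_iff.2 h⟩
    · exact ⟨_, mem_graph_infty_iff.2 h⟩
    · obtain ⟨s, hs, hxs⟩ := exists_mem_piece (P := P) hx
      exact ⟨.inl ⟨s, hs⟩, mem_graph_piece_iff.2 ⟨x, hxs, h⟩⟩

end Profile

/-! ## Counting zeros -/

/-- A function on `(0, ∞)` whose derivative has finitely many zeros has finitely many zeros. -/
theorem finite_zeros_of_finite_deriv {f f' : ℝ → ℝ} (hf : ∀ x, 0 < x → HasDerivAt f (f' x) x)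
    (hfin : {x | 0 < x ∧ f' x = 0}.Finite) : {x | 0 < x ∧ f x = 0}.Finite := by
  have hs : ∀ x : ℝ, ∃ s, 0 < x → s ∈ insert 0 {x | 0 < x ∧ f' x = 0} ∧ s < x ∧
      ∀ r, 0 < r → f' r = 0 → s < r → x ≤ r := by
    intro x
    by_cases hx : 0 < x
    · have hfin' : {s | s ∈ insert 0 {x | 0 < x ∧ f' x = 0} ∧ s < x}.Finite :=
        (hfin.insert 0).subset fun s hs => hs.1
      obtain ⟨s, hs, hmax⟩ := Set.exists_max_image _ id hfin' ⟨0, Or.inl rfl, hx⟩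
      refine ⟨s, fun _ => ⟨hs.1, hs.2, fun r h1 h2 h3 => ?_⟩⟩
      by_contra hlt
      exact absurd (hmax r ⟨Or.inr ⟨h1, h2⟩, not_le.1 hlt⟩) (not_le.2 h3)
    · exact ⟨0, fun h => (hx h).elim⟩
  -- `s x` is the largest critical point below `x`, or 0. By Rolle, distinct zeros of `f` have
  -- distinct values of `s`.
  choose s hs using hs
  have key : ∀ x y, 0 < x → f x = 0 → f y = 0 → x < y → s x ≠ s y := by
    intro x y hx hfx hfy hxy hsxy
    have hpos : ∀ t ∈ Set.Icc x y, 0 < t := fun t ht => hx.trans_le ht.1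
    obtain ⟨t, ht, h0⟩ := exists_hasDerivAt_eq_zero hxy
      (fun t ht => (hf t (hpos t ht)).continuousAt.continuousWithinAt) (hfx.trans hfy.symm)
      (fun t ht => hf t (hpos t (Set.Ioo_subset_Icc_self ht)))
    have := (hs y (hx.trans hxy)).2.2 t (hx.trans ht.1) h0
      (hsxy ▸ (hs x hx).2.1.trans ht.1)
    exact absurd this (not_le.2 ht.2)
  refine Set.Finite.of_injOn (f := s) (fun x hx => (hs x hx.1).1) ?_ (hfin.insert 0)
  intro x hx y hy hxy
  rcases lt_trichotomy x y with h | h | h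
  · exact (key x y hx.1 hx.2 hy.2 h hxy).elim
  · exact h
  · exact (key y x hy.1 hy.2 hx.2 h hxy.symm).elim

/-- A function changes sign at a simple zero. -/
theorem eventually_sign_of_simple_zero {f : ℝ → ℝ} {d x : ℝ} (hf : HasDerivAt f d x)
    (h0 : f x = 0) (hd : d ≠ 0) : ∀ᶠ y in 𝓝[≠] x, 0 < d * ((y - x) * f y) := by
  have h1 : Tendsto (fun y => d * slope f x y) (𝓝[≠] x) (𝓝 (d * d)) :=
    (hasDerivAt_iff_tendsto_slope.1 hf).const_mul d
  have h2 : ∀ᶠ y in 𝓝[≠] x, 0 < d * slope f x y :=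
    h1.eventually (lt_mem_nhds (mul_self_pos.2 hd))
  filter_upwards [h2, self_mem_nhdsWithin] with y hy hne
  have hne' : y - x ≠ 0 := sub_ne_zero.2 hne
  rw [slope_def_field, h0, sub_zero] at hy
  have : d * ((y - x) * f y) = (d * (f y / (y - x))) * (y - x) ^ 2 := by
    field_simp
  rw [this]
  positivity

theorem ncard_le_of_cover {A Z : Set ℝ} (hZ : Z.Finite) (V : ℝ → Set ℝ)
    (hA : A ⊆ ⋃ ζ ∈ Z, V ζ) (hsub : ∀ ζ ∈ Z, (A ∩ V ζ).Subsingleton) : A.ncard ≤ Z.ncard := by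
  have h1 : ∀ a, ∃ ζ, a ∈ A → ζ ∈ Z ∧ a ∈ V ζ := by
    intro a
    by_cases ha : a ∈ A
    · obtain ⟨ζ, hζ, haζ⟩ := Set.mem_iUnion₂.1 (hA ha)
      exact ⟨ζ, fun _ => ⟨hζ, haζ⟩⟩
    · exact ⟨0, fun h => (ha h).elim⟩
  choose f hf using h1
  refine Set.ncard_le_ncard_of_injOn f (fun a ha => (hf a ha).1) ?_ hZ
  intro a ha b hb hab
  exact hsub (f a) (hf a ha).1 ⟨ha, (hf a ha).2⟩ ⟨hb, hab ▸ (hf b hb).2⟩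

theorem ncard_le_of_disjoint {A Z : Set ℝ} (hA : A.Finite) (V : ℝ → Set ℝ)
    (hV : Z.PairwiseDisjoint V) (hne : ∀ ζ ∈ Z, (A ∩ V ζ).Nonempty) : Z.ncard ≤ A.ncard := by
  choose! f hf using hne
  refine Set.ncard_le_ncard_of_injOn f (fun a ha => (hf a ha).1) ?_ hA
  intro a ha b hb hab
  by_contra hne
  exact Set.disjoint_left.1 (hV ha hb hne) (hf a ha).2 (hab ▸ (hf b hb).2)

/-! ### Dependence of the zeros of `G z` on `z` -/

namespace Profile

variable (P : Profile)

/-- The parameters of the lines through `z`. -/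
def zeros (z : ℝ × ℝ) : Set ℝ := {x | 0 < x ∧ P.G z x = 0}

theorem finite_zeros (z : ℝ × ℝ) : (P.zeros z).Finite := by
  refine finite_zeros_of_finite_deriv (fun x hx => P.hasDerivAt_G z hx) ?_
  have h1 : {x | 0 < x ∧ z.2 + P.q x = 0}.Finite :=
    finite_zeros_of_finite_deriv (fun x hx => (P.hasDerivAt_q x hx).const_add z.2) P.finite_dq
  refine h1.subset fun x hx => ⟨hx.1, ?_⟩
  exact (mul_eq_zero.1 hx.2).resolve_left (P.dtau_neg x hx.1).ne

variable {P}

/-- The Lipschitz bound is uniform in `x` because `τ` is bounded. This makes perturbation arguments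
possible on the noncompact range of `x`. -/
theorem abs_G_sub_le (z w : ℝ × ℝ) {x : ℝ} (hx : 0 < x) :
    |P.G z x - P.G w x| ≤ |z.1 - w.1| + |z.2 - w.2| * (|P.tauZero| + |P.tauInfty|) := by
  obtain ⟨s, hs, hxs⟩ := exists_mem_piece (P := P) hx
  have hT : |P.tau x| ≤ |P.tauZero| + |P.tauInfty| :=
    abs_le_of_mem_branchSlopes (k := .inl ⟨s, hs⟩) ⟨x, hxs, rfl⟩
  have : P.G z x - P.G w x = (z.1 - w.1) + (z.2 - w.2) * P.tau x := by
    simp only [G]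
    ring
  rw [this]
  refine (abs_add_le _ _).trans (add_le_add_right ?_ _)
  rw [abs_mul]
  exact mul_le_mul_of_nonneg_left hT (abs_nonneg _)

/-- Near 0 and ∞ the nonzero limits bound `|G z|` from below; in between compactness does. -/
theorem exists_lower_bound {z : ℝ × ℝ} (h0 : P.GZero z ≠ 0) (hi : P.GInfty z ≠ 0) {V : Set ℝ}
    (hV : IsOpen V) (hz : P.zeros z ⊆ V) : ∃ c, 0 < c ∧ ∀ x, 0 < x → x ∉ V → c ≤ |P.G z x| := by
  have hc0 : 0 < |P.GZero z| / 2 := half_pos (abs_pos.2 h0)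
  have hci : 0 < |P.GInfty z| / 2 := half_pos (abs_pos.2 hi)
  have e0 : ∀ᶠ x in 𝓝[>] 0, |P.GZero z| / 2 < |P.G z x| :=
    (P.tendsto_G_zero z).abs.eventually (lt_mem_nhds (half_lt_self (abs_pos.2 h0)))
  have ei : ∀ᶠ x in atTop, |P.GInfty z| / 2 < |P.G z x| :=
    (P.tendsto_G_infty z).abs.eventually (lt_mem_nhds (half_lt_self (abs_pos.2 hi)))
  obtain ⟨ε, hε, he⟩ := mem_nhdsGT_iff_exists_Ioo_subset.1 e0
  obtain ⟨b, hb⟩ := eventually_atTop.1 ei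
  have hε' : 0 < ε := hε
  have hK : IsCompact (Set.Icc (ε / 2) b \ V) := isCompact_Icc.diff hV
  have hcont : ContinuousOn (fun x => |P.G z x|) (Set.Icc (ε / 2) b \ V) :=
    ((P.continuousOn_G z).mono fun x hx => Set.mem_Ioi.2 ((half_pos hε').trans_le hx.1.1)).abs
  obtain ⟨a, ha, hab⟩ := hK.exists_forall_le' hcont (a := 0) fun x hx =>
    abs_pos.2 fun h => hx.2 (hz ⟨(half_pos hε').trans_le hx.1.1, h⟩)
  refine ⟨min a (min (|P.GZero z| / 2) (|P.GInfty z| / 2)), lt_min ha (lt_min hc0 hci), ?_⟩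
  intro x hx hxV
  by_cases h1 : x < ε
  · exact ((min_le_right _ _).trans (min_le_left _ _)).trans (le_of_lt (he ⟨hx, h1⟩))
  by_cases h2 : b ≤ x
  · exact ((min_le_right _ _).trans (min_le_right _ _)).trans (hb x h2).le
  · refine (min_le_left _ _).trans (hab x ⟨⟨?_, (not_le.1 h2).le⟩, hxV⟩)
    linarith [not_lt.1 h1]

/-- The zeros move continuously. -/
theorem eventually_zeros_subset {z : ℝ × ℝ} (h0 : P.GZero z ≠ 0) (hi : P.GInfty z ≠ 0)
    {V : Set ℝ} (hV : IsOpen V) (hz : P.zeros z ⊆ V) : ∀ᶠ w in 𝓝 z, P.zeros w ⊆ V := by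
  obtain ⟨c, hc, hcV⟩ := exists_lower_bound h0 hi hV hz
  have ht : Tendsto (fun w : ℝ × ℝ => |z.1 - w.1| + |z.2 - w.2| * (|P.tauZero| + |P.tauInfty|))
      (𝓝 z) (𝓝 0) := by
    have : Continuous
        fun w : ℝ × ℝ => |z.1 - w.1| + |z.2 - w.2| * (|P.tauZero| + |P.tauInfty|) := by
      fun_prop
    simpa using this.tendsto z
  filter_upwards [ht.eventually (gt_mem_nhds hc)] with w hw x hx
  by_contra hxV
  have h1 := hcV x hx.1 hxV
  have h2 := abs_G_sub_le (P := P) z w hx.1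
  rw [hx.2, sub_zero] at h2
  linarith

theorem exists_nhds_simple {z : ℝ × ℝ} {ζ : ℝ} (hζ : 0 < ζ) (hs : z.2 + P.q ζ ≠ 0) :
    ∃ V, IsOpen V ∧ ζ ∈ V ∧ V.OrdConnected ∧ V ⊆ Set.Ioi 0 ∧
      ∀ᶠ w in 𝓝 z, ∀ x ∈ V, w.2 + P.q x ≠ 0 := by
  have h1 : ContinuousAt (fun p : (ℝ × ℝ) × ℝ => p.1.2 + P.q p.2) (z, ζ) := by
    have hq : ContinuousAt P.q ζ := (P.hasDerivAt_q ζ hζ).continuousAt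
    have h2 : ContinuousAt (fun p : (ℝ × ℝ) × ℝ => P.q p.2) (z, ζ) :=
      ContinuousAt.comp (f := fun p : (ℝ × ℝ) × ℝ => p.2) hq continuousAt_snd
    exact (continuousAt_snd.comp continuousAt_fst).add h2
  have h2 := h1.eventually (isOpen_ne.mem_nhds hs)
  rw [nhds_prod_eq] at h2
  obtain ⟨pa, hpa, pb, hpb, h3⟩ := eventually_prod_iff.1 h2
  obtain ⟨ε, hε, hball⟩ := Metric.eventually_nhds_iff_ball.1 (hpb.and (lt_mem_nhds hζ))
  refine ⟨Metric.ball ζ ε, Metric.isOpen_ball, Metric.mem_ball_self hε,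
    (convex_ball ζ ε).ordConnected, fun x hx => (hball x hx).2, ?_⟩
  filter_upwards [hpa] with w hw x hx
  exact h3 hw (hball x hx).1

/-- `G w` has no critical point on the interval `V`, so Rolle allows at most one zero there. -/
theorem subsingleton_zeros_inter {w : ℝ × ℝ} {V : Set ℝ} (hV : V.OrdConnected)
    (hVp : V ⊆ Set.Ioi 0) (hw : ∀ x ∈ V, w.2 + P.q x ≠ 0) : (P.zeros w ∩ V).Subsingleton := by
  have key : ∀ x ∈ V, ∀ y ∈ V, x < y → P.G w x ≠ P.G w y := by
    intro x hx y hy hxy heq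
    have hin : ∀ t ∈ Set.Icc x y, t ∈ V := fun t ht => hV.out hx hy ht
    obtain ⟨t, ht, h0⟩ := exists_hasDerivAt_eq_zero hxy
      (fun t ht => (P.hasDerivAt_G w (hVp (hin t ht))).continuousAt.continuousWithinAt) heq
      (fun t ht => P.hasDerivAt_G w (hVp (hin t (Set.Ioo_subset_Icc_self ht))))
    have htV := hin t (Set.Ioo_subset_Icc_self ht)
    exact hw t htV ((mul_eq_zero.1 h0).resolve_left (P.dtau_neg t (hVp htV)).ne)
  intro x hx y hy
  rcases lt_trichotomy x y with h | h | h
  · exact (key x hx.2 y hy.2 h (hx.1.2.trans hy.1.2.symm)).elim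
  · exact h
  · exact (key y hy.2 x hx.2 h (hy.1.2.trans hx.1.2.symm)).elim

/-- Zeros of nearby `G w` stay near the zeros of `G z`, where `w.2 + q` does not vanish; hence none
of them is multiple. -/
theorem isOpen_compl_arrangement : IsOpen (arrangement P.branchDom P.branchVal)ᶜ := by
  rw [isOpen_iff_mem_nhds]
  intro z hz
  rw [Set.mem_compl_iff, mem_arrangement_iff] at hz
  push Not at hz
  obtain ⟨h0, hi, hs⟩ := hz
  have hV : ∀ ζ, ∃ V, ζ ∈ P.zeros z → IsOpen V ∧ ζ ∈ V ∧ V.OrdConnected ∧ V ⊆ Set.Ioi 0 ∧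
      ∀ᶠ w in 𝓝 z, ∀ x ∈ V, w.2 + P.q x ≠ 0 := by
    intro ζ
    by_cases hζ : ζ ∈ P.zeros z
    · obtain ⟨V, h⟩ := exists_nhds_simple hζ.1 (hs ζ hζ.1 hζ.2)
      exact ⟨V, fun _ => h⟩
    · exact ⟨∅, fun h => (hζ h).elim⟩
  choose V hV using hV
  have e1 : ∀ᶠ w in 𝓝 z, P.zeros w ⊆ ⋃ ζ ∈ P.zeros z, V ζ :=
    eventually_zeros_subset h0 hi (isOpen_biUnion fun ζ hζ => (hV ζ hζ).1)
      fun ζ hζ => Set.mem_biUnion hζ (hV ζ hζ).2.1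
  have e2 : ∀ᶠ w in 𝓝 z, ∀ ζ ∈ P.zeros z, ∀ x ∈ V ζ, w.2 + P.q x ≠ 0 :=
    (eventually_all_finite (P.finite_zeros z)).2 fun ζ hζ => (hV ζ hζ).2.2.2.2
  have c0 : Continuous P.GZero := by unfold GZero; fun_prop
  have ci : Continuous P.GInfty := by unfold GInfty; fun_prop
  filter_upwards [e1, e2, c0.continuousAt.eventually (isOpen_ne.mem_nhds h0),
    ci.continuousAt.eventually (isOpen_ne.mem_nhds hi)] with w h1 h2 h3 h4
  rw [Set.mem_compl_iff, mem_arrangement_iff]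
  rintro (h | h | ⟨x, hx, hx0, hx1⟩)
  · exact h3 h
  · exact h4 h
  · obtain ⟨ζ, hζ, hxζ⟩ := Set.mem_iUnion₂.1 (h1 ⟨hx, hx0⟩)
    exact h2 ζ hζ x hxζ hx1

theorem continuous_G (x : ℝ) : Continuous fun w => P.G w x := by
  unfold G
  fun_prop

/-- If `G z` has opposite signs at two points, all `G w` near it have a zero in between. -/
theorem exists_zero_between {w : ℝ × ℝ} {x y : ℝ} (hx : 0 < x) (hy : 0 < y)
    (h : P.G w x * P.G w y < 0) : ∃ t ∈ Set.uIcc x y, t ∈ P.zeros w := by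
  have hsub : Set.uIcc x y ⊆ Set.Ioi 0 := Set.ordConnected_Ioi.uIcc_subset hx hy
  have hmem : (0 : ℝ) ∈ Set.uIcc (P.G w x) (P.G w y) := by
    rcases mul_neg_iff.1 h with ⟨h1, h2⟩ | ⟨h1, h2⟩
    · exact Set.mem_uIcc_of_ge h2.le h1.le
    · exact Set.mem_uIcc_of_le h1.le h2.le
  obtain ⟨t, ht, h0⟩ := intermediate_value_uIcc ((P.continuousOn_G w).mono hsub) hmem
  exact ⟨t, ht, hsub ht, h0⟩

/-- `G z` has opposite signs at two points on either side of a simple zero, and these two signs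
survive small changes of `z`. -/
theorem eventually_zero_near_simple {z : ℝ × ℝ} {ζ : ℝ} (hζ : ζ ∈ P.zeros z)
    (hs : z.2 + P.q ζ ≠ 0) {V : Set ℝ} (hV : V ∈ 𝓝 ζ) :
    ∀ᶠ w in 𝓝 z, (P.zeros w ∩ V).Nonempty := by
  have hd : P.dtau ζ * (z.2 + P.q ζ) ≠ 0 := mul_ne_zero (P.dtau_neg ζ hζ.1).ne hs
  have h1 := eventually_sign_of_simple_zero (P.hasDerivAt_G z hζ.1) hζ.2 hd
  set d := P.dtau ζ * (z.2 + P.q ζ)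
  obtain ⟨ε, hε, hball⟩ := Metric.eventually_nhds_iff_ball.1
    ((eventually_nhdsWithin_iff.1 h1).and ((lt_mem_nhds hζ.1).and hV))
  have hx : ζ - ε / 2 ∈ Metric.ball ζ ε := by
    rw [Metric.mem_ball, Real.dist_eq, abs_lt]
    constructor <;> linarith
  have hy : ζ + ε / 2 ∈ Metric.ball ζ ε := by
    rw [Metric.mem_ball, Real.dist_eq, abs_lt]
    constructor <;> linarith
  have hsub : Set.uIcc (ζ - ε / 2) (ζ + ε / 2) ⊆ V := fun t ht =>
    (hball t ((convex_ball ζ ε).ordConnected.uIcc_subset hx hy ht)).2.2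
  have hx1 := (hball _ hx).1 (by simp only [Set.mem_compl_iff, Set.mem_singleton_iff]; linarith)
  have hy1 := (hball _ hy).1 (by simp only [Set.mem_compl_iff, Set.mem_singleton_iff]; linarith)
  have hneg : P.G z (ζ - ε / 2) * P.G z (ζ + ε / 2) < 0 := by
    have h2 := mul_pos hx1 hy1
    have h3 : d * ((ζ - ε / 2 - ζ) * P.G z (ζ - ε / 2)) *
        (d * ((ζ + ε / 2 - ζ) * P.G z (ζ + ε / 2))) =
        -((d * (ε / 2)) ^ 2 * (P.G z (ζ - ε / 2) * P.G z (ζ + ε / 2))) := by ring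
    rw [h3] at h2
    have h4 : 0 < (d * (ε / 2)) ^ 2 := by positivity
    by_contra hcon
    have := mul_nonneg h4.le (not_lt.1 hcon)
    linarith
  have hc : Continuous fun w => P.G w (ζ - ε / 2) * P.G w (ζ + ε / 2) :=
    (continuous_G _).mul (continuous_G _)
  filter_upwards [hc.continuousAt.eventually (gt_mem_nhds hneg)] with w hw
  obtain ⟨t, ht, htz⟩ := exists_zero_between (hball _ hx).2.1 (hball _ hy).2.1 hw
  exact ⟨t, htz, hsub ht⟩

theorem eventually_le_ncard {Z : Set ℝ} (hZ : Z.Finite) {l : Filter (ℝ × ℝ)}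
    (h : ∀ ζ ∈ Z, ∀ V ∈ 𝓝 ζ, ∀ᶠ w in l, (P.zeros w ∩ V).Nonempty) :
    ∀ᶠ w in l, Z.ncard ≤ (P.zeros w).ncard := by
  obtain ⟨V, hV, hdisj⟩ := hZ.t2_separation
  have h1 : ∀ᶠ w in l, ∀ ζ ∈ Z, (P.zeros w ∩ V ζ).Nonempty :=
    (eventually_all_finite hZ).2 fun ζ hζ => h ζ hζ _ ((hV ζ).2.mem_nhds (hV ζ).1)
  filter_upwards [h1] with w hw
  exact ncard_le_of_disjoint (P.finite_zeros w) V hdisj hw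

/-- A general filter is needed because the lemma serves both full neighbourhoods and the one-sided
approach to an envelope point, where the zeros outside `Z` disappear. -/
theorem eventually_ncard_le {z : ℝ × ℝ} (h0 : P.GZero z ≠ 0) (hi : P.GInfty z ≠ 0)
    {l : Filter (ℝ × ℝ)} (hl : l ≤ 𝓝 z) {Z : Set ℝ} (hZ : Z ⊆ P.zeros z)
    (hs : ∀ ζ ∈ Z, z.2 + P.q ζ ≠ 0)
    (hrest : ∀ ζ ∈ P.zeros z \ Z, ∃ V ∈ 𝓝 ζ, ∀ᶠ w in l, P.zeros w ∩ V = ∅) :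
    ∀ᶠ w in l, (P.zeros w).ncard ≤ Z.ncard := by
  have hZf : Z.Finite := (P.finite_zeros z).subset hZ
  have hV : ∀ ζ, ∃ V, (ζ ∈ P.zeros z → IsOpen V ∧ ζ ∈ V) ∧
      (ζ ∈ Z → ∀ᶠ w in l, (P.zeros w ∩ V).Subsingleton) ∧
      (ζ ∈ P.zeros z \ Z → ∀ᶠ w in l, P.zeros w ∩ V = ∅) := by
    intro ζ
    by_cases hζ : ζ ∈ Z
    · obtain ⟨V, hVo, hζV, hVc, hVp, h⟩ := exists_nhds_simple (hZ hζ).1 (hs ζ hζ)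
      exact ⟨V, fun _ => ⟨hVo, hζV⟩, fun _ => (h.filter_mono hl).mono fun w hw =>
        subsingleton_zeros_inter hVc hVp hw, fun h => (h.2 hζ).elim⟩
    · by_cases hζ' : ζ ∈ P.zeros z
      · obtain ⟨V, hV, h⟩ := hrest ζ ⟨hζ', hζ⟩
        refine ⟨interior V, fun _ => ⟨isOpen_interior, mem_interior_iff_mem_nhds.2 hV⟩,
          fun h => (hζ h).elim, fun _ => h.mono fun w hw => ?_⟩
        exact Set.subset_eq_empty (Set.inter_subset_inter_right _ interior_subset) hw
      · exact ⟨∅, fun h => (hζ' h).elim, fun h => (hζ h).elim, fun h => (hζ' h.1).elim⟩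
  choose V hV1 hV2 hV3 using hV
  have e1 : ∀ᶠ w in l, P.zeros w ⊆ ⋃ ζ ∈ P.zeros z, V ζ :=
    hl (eventually_zeros_subset h0 hi (isOpen_biUnion fun ζ hζ => (hV1 ζ hζ).1)
      fun ζ hζ => Set.mem_biUnion hζ (hV1 ζ hζ).2)
  have e2 : ∀ᶠ w in l, ∀ ζ ∈ Z, (P.zeros w ∩ V ζ).Subsingleton :=
    (eventually_all_finite hZf).2 hV2
  have e3 : ∀ᶠ w in l, ∀ ζ ∈ P.zeros z \ Z, P.zeros w ∩ V ζ = ∅ :=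
    (eventually_all_finite ((P.finite_zeros z).subset Set.sdiff_subset)).2 hV3
  filter_upwards [e1, e2, e3] with w h1 h2 h3
  refine ncard_le_of_cover hZf V (fun x hx => ?_) h2
  obtain ⟨ζ, hζ, hxζ⟩ := Set.mem_iUnion₂.1 (h1 hx)
  by_cases hζZ : ζ ∈ Z
  · exact Set.mem_biUnion hζZ hxζ
  · have : x ∈ P.zeros w ∩ V ζ := ⟨hx, hxζ⟩
    rw [h3 ζ ⟨hζ, hζZ⟩] at this
    exact this.elim

/-- Off the arrangement, the number of zeros is locally constant. -/
theorem eventually_ncard_eq {z : ℝ × ℝ} (hz : z ∉ arrangement P.branchDom P.branchVal) :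
    ∀ᶠ w in 𝓝 z, (P.zeros w).ncard = (P.zeros z).ncard := by
  rw [mem_arrangement_iff] at hz
  push Not at hz
  obtain ⟨h0, hi, hs⟩ := hz
  filter_upwards [eventually_ncard_le h0 hi le_rfl (subset_refl _)
    (fun ζ hζ => hs ζ hζ.1 hζ.2) (fun ζ hζ => (hζ.2 hζ.1).elim),
    eventually_le_ncard (P.finite_zeros z) fun ζ hζ V hV =>
      eventually_zero_near_simple hζ (hs ζ hζ.1 hζ.2) hV] with w h1 h2
  exact le_antisymm h1 h2

/-- At a double zero with `q' ≠ 0` the derivative of `G z` changes sign, so `G z` has a strict local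
extremum with value 0. The sign `s` is opposite to that of `dq x₀`, as `τ' < 0`. -/
theorem exists_sign_of_double_zero {z : ℝ × ℝ} {x₀ : ℝ} (hx : x₀ ∈ P.zeros z)
    (hq : z.2 + P.q x₀ = 0) (hdq : P.dq x₀ ≠ 0) :
    ∃ s : ℝ, (s = 1 ∨ s = -1) ∧ ∀ᶠ x in 𝓝[≠] x₀, 0 < x ∧ 0 < s * P.G z x := by
  have h1 := eventually_sign_of_simple_zero ((P.hasDerivAt_q x₀ hx.1).const_add z.2) hq hdq
  obtain ⟨ε, hε, hball⟩ := Metric.eventually_nhds_iff_ball.1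
    ((eventually_nhdsWithin_iff.1 h1).and (lt_mem_nhds hx.1))
  have key : ∀ x ∈ Metric.ball x₀ ε, x ≠ x₀ → P.dq x₀ * P.G z x < 0 := by
    intro x hxb hne
    have hsub : Set.uIcc x₀ x ⊆ Metric.ball x₀ ε :=
      (convex_ball x₀ ε).ordConnected.uIcc_subset (Metric.mem_ball_self hε) hxb
    -- Mean value theorem with `G z x₀ = 0`; the point `t` lies on the same side of `x₀` as `x`.
    have hmv : ∃ t ∈ Metric.ball x₀ ε, t ≠ x₀ ∧ 0 < (t - x₀) * (x - x₀) ∧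
        P.G z x = P.dtau t * (z.2 + P.q t) * (x - x₀) := by
      rcases lt_or_gt_of_ne hne with h | h
      · obtain ⟨t, ht, h2⟩ := exists_hasDerivAt_eq_slope (P.G z)
          (fun t => P.dtau t * (z.2 + P.q t)) h
          (fun t ht => (P.hasDerivAt_G z (hball t (hsub (Set.Icc_subset_uIcc'
            ht))).2).continuousAt.continuousWithinAt)
          (fun t ht => P.hasDerivAt_G z (hball t (hsub (Set.Icc_subset_uIcc'
            (Set.Ioo_subset_Icc_self ht)))).2)
        refine ⟨t, hsub (Set.Icc_subset_uIcc' (Set.Ioo_subset_Icc_self ht)), ht.2.ne,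
          mul_pos_of_neg_of_neg (by linarith [ht.2]) (by linarith), ?_⟩
        have hne' : x₀ - x ≠ 0 := sub_ne_zero.2 h.ne'
        simp only [hx.2] at h2
        rw [h2]
        field_simp
        ring
      · obtain ⟨t, ht, h2⟩ := exists_hasDerivAt_eq_slope (P.G z)
          (fun t => P.dtau t * (z.2 + P.q t)) h
          (fun t ht => (P.hasDerivAt_G z (hball t (hsub (Set.Icc_subset_uIcc
            ht))).2).continuousAt.continuousWithinAt)
          (fun t ht => P.hasDerivAt_G z (hball t (hsub (Set.Icc_subset_uIcc
            (Set.Ioo_subset_Icc_self ht)))).2)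
        refine ⟨t, hsub (Set.Icc_subset_uIcc (Set.Ioo_subset_Icc_self ht)), ht.1.ne',
          mul_pos (by linarith [ht.1]) (by linarith), ?_⟩
        have hne' : x - x₀ ≠ 0 := sub_ne_zero.2 h.ne'
        simp only [hx.2] at h2
        rw [h2]
        field_simp
        ring
    obtain ⟨t, htb, htne, htx, hG⟩ := hmv
    have h3 := (hball t htb).1 htne
    have h4 := P.dtau_neg t (hball t htb).2
    have h5 : 0 < (t - x₀) ^ 2 := by
      have := sub_ne_zero.2 htne
      positivity
    have h6 : P.dq x₀ * P.G z x * (t - x₀) ^ 2 =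
        P.dtau t * ((P.dq x₀ * ((t - x₀) * (z.2 + P.q t))) * ((t - x₀) * (x - x₀))) := by
      rw [hG]
      ring
    have h7 : P.dq x₀ * P.G z x * (t - x₀) ^ 2 < 0 := by
      rw [h6]
      exact mul_neg_of_neg_of_pos h4 (mul_pos h3 htx)
    by_contra hcon
    exact absurd (mul_nonneg (not_lt.1 hcon) h5.le) (not_le.2 h7)
  have hmem : Metric.ball x₀ ε ∈ 𝓝[≠] x₀ := nhdsWithin_le_nhds (Metric.ball_mem_nhds _ hε)
  rcases lt_or_gt_of_ne hdq with h | h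
  · refine ⟨1, Or.inl rfl, ?_⟩
    filter_upwards [hmem, self_mem_nhdsWithin] with x hxb hne
    have := key x hxb hne
    exact ⟨(hball x hxb).2, by rw [one_mul]; exact pos_of_mul_neg_right this h.le⟩
  · refine ⟨-1, Or.inr rfl, ?_⟩
    filter_upwards [hmem, self_mem_nhdsWithin] with x hxb hne
    have h1 := key x hxb hne
    have h2 := neg_of_mul_neg_right h1 h.le
    exact ⟨(hball x hxb).2, by linarith⟩

theorem G_shift (z : ℝ × ℝ) (a x : ℝ) : P.G (z.1 + a, z.2) x = P.G z x + a := by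
  simp only [G]
  ring

/-- Across a point of the envelope that is on no other branch, the number of zeros changes. -/
theorem eventually_ncard_ne {z : ℝ × ℝ} (h0 : P.GZero z ≠ 0) (hi : P.GInfty z ≠ 0) {x₀ : ℝ}
    (hx : x₀ ∈ P.zeros z) (hq : z.2 + P.q x₀ = 0) (hdq : P.dq x₀ ≠ 0)
    (huniq : ∀ x ∈ P.zeros z, z.2 + P.q x = 0 → x = x₀) :
    ∀ᶠ ε in 𝓝[>] (0 : ℝ), (P.zeros (z.1 + ε, z.2)).ncard ≠ (P.zeros (z.1 - ε, z.2)).ncard := by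
  obtain ⟨s, hs, hsG⟩ := exists_sign_of_double_zero hx hq hdq
  have hss : s * s = 1 := by rcases hs with rfl | rfl <;> norm_num
  have htend : ∀ r : ℝ, Tendsto (fun ε : ℝ => ((z.1 + r * ε, z.2) : ℝ × ℝ)) (𝓝[>] 0) (𝓝 z) := by
    intro r
    have hc : Continuous (fun ε : ℝ => ((z.1 + r * ε, z.2) : ℝ × ℝ)) := by fun_prop
    have := hc.tendsto 0
    simp only [mul_zero, add_zero, Prod.mk.eta] at this
    exact this.mono_left nhdsWithin_le_nhds
  have hsimple : ∀ ζ ∈ P.zeros z \ {x₀}, z.2 + P.q ζ ≠ 0 := fun ζ hζ h =>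
    hζ.2 (huniq ζ hζ.1 h)
  -- Shifting `G z` by `s ε` pushes it away from zero near `x₀`, so at most the other zeros remain.
  have hup : ∀ᶠ ε in 𝓝[>] (0 : ℝ),
      (P.zeros (z.1 + s * ε, z.2)).ncard ≤ (P.zeros z \ {x₀}).ncard := by
    refine (tendsto_map (f := fun ε : ℝ => ((z.1 + s * ε, z.2) : ℝ × ℝ)) (x := 𝓝[>] 0)).eventually
      (eventually_ncard_le h0 hi (htend s) Set.sdiff_subset hsimple ?_)
    rintro ζ ⟨hζ, hζ'⟩
    have hζx : ζ = x₀ := by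
      by_contra hne
      exact hζ' ⟨hζ, hne⟩
    subst hζx
    refine ⟨_, eventually_nhdsWithin_iff.1 hsG, ?_⟩
    rw [eventually_map]
    filter_upwards [self_mem_nhdsWithin] with ε hε
    have hε' : 0 < ε := hε
    refine Set.eq_empty_of_forall_notMem ?_
    rintro x ⟨hx1, hx2⟩
    have h3 := hx1.2
    rw [G_shift] at h3
    have h4 : 0 ≤ s * P.G z x := by
      by_cases hxx : x = ζ
      · rw [hxx, hx.2, mul_zero]
      · exact (hx2 hxx).2.le
    have h5 : s * P.G z x + s * s * ε = 0 := by linear_combination s * h3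
    rw [hss] at h5
    linarith
  -- Shifting by `-s ε` creates a zero near `x₀`. One of the two new zeros already makes the count
  -- exceed that on the other side.
  have hlow : ∀ᶠ ε in 𝓝[>] (0 : ℝ),
      (P.zeros z).ncard ≤ (P.zeros (z.1 + -s * ε, z.2)).ncard := by
    refine (tendsto_map (f := fun ε : ℝ => ((z.1 + -s * ε, z.2) : ℝ × ℝ))
      (x := 𝓝[>] 0)).eventually (eventually_le_ncard (P.finite_zeros z) ?_)
    intro ζ hζ V hV
    by_cases hζx : ζ = x₀
    · subst hζx
      rw [eventually_map]
      obtain ⟨r, hr, hball⟩ := Metric.eventually_nhds_iff_ball.1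
        ((eventually_nhdsWithin_iff.1 hsG).and hV)
      have hy : ζ + r / 2 ∈ Metric.ball ζ r := by
        rw [Metric.mem_ball, Real.dist_eq, abs_lt]
        constructor <;> linarith
      obtain ⟨hypos, hyG⟩ := (hball _ hy).1
        (by simp only [Set.mem_compl_iff, Set.mem_singleton_iff]; linarith)
      have hsub : Set.uIcc ζ (ζ + r / 2) ⊆ V := fun t ht => (hball t
        ((convex_ball ζ r).ordConnected.uIcc_subset (Metric.mem_ball_self hr) hy ht)).2
      filter_upwards [Ioo_mem_nhdsGT hyG] with ε hε
      obtain ⟨t, ht, htz⟩ := exists_zero_between (P := P) (w := (z.1 + -s * ε, z.2)) hx.1 hypos (by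
        rw [G_shift, G_shift, hx.2]
        have h6 : (0 + -s * ε) * (P.G z (ζ + r / 2) + -s * ε) =
          -(ε * (s * P.G z (ζ + r / 2) - s * s * ε)) := by ring
        rw [h6, hss, one_mul]
        exact neg_neg_of_pos (mul_pos hε.1 (sub_pos.2 hε.2)))
      exact ⟨t, htz, hsub ht⟩
    · exact (htend (-s)) (eventually_zero_near_simple hζ (hsimple ζ ⟨hζ, hζx⟩) hV)
  filter_upwards [hup, hlow] with ε h1 h2
  have h3 : (P.zeros z \ {x₀}).ncard < (P.zeros z).ncard :=
    Set.ncard_sdiff_singleton_lt_of_mem hx (P.finite_zeros z)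
  have h4 : (P.zeros (z.1 + s * ε, z.2)).ncard < (P.zeros (z.1 + -s * ε, z.2)).ncard :=
    (h1.trans_lt h3).trans_le h2
  rcases hs with rfl | rfl
  · simp only [one_mul, neg_mul, ← sub_eq_add_neg] at h4
    exact h4.ne
  · simp only [neg_neg, one_mul, neg_mul, ← sub_eq_add_neg] at h4
    exact h4.ne'

end Profile

/-! ## Shapes from sign changes of the derivative -/

/-- `Z` is the set of zeros of `ψ` on `(0, ∞)`, and `ψ` changes sign at each of them. -/
structure SignChanges (ψ : ℝ → ℝ) (Z : Finset ℝ) : Prop where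
  continuousOn : ContinuousOn ψ (Set.Ioi 0)
  mem_iff : ∀ x, x ∈ Z ↔ 0 < x ∧ ψ x = 0
  change : ∀ ζ ∈ Z, ∃ d : ℝ, ∀ᶠ y in 𝓝[≠] ζ, 0 < d * ((y - ζ) * ψ y)

namespace SignChanges

variable {ψ : ℝ → ℝ} {Z : Finset ℝ}

theorem mul_pos_of_forall_notMem (h : SignChanges ψ Z) {x y : ℝ} (hx : 0 < x) (hxy : x ≤ y)
    (hZ : ∀ t ∈ Set.Icc x y, t ∉ Z) : 0 < ψ x * ψ y := by
  have hne : ∀ t ∈ Set.Icc x y, ψ t ≠ 0 := fun t ht h0 =>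
    hZ t ht ((h.mem_iff t).2 ⟨hx.trans_le ht.1, h0⟩)
  have hx0 := hne x (Set.left_mem_Icc.2 hxy)
  have hy0 := hne y (Set.right_mem_Icc.2 hxy)
  by_contra hcon
  have hneg : ψ x * ψ y < 0 := lt_of_le_of_ne (not_lt.1 hcon) (mul_ne_zero hx0 hy0)
  have hmem : (0 : ℝ) ∈ Set.uIcc (ψ x) (ψ y) := by
    rcases mul_neg_iff.1 hneg with ⟨h1, h2⟩ | ⟨h1, h2⟩
    · exact Set.mem_uIcc_of_ge h2.le h1.le
    · exact Set.mem_uIcc_of_le h1.le h2.le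
  have hsub : Set.uIcc x y ⊆ Set.Ioi 0 :=
    Set.ordConnected_Ioi.uIcc_subset hx (Set.mem_Ioi.2 (hx.trans_le hxy))
  obtain ⟨t, ht, h0⟩ := intermediate_value_uIcc (h.continuousOn.mono hsub) hmem
  rw [Set.uIcc_of_le hxy] at ht
  exact hne t ht h0

/-- Around a zero there is a punctured ball in `(0, ∞)` on which the sign is known. -/
theorem exists_radius (h : SignChanges ψ Z) {ζ b : ℝ} (hζ : ζ ∈ Z) (hb : 0 < b) :
    ∃ r d : ℝ, 0 < r ∧ r < b ∧ r < ζ ∧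
      ∀ y, |y - ζ| ≤ r → y ≠ ζ → 0 < d * ((y - ζ) * ψ y) ∧ y ∉ Z := by
  obtain ⟨d, hd⟩ := h.change ζ hζ
  obtain ⟨ε, hε, hball⟩ := Metric.eventually_nhds_iff_ball.1 (eventually_nhdsWithin_iff.1 hd)
  have hζ0 := ((h.mem_iff ζ).1 hζ).1
  have hm : 0 < min ε (min b ζ) := lt_min hε (lt_min hb hζ0)
  refine ⟨min ε (min b ζ) / 2, d, half_pos hm, (half_lt_self hm).trans_le
    ((min_le_right _ _).trans (min_le_left _ _)), (half_lt_self hm).trans_le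
    ((min_le_right _ _).trans (min_le_right _ _)), fun y hy hne => ?_⟩
  have h1 : 0 < d * ((y - ζ) * ψ y) := by
    refine hball y ?_ hne
    rw [Metric.mem_ball, Real.dist_eq]
    exact hy.trans_lt ((half_lt_self hm).trans_le (min_le_left _ _))
  refine ⟨h1, fun hyZ => ?_⟩
  rw [((h.mem_iff y).1 hyZ).2, mul_zero, mul_zero] at h1
  exact lt_irrefl _ h1

/-- The sign of `ψ` after `n` zeros is `(-1) ^ n` times its initial sign. -/
theorem sign_formula (h : SignChanges ψ Z) {s : ℝ} (hs : ∀ᶠ x in 𝓝[>] 0, 0 < s * ψ x) :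
    ∀ (n : ℕ) (x : ℝ), 0 < x → x ∉ Z → (Z.filter (· < x)).card = n →
      0 < s * (-1) ^ n * ψ x := by
  intro n
  induction n with
  | zero =>
    intro x hx hxZ hcard
    rw [Finset.card_eq_zero] at hcard
    obtain ⟨y, hy, hyx⟩ := (hs.and (Ioo_mem_nhdsGT hx)).exists
    have h1 := h.mul_pos_of_forall_notMem hyx.1 hyx.2.le fun t ht htZ => by
      rcases ht.2.eq_or_lt with rfl | hlt
      · exact hxZ htZ
      · have : t ∈ Z.filter (· < x) := Finset.mem_filter.2 ⟨htZ, hlt⟩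
        rw [hcard] at this
        exact absurd this (Finset.notMem_empty t)
    rw [pow_zero, mul_one]
    have h2 : s * ψ x * (ψ y) ^ 2 = s * ψ y * (ψ y * ψ x) := by ring
    have h3 : 0 < s * ψ x * (ψ y) ^ 2 := h2 ▸ mul_pos hy h1
    exact pos_of_mul_pos_left h3 (sq_nonneg _)
  | succ n ih =>
    intro x hx hxZ hcard
    have hne : (Z.filter (· < x)).Nonempty := by
      rw [← Finset.card_pos, hcard]
      exact Nat.succ_pos n
    set ζ := (Z.filter (· < x)).max' hne with hζdef
    obtain ⟨hζZ, hζx⟩ := Finset.mem_filter.1 ((Z.filter (· < x)).max'_mem hne)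
    obtain ⟨r, d, hr, hrx, hrζ, hsign⟩ := h.exists_radius hζZ (sub_pos.2 hζx)
    have hcardζ : (Z.filter (· < x)) = insert ζ (Z.filter (· < ζ)) := by
      ext t
      simp only [Finset.mem_filter, Finset.mem_insert]
      constructor
      · rintro ⟨ht, htx⟩
        rcases ((Z.filter (· < x)).le_max' t (Finset.mem_filter.2 ⟨ht, htx⟩)).eq_or_lt with h | h
        · exact Or.inl h
        · exact Or.inr ⟨ht, h⟩
      · rintro (rfl | ⟨ht, htζ⟩)
        · exact ⟨hζZ, hζx⟩
        · exact ⟨ht, htζ.trans hζx⟩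
    have hfilter : Z.filter (· < ζ - r) = Z.filter (· < ζ) := by
      ext t
      simp only [Finset.mem_filter, and_congr_right_iff]
      intro htZ
      refine ⟨fun ht => by linarith, fun ht => ?_⟩
      by_contra hcon
      refine (hsign t ?_ ht.ne).2 htZ
      rw [abs_le]
      constructor <;> linarith [not_lt.1 hcon]
    have hcard' : (Z.filter (· < ζ - r)).card = n := by
      rw [hfilter]
      rw [hcardζ, Finset.card_insert_of_notMem (by simp)] at hcard
      exact Nat.succ.inj hcard
    obtain ⟨hl, hlZ⟩ := hsign (ζ - r) (by rw [abs_le]; constructor <;> linarith) (by linarith)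
    obtain ⟨hr', hrZ⟩ := hsign (ζ + r) (by rw [abs_le]; constructor <;> linarith) (by linarith)
    have h1 := ih (ζ - r) (by linarith) hlZ hcard'
    have h2 : 0 < ψ (ζ + r) * ψ x := by
      refine h.mul_pos_of_forall_notMem (by linarith) (by linarith) fun t ht htZ => ?_
      rcases ht.2.eq_or_lt with rfl | hlt
      · exact hxZ htZ
      · have := (Z.filter (· < x)).le_max' t (Finset.mem_filter.2 ⟨htZ, hlt⟩)
        rw [← hζdef] at this
        linarith [ht.1]
    have e1 : d * ((ζ - r - ζ) * ψ (ζ - r)) = r * -(d * ψ (ζ - r)) := by ring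
    have e2 : d * ((ζ + r - ζ) * ψ (ζ + r)) = r * (d * ψ (ζ + r)) := by ring
    rw [e1] at hl
    rw [e2] at hr'
    have h3 := pos_of_mul_pos_right hl hr.le
    have h4 := pos_of_mul_pos_right hr' hr.le
    -- Multiplying by a square eliminates the unknown `d`: the sign before the zero, the change
    -- across it, and the constant sign from `ζ + r` to `x` combine.
    have h5 : s * (-1) ^ (n + 1) * ψ x * (d * ψ (ζ - r) * ψ (ζ + r)) ^ 2 =
        (s * (-1) ^ n * ψ (ζ - r)) * -(d * ψ (ζ - r)) * (d * ψ (ζ + r)) *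
          (ψ (ζ + r) * ψ x) := by
      ring
    have h6 : 0 < s * (-1) ^ (n + 1) * ψ x * (d * ψ (ζ - r) * ψ (ζ + r)) ^ 2 :=
      h5 ▸ mul_pos (mul_pos (mul_pos h1 h3) h4) h2
    exact pos_of_mul_pos_left h6 (sq_nonneg _)

theorem card_filter_lt_orderEmb (Z : Finset ℝ) (k : Fin Z.card) :
    (Z.filter (· < Z.orderEmbOfFin rfl k)).card = k := by
  have : Z.filter (· < Z.orderEmbOfFin rfl k) =
      (Finset.univ.filter (· < k)).map (Z.orderEmbOfFin rfl).toEmbedding := by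
    ext t
    simp only [Finset.mem_filter, Finset.mem_map, Finset.mem_univ, true_and,
      RelEmbedding.coe_toEmbedding]
    constructor
    · rintro ⟨ht, hlt⟩
      have : t ∈ Set.range (Z.orderEmbOfFin rfl) := by
        rw [Finset.range_orderEmbOfFin]
        exact ht
      obtain ⟨j, rfl⟩ := this
      exact ⟨j, (Z.orderEmbOfFin rfl).lt_iff_lt.1 hlt, rfl⟩
    · rintro ⟨j, hj, rfl⟩
      exact ⟨Finset.orderEmbOfFin_mem Z rfl j, (Z.orderEmbOfFin rfl).lt_iff_lt.2 hj⟩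
  have hIio : Finset.univ.filter (· < k) = Finset.Iio k := by
    ext j
    simp
  rw [this, Finset.card_map, hIio, Fin.card_Iio]

/-- The sign `1` for increasing and `-1` for decreasing. -/
def risingSign (b : Bool) : ℝ := if b then 1 else -1

/-- The alternating sequence of `n` humps and dips that begins with a hump if the curve is
initially rising. -/
def alternating (b : Bool) (n : ℕ) : List Extremum :=
  List.ofFn fun k : Fin n => if b = decide (Even (k : ℕ)) then Extremum.hump else Extremum.dip

theorem length_alternating (b : Bool) (n : ℕ) : (alternating b n).length = n :=
  List.length_ofFn

theorem isAt (h : SignChanges ψ Z) {φ : ℝ → ℝ} (hφ : ∀ x, 0 < x → HasDerivAt φ (ψ x) x)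
    {b : Bool} (hb : ∀ᶠ x in 𝓝[>] 0, 0 < risingSign b * ψ x) (k : Fin Z.card) :
    Extremum.IsAt (if b = decide (Even (k : ℕ)) then Extremum.hump else Extremum.dip) φ
      (Z.orderEmbOfFin rfl k) := by
  set ζ := Z.orderEmbOfFin rfl k with hζ
  have hζZ : ζ ∈ Z := Finset.orderEmbOfFin_mem Z rfl k
  have hcard : (Z.filter (· < ζ)).card = k := card_filter_lt_orderEmb Z k
  obtain ⟨r, d, hr, -, hrζ, hsign⟩ := h.exists_radius hζZ one_pos
  have hζ0 : 0 < ζ := hr.trans hrζ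
  have hleft : ∀ y ∈ Set.Ioo (ζ - r) ζ, 0 < risingSign b * (-1) ^ (k : ℕ) * ψ y := by
    intro y hy
    refine h.sign_formula hb k y (by linarith [hy.1])
      (hsign y (by rw [abs_le]; constructor <;> linarith [hy.1, hy.2]) hy.2.ne).2 ?_
    rw [← hcard]
    congr 1
    ext t
    simp only [Finset.mem_filter, and_congr_right_iff]
    intro htZ
    refine ⟨fun ht => ht.trans hy.2, fun ht => ?_⟩
    by_contra hcon
    refine (hsign t ?_ ht.ne).2 htZ
    rw [abs_le]
    constructor <;> linarith [not_lt.1 hcon, hy.1]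
  have hright : ∀ y ∈ Set.Ioo ζ (ζ + r), risingSign b * (-1) ^ (k : ℕ) * ψ y < 0 := by
    intro y hy
    have := h.sign_formula hb (k + 1) y (hζ0.trans hy.1)
      (hsign y (by rw [abs_le]; constructor <;> linarith [hy.1, hy.2]) hy.1.ne').2 (by
        have hins : Z.filter (· < y) = insert ζ (Z.filter (· < ζ)) := by
          ext t
          simp only [Finset.mem_filter, Finset.mem_insert]
          constructor
          · rintro ⟨htZ, hty⟩
            rcases lt_trichotomy t ζ with h1 | h1 | h1
            · exact Or.inr ⟨htZ, h1⟩
            · exact Or.inl h1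
            · refine ((hsign t ?_ h1.ne').2 htZ).elim
              rw [abs_le]
              constructor <;> linarith [hy.2]
          · rintro (rfl | ⟨htZ, ht⟩)
            · exact ⟨hζZ, hy.1⟩
            · exact ⟨htZ, ht.trans hy.1⟩
        rw [hins, Finset.card_insert_of_notMem (by simp), hcard])
    rw [pow_succ] at this
    linarith
  have hd : ∀ y, 0 < y → deriv φ y = ψ y := fun y hy => (hφ y hy).deriv
  have hdl : DifferentiableOn ℝ φ (Set.Ioo (ζ - r) ζ) := fun y hy =>
    (hφ y (by linarith [hy.1])).differentiableAt.differentiableWithinAt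
  have hdr : DifferentiableOn ℝ φ (Set.Ioo ζ (ζ + r)) := fun y hy =>
    (hφ y (hζ0.trans hy.1)).differentiableAt.differentiableWithinAt
  have hsgn : risingSign b * (-1) ^ (k : ℕ) =
      if b = decide (Even (k : ℕ)) then 1 else -1 := by
    rcases Nat.even_or_odd (k : ℕ) with he | ho
    · rw [he.neg_one_pow]
      cases b <;> simp [risingSign, he]
    · have hne : ¬ Even (k : ℕ) := Nat.not_even_iff_odd.2 ho
      rw [ho.neg_one_pow]
      cases b <;> simp [risingSign, hne]
  rw [hsgn] at hleft hright
  split_ifs at hleft hright ⊢ with hif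
  · refine isLocalMax_of_deriv_Ioo (sub_lt_self ζ hr) (lt_add_of_pos_right ζ hr)
      (hφ ζ hζ0).continuousAt hdl hdr (fun y hy => ?_) fun y hy => ?_
    · rw [hd y (by linarith [hy.1])]
      linarith [hleft y hy]
    · rw [hd y (hζ0.trans hy.1)]
      linarith [hright y hy]
  · refine isLocalMin_of_deriv_Ioo (sub_lt_self ζ hr) (lt_add_of_pos_right ζ hr)
      (hφ ζ hζ0).continuousAt hdl hdr (fun y hy => ?_) fun y hy => ?_
    · rw [hd y (by linarith [hy.1])]
      linarith [hleft y hy]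
    · rw [hd y (hζ0.trans hy.1)]
      linarith [hright y hy]

/-- The shape of a curve is determined by its initial direction and the number of zeros of its
derivative, if the derivative changes sign at each of them. -/
theorem hasShape (h : SignChanges ψ Z) {φ : ℝ → ℝ} (hφ : ∀ x, 0 < x → HasDerivAt φ (ψ x) x)
    {b : Bool} (hb : ∀ᶠ x in 𝓝[>] 0, 0 < risingSign b * ψ x) :
    HasShape φ ⟨b, alternating b Z.card⟩ := by
  constructor
  · obtain ⟨ε, hε, hsub⟩ := mem_nhdsGT_iff_exists_Ioo_subset.1 hb
    have hcont : ContinuousOn φ (Set.Ioo 0 ε) := fun y hy =>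
      (hφ y hy.1).continuousAt.continuousWithinAt
    refine ⟨ε, hε, fun hbt => ?_, fun hbf => ?_⟩
    · refine strictMonoOn_of_deriv_pos (convex_Ioo 0 ε) hcont fun y hy => ?_
      rw [interior_Ioo] at hy
      rw [(hφ y hy.1).deriv]
      have h1 : 0 < risingSign b * ψ y := hsub hy
      have h2 : b = true := hbt
      simpa [risingSign, h2] using h1
    · refine strictAntiOn_of_deriv_neg (convex_Ioo 0 ε) hcont fun y hy => ?_
      rw [interior_Ioo] at hy
      rw [(hφ y hy.1).deriv]
      have h1 : 0 < risingSign b * ψ y := hsub hy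
      have h2 : b = false := hbf
      simpa [risingSign, h2] using h1
  · have hlen := length_alternating b Z.card
    refine ⟨fun k => Z.orderEmbOfFin rfl (Fin.cast hlen k), ?_, ?_, ?_, ?_⟩
    · intro j k hjk
      exact (Z.orderEmbOfFin rfl).lt_iff_lt.2 hjk
    · intro k
      exact ((h.mem_iff _).1 (Finset.orderEmbOfFin_mem Z rfl _)).1
    · intro k
      have hget : (alternating b Z.card).get k =
          if b = decide (Even (Fin.cast hlen k : ℕ)) then Extremum.hump else Extremum.dip := by
        exact List.get_ofFn _ _
      simp only [hget]
      exact h.isAt hφ hb _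
    · intro y hy hext
      have hyZ : y ∈ Z := (h.mem_iff y).2 ⟨hy, hext.hasDerivAt_eq_zero (hφ y hy)⟩
      have : y ∈ Set.range (Z.orderEmbOfFin rfl) := by
        rw [Finset.range_orderEmbOfFin]
        exact hyZ
      obtain ⟨j, hj⟩ := this
      exact ⟨Fin.cast hlen.symm j, hj⟩

end SignChanges

/-! ### Shapes of curves off the arrangement -/

namespace Profile

variable {P : Profile} {z : ℝ × ℝ}

open SignChanges

theorem signChanges_mul (hz : z ∉ arrangement P.branchDom P.branchVal) {w : ℝ → ℝ}
    (hw : ContinuousOn w (Set.Ioi 0)) (hneg : ∀ x, 0 < x → w x < 0) :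
    SignChanges (fun x => w x * P.G z x) (P.finite_zeros z).toFinset where
  continuousOn := hw.mul (P.continuousOn_G z)
  mem_iff x := by
    rw [Set.Finite.mem_toFinset]
    refine and_congr_right fun hx => ?_
    simp [(hneg x hx).ne]
  change ζ hζ := by
    rw [Set.Finite.mem_toFinset] at hζ
    rw [mem_arrangement_iff] at hz
    push Not at hz
    have h1 := eventually_sign_of_simple_zero (P.hasDerivAt_G z hζ.1) hζ.2
      (mul_ne_zero (P.dtau_neg ζ hζ.1).ne (hz.2.2 ζ hζ.1 hζ.2))
    refine ⟨-(P.dtau ζ * (z.2 + P.q ζ)), ?_⟩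
    filter_upwards [h1, nhdsWithin_le_nhds (lt_mem_nhds hζ.1)] with y hy hpos
    have := mul_pos_of_neg_of_neg (hneg y hpos) (neg_neg_of_pos hy)
    linarith

/-- `G z` flips its sign at each zero, so the signs at the two ends determine the parity of the
number of zeros. -/
theorem GZero_mul_GInfty_pos (hz : z ∉ arrangement P.branchDom P.branchVal) :
    0 < P.GZero z * (-1) ^ (P.zeros z).ncard * P.GInfty z := by
  -- The weight `-1` is a device to reuse `signChanges_mul`, which expects a negative factor; the
  -- sign `-GZero` compensates for it.
  have hsc := signChanges_mul hz (w := fun _ => -1) continuousOn_const (fun _ _ => by norm_num)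
  rw [mem_arrangement_iff] at hz
  push Not at hz
  obtain ⟨h0, hi, -⟩ := hz
  have hs : ∀ᶠ x in 𝓝[>] 0, 0 < -P.GZero z * (-1 * P.G z x) := by
    have h1 : Tendsto (fun x => P.GZero z * P.G z x) (𝓝[>] 0) (𝓝 (P.GZero z * P.GZero z)) :=
      (P.tendsto_G_zero z).const_mul _
    filter_upwards [h1.eventually (lt_mem_nhds (mul_self_pos.2 h0))] with x hx
    linarith
  have hne : P.GZero z * (-1) ^ (P.zeros z).ncard * P.GInfty z ≠ 0 := by
    simp [h0, hi]
  refine lt_of_le_of_ne ?_ hne.symm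
  have h2 : Tendsto (fun x => P.GZero z * (-1) ^ (P.zeros z).ncard * P.G z x) atTop
      (𝓝 (P.GZero z * (-1) ^ (P.zeros z).ncard * P.GInfty z)) :=
    (P.tendsto_G_infty z).const_mul _
  refine ge_of_tendsto h2 ?_
  filter_upwards [eventually_gt_atTop 0,
    (eventually_all_finset (P.finite_zeros z).toFinset).2 fun t _ => eventually_gt_atTop t]
    with x hx hxt
  have hx1 : x ∉ (P.finite_zeros z).toFinset := fun h => lt_irrefl _ (hxt x h)
  have h3 := hsc.sign_formula hs _ x hx hx1 rfl
  have h4 : (P.finite_zeros z).toFinset.filter (· < x) = (P.finite_zeros z).toFinset :=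
    Finset.filter_true_of_mem hxt
  rw [h4, ← Set.ncard_eq_toFinset_card _ (P.finite_zeros z)] at h3
  linarith

theorem hasShape (hz : z ∉ arrangement P.branchDom P.branchVal) {w φ : ℝ → ℝ}
    (hw : ContinuousOn w (Set.Ioi 0)) (hneg : ∀ x, 0 < x → w x < 0)
    (hφ : ∀ x, 0 < x → HasDerivAt φ (w x * P.G z x) x) :
    HasShape φ ⟨decide (P.GZero z < 0),
      alternating (decide (P.GZero z < 0)) (P.zeros z).ncard⟩ := by
  rw [Set.ncard_eq_toFinset_card _ (P.finite_zeros z)]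
  refine (signChanges_mul hz hw hneg).hasShape hφ ?_
  rw [mem_arrangement_iff] at hz
  push Not at hz
  rcases lt_or_gt_of_ne hz.1 with h | h
  · filter_upwards [(P.tendsto_G_zero z).eventually (gt_mem_nhds h), self_mem_nhdsWithin]
      with x hx hpos
    have := mul_pos_of_neg_of_neg (hneg x hpos) hx
    simpa [risingSign, h] using this
  · filter_upwards [(P.tendsto_G_zero z).eventually (lt_mem_nhds h), self_mem_nhdsWithin]
      with x hx hpos
    have := mul_neg_of_neg_of_pos (hneg x hpos) hx
    simpa [risingSign, h.not_gt] using this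

end Profile

/-! ## Curves whose derivatives are given by a family of lines -/

/-- The derivative of `x ↦ g x z` is a negative multiple of the family of lines `P`. -/
structure IsCurve (P : Profile) (g : ℝ → ℝ × ℝ → ℝ) (w dw : ℝ → ℝ) : Prop where
  neg : ∀ x, 0 < x → w x < 0
  hasDerivAt_w : ∀ x, 0 < x → HasDerivAt w (dw x) x
  hasDerivAt : ∀ z x, 0 < x → HasDerivAt (fun y => g y z) (w x * P.G z x) x

namespace IsCurve

variable {P : Profile} {g : ℝ → ℝ × ℝ → ℝ} {w dw : ℝ → ℝ}

theorem lineFun_eq (h : IsCurve P g w dw) {x : ℝ} (hx : 0 < x) (z : ℝ × ℝ) :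
    lineFun g x z = w x * P.G z x := (h.hasDerivAt z x hx).deriv

/-- The weight `w` cancels up to its negative sign, so limits of the normalized coefficients reduce
to limits of `τ` and `G`. -/
theorem normalized_eq (h : IsCurve P g w dw) {x : ℝ} (hx : 0 < x) (z : ℝ × ℝ) :
    lineFun g x z / Real.sqrt (coeffB g x ^ 2 + coeffC g x ^ 2) =
      -P.G z x / Real.sqrt (1 + P.tau x ^ 2) := by
  have hw := h.neg x hx
  have hb : coeffB g x = w x := by
    simp only [coeffB, h.lineFun_eq hx, Profile.G]
    ring
  have hc : coeffC g x = w x * P.tau x := by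
    simp only [coeffC, h.lineFun_eq hx, Profile.G]
    ring
  have hs : coeffB g x ^ 2 + coeffC g x ^ 2 = (-w x) ^ 2 * (1 + P.tau x ^ 2) := by
    rw [hb, hc]
    ring
  rw [hs, Real.sqrt_mul (sq_nonneg _), Real.sqrt_sq (neg_pos.2 hw).le, h.lineFun_eq hx]
  have h1 : 0 < Real.sqrt (1 + P.tau x ^ 2) := Real.sqrt_pos.2 (by positivity)
  have h2 : w x ≠ 0 := hw.ne
  field_simp

theorem mem_limitLine_iff (h : IsCurve P g w dw) {l : Filter ℝ} [l.NeBot]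
    (hl : ∀ᶠ x in l, 0 < x) {z : ℝ × ℝ} {t L : ℝ} (htau : Tendsto P.tau l (𝓝 t))
    (hG : Tendsto (P.G z) l (𝓝 L)) : z ∈ limitLine g l ↔ L = 0 := by
  have h0 : Real.sqrt (1 + t ^ 2) ≠ 0 := (Real.sqrt_pos.2 (by positivity)).ne'
  have h1 : Tendsto (fun x => lineFun g x z / Real.sqrt (coeffB g x ^ 2 + coeffC g x ^ 2)) l
      (𝓝 (-L / Real.sqrt (1 + t ^ 2))) := by
    have h2 : Tendsto (fun x => -P.G z x / Real.sqrt (1 + P.tau x ^ 2)) l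
        (𝓝 (-L / Real.sqrt (1 + t ^ 2))) :=
      hG.neg.div ((htau.pow 2).const_add 1).sqrt h0
    exact h2.congr' (hl.mono fun x hx => (h.normalized_eq hx z).symm)
  constructor
  · intro hz
    have := tendsto_nhds_unique h1 hz
    rw [div_eq_zero_iff, neg_eq_zero] at this
    exact this.resolve_right h0
  · rintro rfl
    simpa [limitLine] using h1

theorem eventually_pos_nhdsGT : ∀ᶠ x : ℝ in 𝓝[>] 0, 0 < x := self_mem_nhdsWithin

theorem mem_lineZero_iff (h : IsCurve P g w dw) {z : ℝ × ℝ} :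
    z ∈ lineZero g ↔ P.GZero z = 0 :=
  h.mem_limitLine_iff eventually_pos_nhdsGT P.tendsto_tau_zero (P.tendsto_G_zero z)

theorem mem_lineInfty_iff (h : IsCurve P g w dw) {z : ℝ × ℝ} :
    z ∈ lineInfty g ↔ P.GInfty z = 0 :=
  h.mem_limitLine_iff (eventually_gt_atTop 0) P.tendsto_tau_infty (P.tendsto_G_infty z)

/-- Where `G` vanishes, the term with the derivative of `w` drops out; `w` and `dtau` have no zeros.
-/
theorem mem_envelopeAt_iff (h : IsCurve P g w dw) {x : ℝ} (hx : 0 < x) {z : ℝ × ℝ} :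
    z ∈ envelopeAt g x ↔ P.G z x = 0 ∧ z.2 + P.q x = 0 := by
  have h1 : HasDerivAt (fun y => lineFun g y z)
      (dw x * P.G z x + w x * (P.dtau x * (z.2 + P.q x))) x := by
    refine ((h.hasDerivAt_w x hx).mul (P.hasDerivAt_G z hx)).congr_of_eventuallyEq ?_
    filter_upwards [lt_mem_nhds hx] with y hy
    exact h.lineFun_eq hy z
  have hw := (h.neg x hx).ne
  have ht := (P.dtau_neg x hx).ne
  simp only [envelopeAt, Set.mem_ofPred_eq, h1.deriv, h.lineFun_eq hx]
  constructor
  · rintro ⟨h2, h3⟩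
    have h4 := (mul_eq_zero.1 h2).resolve_left hw
    rw [h4, mul_zero, zero_add] at h3
    exact ⟨h4, (mul_eq_zero.1 ((mul_eq_zero.1 h3).resolve_left hw)).resolve_left ht⟩
  · rintro ⟨h2, h3⟩
    simp [h2, h3]

theorem envelopeAt_eq (h : IsCurve P g w dw) {x : ℝ} (hx : 0 < x) :
    envelopeAt g x = {(P.env x, -P.q x)} := by
  ext z
  rw [h.mem_envelopeAt_iff hx, Set.mem_singleton_iff]
  constructor
  · rintro ⟨h1, h2⟩
    have hq : z.2 = -P.q x := by linarith
    exact Prod.ext ((Profile.G_eq_zero_iff hq).1 h1) hq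
  · rintro rfl
    exact ⟨(Profile.G_eq_zero_iff rfl).2 rfl, by simp⟩

theorem mem_envelope_iff (h : IsCurve P g w dw) {z : ℝ × ℝ} :
    z ∈ envelope g ↔ ∃ x, 0 < x ∧ P.G z x = 0 ∧ z.2 + P.q x = 0 := by
  simp only [envelope, Set.mem_iUnion, Set.mem_Ioi]
  constructor
  · rintro ⟨x, hx, hz⟩
    exact ⟨x, hx, (h.mem_envelopeAt_iff hx).1 hz⟩
  · rintro ⟨x, hx, hz⟩
    exact ⟨x, hx, (h.mem_envelopeAt_iff hx).2 hz⟩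

theorem exists_lineZero_inter_lineInfty (h : IsCurve P g w dw) :
    ∃ M, P.GZero M = 0 ∧ P.GInfty M = 0 ∧ lineZero g ∩ lineInfty g = {M} := by
  have ht : P.tauZero - P.tauInfty ≠ 0 := (sub_pos.2 P.tauInfty_lt_tauZero).ne'
  set m := (P.hInfty - P.hZero) / (P.tauZero - P.tauInfty) with hm
  have hmt : m * (P.tauZero - P.tauInfty) = P.hInfty - P.hZero := div_mul_cancel₀ _ ht
  have h1 : P.GZero (-(m * P.tauZero + P.hZero), m) = 0 := by
    simp only [Profile.GZero]
    ring
  have h2 : P.GInfty (-(m * P.tauZero + P.hZero), m) = 0 := by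
    simp only [Profile.GInfty]
    linarith
  refine ⟨_, h1, h2, ?_⟩
  ext z
  rw [Set.mem_inter_iff, h.mem_lineZero_iff, h.mem_lineInfty_iff, Set.mem_singleton_iff]
  constructor
  · rintro ⟨h3, h4⟩
    simp only [Profile.GZero] at h3
    simp only [Profile.GInfty] at h4
    have h5 : z.2 = m := by
      rw [hm, eq_div_iff ht]
      linarith
    refine Prod.ext ?_ h5
    simp only [← h5]
    linarith
  · rintro rfl
    exact ⟨h1, h2⟩

/-- The segments on the contact lines are contained in these lines. -/
theorem contactSegment_subset (h : IsCurve P g w dw) {l : Filter ℝ} [l.NeBot]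
    (hl : ∀ᶠ x in l, 0 < x) {L : ℝ × ℝ → ℝ} (hG : ∀ z, Tendsto (P.G z) l (𝓝 (L z)))
    (hLM : ∀ M ∈ lineZero g ∩ lineInfty g, L M = 0) {z : ℝ × ℝ} (hz : z ∈ contactSegment g l) :
    L z = 0 := by
  obtain ⟨M, -, -, hM⟩ := h.exists_lineZero_inter_lineInfty
  have hLM' : L M = 0 := hLM M (hM ▸ Set.mem_singleton M)
  set C := 1 + (|P.tauZero| + |P.tauInfty|) with hC
  have hCpos : 0 < C := by positivity
  have hbound : ∀ᶠ x in l, |P.G z x| ≤ |P.G M x| + C * Metric.infDist z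
      (convexJoin ℝ (lineZero g ∩ lineInfty g) (envelopeAt g x)) := by
    filter_upwards [hl] with x hx
    rw [hM, h.envelopeAt_eq hx, convexJoin_singletons]
    set e : ℝ × ℝ := (P.env x, -P.q x) with he
    have hGe : P.G e x = 0 := (Profile.G_eq_zero_iff rfl).2 rfl
    have hne : (segment ℝ M e).Nonempty := ⟨M, left_mem_segment ℝ M e⟩
    -- `G(·, x)` is affine and vanishes at `e`, so on the segment it is at most `|G M x|`, which
    -- tends to 0. `C` is a Lipschitz constant of `G(·, x)` for the maximum norm, uniform in `x`.
    have key : (|P.G z x| - |P.G M x|) / C ≤ Metric.infDist z (segment ℝ M e) := by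
      rw [Metric.le_infDist hne]
      rintro y ⟨a, b, ha, hb, hab, rfl⟩
      rw [div_le_iff₀ hCpos]
      have h1 : P.G (a • M + b • e) x = a * P.G M x := by
        have : P.G (a • M + b • e) x = a * P.G M x + b * P.G e x + (1 - (a + b)) * P.h x := by
          simp only [Profile.G, Prod.fst_add, Prod.snd_add, Prod.smul_fst, Prod.smul_snd,
            smul_eq_mul]
          ring
        rw [this, hGe, hab]
        ring
      have h2 := Profile.abs_G_sub_le (P := P) z (a • M + b • e) hx
      have h3 : |P.G (a • M + b • e) x| ≤ |P.G M x| := by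
        rw [h1, abs_mul, abs_of_nonneg ha]
        exact mul_le_of_le_one_left (abs_nonneg _) (by linarith)
      have h4 : |z.1 - (a • M + b • e).1| ≤ dist z (a • M + b • e) := by
        rw [Prod.dist_eq, ← Real.dist_eq]
        exact le_max_left _ _
      have h5 : |z.2 - (a • M + b • e).2| ≤ dist z (a • M + b • e) := by
        rw [Prod.dist_eq, ← Real.dist_eq]
        exact le_max_right _ _
      have h6 := mul_le_mul_of_nonneg_right h5
        (by positivity : 0 ≤ |P.tauZero| + |P.tauInfty|)
      have h7 := abs_sub_abs_le_abs_sub (P.G z x) (P.G (a • M + b • e) x)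
      rw [hC]
      linarith
    rw [div_le_iff₀ hCpos] at key
    linarith
  have h1 : Tendsto (fun x => |P.G M x| + C * Metric.infDist z
      (convexJoin ℝ (lineZero g ∩ lineInfty g) (envelopeAt g x))) l (𝓝 (|L M| + C * 0)) :=
    (hG M).abs.add (Tendsto.const_mul C hz)
  rw [hLM', abs_zero, mul_zero, add_zero] at h1
  have h2 : Tendsto (P.G z) l (𝓝 0) := squeeze_zero_norm' hbound h1
  exact tendsto_nhds_unique (hG z) h2

/-- The contact segments are absorbed by the two lines, so their precise extent does not affect the
regions. -/
theorem curves_eq (h : IsCurve P g w dw) :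
    augmentedEnvelope g ∪ lineZero g ∪ lineInfty g =
      arrangement P.branchDom P.branchVal := by
  ext z
  rw [Profile.mem_arrangement_iff, augmentedEnvelope]
  simp only [Set.mem_union, h.mem_lineZero_iff, h.mem_lineInfty_iff, h.mem_envelope_iff]
  constructor
  · rintro ((((hz | hz) | hz) | hz) | hz)
    · exact Or.inl (h.contactSegment_subset eventually_pos_nhdsGT P.tendsto_G_zero
        (fun M hM => h.mem_lineZero_iff.1 hM.1) hz)
    · exact Or.inr (Or.inr hz)
    · exact Or.inr (Or.inl (h.contactSegment_subset (eventually_gt_atTop 0) P.tendsto_G_infty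
        (fun M hM => h.mem_lineInfty_iff.1 hM.2) hz))
    · exact Or.inl hz
    · exact Or.inr (Or.inl hz)
  · rintro (hz | hz | hz)
    · exact Or.inl (Or.inr hz)
    · exact Or.inr hz
    · exact Or.inl (Or.inl (Or.inl (Or.inr hz)))

end IsCurve

/-! ### Comparison of neighbouring regions -/

namespace Profile

variable {P : Profile}

/-- On a region, the number of zeros and the initial sign are constant. -/
theorem eq_on_component {z z' : ℝ × ℝ}
    (hz : z ∈ connectedComponentIn (arrangement P.branchDom P.branchVal)ᶜ z') :
    (P.zeros z).ncard = (P.zeros z').ncard ∧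
      decide (P.GZero z < 0) = decide (P.GZero z' < 0) := by
  set O := (arrangement P.branchDom P.branchVal)ᶜ with hO
  have hz' : z' ∈ O := by
    by_contra hcon
    rw [connectedComponentIn_eq_empty hcon] at hz
    exact hz
  have hcont : ContinuousOn (fun y => ((P.zeros y).ncard, decide (P.GZero y < 0)))
      (connectedComponentIn O z') := by
    intro y hy
    have hyO : y ∉ arrangement P.branchDom P.branchVal := connectedComponentIn_subset _ _ hy
    refine ContinuousAt.continuousWithinAt ?_
    have h0 : P.GZero y ≠ 0 := fun h => hyO (mem_arrangement_iff.2 (Or.inl h))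
    have hc : Continuous P.GZero := by unfold GZero; fun_prop
    have hsign : ∀ᶠ y' in 𝓝 y, decide (P.GZero y' < 0) = decide (P.GZero y < 0) := by
      rcases lt_or_gt_of_ne h0 with h | h
      · filter_upwards [hc.continuousAt.eventually (gt_mem_nhds h)] with y' hy'
        simp [h, hy']
      · filter_upwards [hc.continuousAt.eventually (lt_mem_nhds h)] with y' hy'
        simp [h.not_gt, hy'.not_gt]
    refine (continuousAt_const (y := ((P.zeros y).ncard, decide (P.GZero y < 0)))).congr ?_
    filter_upwards [eventually_ncard_eq hyO, hsign] with y' h1 h2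
    rw [h1, h2]
  -- A continuous map from a preconnected set to the discrete space `ℕ × Bool` is constant.
  have := isPreconnected_connectedComponentIn.constant hcont hz (mem_connectedComponentIn hz')
  exact Prod.ext_iff.1 this

/-- Two regions with uncountably many common boundary points have different numbers of zeros. -/
theorem ncard_ne_of_frontier {z z' : ℝ × ℝ}
    (hne : connectedComponentIn (arrangement P.branchDom P.branchVal)ᶜ z ≠
      connectedComponentIn (arrangement P.branchDom P.branchVal)ᶜ z')
    {X : Set (ℝ × ℝ)} (hX : ¬ X.Countable)
    (hXs : X ⊆ frontier (connectedComponentIn (arrangement P.branchDom P.branchVal)ᶜ z) ∩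
      frontier (connectedComponentIn (arrangement P.branchDom P.branchVal)ᶜ z')) :
    (P.zeros z).ncard ≠ (P.zeros z').ncard := by
  intro heq
  -- The finitely many envelope points with `q' = 0` are removed, because the double zero argument
  -- fails there.
  set E : Set (ℝ × ℝ) := (fun x => (P.env x, -P.q x)) '' {x | 0 < x ∧ P.dq x = 0} with hE
  have hEf : E.Finite := P.finite_dq.image _
  have hX' : ¬ (X \ E).Countable := fun hc =>
    hX ((hc.union hEf.countable).mono fun y hy => by
      by_cases h : y ∈ E
      exacts [Or.inr h, Or.inl ⟨hy, h⟩])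
  obtain ⟨p, hpX, k, hk, huniq, s, hs, hev⟩ := P.isArrangement.exists_two_sided
    isOpen_compl_arrangement hne hX' (Set.sdiff_subset.trans hXs)
  have hncard : ∀ᶠ ε in 𝓝[>] (0 : ℝ),
      (P.zeros (p.1 + s * ε, p.2)).ncard = (P.zeros (p.1 - s * ε, p.2)).ncard := by
    filter_upwards [hev] with ε hε
    rw [(eq_on_component hε.1).1, (eq_on_component hε.2).1, heq]
  have hoff : ∀ᶠ ε in 𝓝[>] (0 : ℝ),
      (p.1 + s * ε, p.2) ∉ arrangement P.branchDom P.branchVal ∧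
      (p.1 - s * ε, p.2) ∉ arrangement P.branchDom P.branchVal := by
    filter_upwards [hev] with ε hε
    exact ⟨connectedComponentIn_subset _ _ hε.1, connectedComponentIn_subset _ _ hε.2⟩
  have hss : s * s = 1 := by rcases hs with rfl | rfl <;> norm_num
  -- Equal numbers of zeros on both sides force the end signs to flip at both ends or at neither. At
  -- a point of exactly one limiting line only one of them flips.
  have hparity : ∀ᶠ ε in 𝓝[>] (0 : ℝ),
      0 < (P.GZero p + s * ε) * (P.GZero p - s * ε) *
        ((P.GInfty p + s * ε) * (P.GInfty p - s * ε)) := by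
    filter_upwards [hncard, hoff] with ε h1 h2
    have h3 := mul_pos (GZero_mul_GInfty_pos h2.1) (GZero_mul_GInfty_pos h2.2)
    rw [h1] at h3
    set N := (P.zeros (p.1 - s * ε, p.2)).ncard
    have hN : ((-1 : ℝ) ^ N) * (-1) ^ N = 1 := by
      rw [← mul_pow]
      norm_num
    have e1 : P.GZero (p.1 + s * ε, p.2) = P.GZero p + s * ε := by
      simp only [GZero]
      ring
    have e2 : P.GZero (p.1 - s * ε, p.2) = P.GZero p - s * ε := by
      simp only [GZero]
      ring
    have e3 : P.GInfty (p.1 + s * ε, p.2) = P.GInfty p + s * ε := by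
      simp only [GInfty]
      ring
    have e4 : P.GInfty (p.1 - s * ε, p.2) = P.GInfty p - s * ε := by
      simp only [GInfty]
      ring
    rw [e1, e2, e3, e4] at h3
    have e5 : (P.GZero p + s * ε) * (-1) ^ N * (P.GInfty p + s * ε) *
        ((P.GZero p - s * ε) * (-1) ^ N * (P.GInfty p - s * ε)) =
        (P.GZero p + s * ε) * (P.GZero p - s * ε) *
        ((P.GInfty p + s * ε) * (P.GInfty p - s * ε)) * ((-1) ^ N * (-1) ^ N) := by ring
    rwa [e5, hN, mul_one] at h3
  have hnear : ∀ a : ℝ, a ≠ 0 → ∀ᶠ ε in 𝓝[>] (0 : ℝ), 0 < (a + s * ε) * (a - s * ε) := by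
    intro a ha
    have hc : Continuous fun ε : ℝ => (a + s * ε) * (a - s * ε) := by fun_prop
    have h1 := hc.tendsto 0
    simp only [mul_zero, add_zero, sub_zero] at h1
    exact (h1.eventually (lt_mem_nhds (mul_self_pos.2 ha))).filter_mono nhdsWithin_le_nhds
  have hflat : ∀ ε : ℝ, (0 + s * ε) * (0 - s * ε) = -(ε * ε) := by
    intro ε
    linear_combination -(ε * ε) * hss
  rcases k with c | _ | _
  · obtain ⟨x₀, hx₀, hG, hq⟩ := mem_graph_piece_iff.1 hk
    have hx₀pos := pos_of_mem_piece c.2 hx₀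
    have h0 : P.GZero p ≠ 0 := fun h => by
      have := mem_graph_zero_iff.2 h
      exact huniq _ (by simp) this.1 this.2
    have hi : P.GInfty p ≠ 0 := fun h => by
      have := mem_graph_infty_iff.2 h
      exact huniq _ (by simp) this.1 this.2
    have hdq : P.dq x₀ ≠ 0 := fun h => by
      have hq' : p.2 = -P.q x₀ := by linarith
      exact hpX.2 ⟨x₀, ⟨hx₀pos, h⟩, Prod.ext ((G_eq_zero_iff hq').1 hG).symm hq'.symm⟩
    have hun : ∀ x ∈ P.zeros p, p.2 + P.q x = 0 → x = x₀ := by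
      intro x hx hqx
      obtain ⟨c', hc', hxc'⟩ := exists_mem_piece (P := P) hx.1
      by_cases hcc : (⟨c', hc'⟩ : P.cuts) = c
      · subst hcc
        exact injOn_q_piece hc' hxc' hx₀ (by simp only; linarith)
      · have := mem_graph_piece_iff (s := ⟨c', hc'⟩).2 ⟨x, hxc', hx.2, hqx⟩
        exact (huniq (.inl ⟨c', hc'⟩) (fun h => hcc (Sum.inl_injective h)) this.1 this.2).elim
    obtain ⟨ε, h1, h2⟩ := (hncard.and
      (eventually_ncard_ne h0 hi ⟨hx₀pos, hG⟩ hq hdq hun)).exists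
    rcases hs with rfl | rfl
    · rw [one_mul] at h1
      exact h2 h1
    · rw [neg_one_mul, ← sub_eq_add_neg, sub_neg_eq_add] at h1
      exact h2 h1.symm
  · have h0 := mem_graph_zero_iff.1 hk
    have hi : P.GInfty p ≠ 0 := fun h => by
      have := mem_graph_infty_iff.2 h
      exact huniq _ (by simp) this.1 this.2
    obtain ⟨ε, h1, h2, h3⟩ := (hparity.and ((hnear _ hi).and self_mem_nhdsWithin)).exists
    rw [h0, hflat] at h1
    have h4 : 0 < ε := h3
    have := mul_pos (mul_pos h4 h4) h2
    linarith
  · have hi := mem_graph_infty_iff.1 hk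
    have h0 : P.GZero p ≠ 0 := fun h => by
      have := mem_graph_zero_iff.2 h
      exact huniq _ (by simp) this.1 this.2
    obtain ⟨ε, h1, h2, h3⟩ := (hparity.and ((hnear _ h0).and self_mem_nhdsWithin)).exists
    rw [hi, hflat] at h1
    have h4 : 0 < ε := h3
    have := mul_pos (mul_pos h4 h4) h2
    linarith

end Profile

/-- The classification of shapes for a curve whose derivative is given by a family of lines. -/
theorem IsCurve.classification {P : Profile} {g : ℝ → ℝ × ℝ → ℝ} {w dw : ℝ → ℝ}
    (h : IsCurve P g w dw) :
    ∃ (K : ℕ) (R : Fin K → Set (ℝ × ℝ)) (S : Fin K → Shape),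
      Function.Injective R ∧
      Set.range R = regions g ∧
      (∀ i, IsOpen (R i)) ∧
      (∀ i j, i ≠ j → Disjoint (R i) (R j)) ∧
      (⋃ i, R i) = (augmentedEnvelope g ∪ lineZero g ∪ lineInfty g)ᶜ ∧
      (∀ i, ∀ z ∈ R i, HasShape (fun x => g x z) (S i)) ∧
      (∀ i j, i ≠ j → ShareCurve (R i) (R j) → (S i).extrema ≠ (S j).extrema) := by
  set O := (arrangement P.branchDom P.branchVal)ᶜ with hO
  have hoff : offCurves g = O := by rw [offCurves, h.curves_eq]
  have hfin : (regions g).Finite := by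
    have := P.isArrangement.finite_components
    rw [regions, hoff]
    exact this
  obtain ⟨K, R, hinj, hrange⟩ : ∃ (K : ℕ) (R : Fin K → Set (ℝ × ℝ)),
      Function.Injective R ∧ Set.range R = regions g := by
    have := hfin.to_subtype
    refine ⟨_, fun i => ((Finite.equivFin (regions g)).symm i : regions g),
      Subtype.val_injective.comp (Equiv.injective _), ?_⟩
    have := Set.range_comp (Subtype.val : regions g → Set (ℝ × ℝ))
      (Finite.equivFin (regions g)).symm
    rw [(Equiv.surjective _).range_eq, Set.image_univ, Subtype.range_coe] at this
    exact this
  have hrep : ∀ i, ∃ z ∈ O, R i = connectedComponentIn O z := by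
    intro i
    obtain ⟨z, hz, hR⟩ : R i ∈ regions g := hrange ▸ Set.mem_range_self i
    rw [hoff] at hz hR
    exact ⟨z, hz, hR⟩
  choose c hcO hc using hrep
  refine ⟨K, R, fun i => ⟨decide (P.GZero (c i) < 0),
    SignChanges.alternating (decide (P.GZero (c i) < 0)) (P.zeros (c i)).ncard⟩,
    hinj, hrange, ?_, ?_, ?_, ?_, ?_⟩
  · intro i
    rw [hc]
    exact Profile.isOpen_compl_arrangement.connectedComponentIn
  · intro i j hij
    rw [Set.disjoint_left]
    intro z hzi hzj
    rw [hc] at hzi hzj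
    refine hij (hinj ?_)
    rw [hc, hc, connectedComponentIn_eq hzi, connectedComponentIn_eq hzj]
  · rw [← Set.sUnion_range, hrange, h.curves_eq]
    ext z
    simp only [regions, hoff, Set.mem_sUnion, Set.mem_ofPred_eq]
    constructor
    · rintro ⟨_, ⟨y, hy, rfl⟩, hz⟩
      exact connectedComponentIn_subset _ _ hz
    · intro hz
      exact ⟨_, ⟨z, hz, rfl⟩, mem_connectedComponentIn hz⟩
  · intro i z hz
    rw [hc] at hz
    obtain ⟨h1, h2⟩ := Profile.eq_on_component hz
    simp only
    rw [← h1, ← h2]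
    exact Profile.hasShape (connectedComponentIn_subset _ _ hz)
      (fun x hx => (h.hasDerivAt_w x hx).continuousAt.continuousWithinAt) h.neg
      (fun x hx => h.hasDerivAt z x hx)
  · rintro i j hij ⟨γ, -, hγ, hsub⟩ heq
    have hlen := congrArg List.length heq
    simp only [SignChanges.length_alternating] at hlen
    rw [hc, hc] at hsub
    refine Profile.ncard_ne_of_frontier (fun hcc => hij (hinj ?_)) (fun hcount => ?_) hsub hlen
    · rw [hc, hc, hcc]
    -- An injective image of `[0, 1]` is uncountable, which is what `ncard_ne_of_frontier` needs.
    · have h1 := Set.countable_of_injective_of_countable_image hγ hcount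
      rw [Cardinal.Real.Icc_countable_iff] at h1
      exact absurd h1 (by norm_num)

/-! ## Averaged families of lines -/

theorem pos_of_hasDerivAt_pos {f f' : ℝ → ℝ} (hf : ∀ x, 0 < x → HasDerivAt f (f' x) x)
    (hpos : ∀ x, 0 < x → 0 < f' x) (h0 : Tendsto f (𝓝[>] 0) (𝓝 0)) {x : ℝ} (hx : 0 < x) :
    0 < f x := by
  have hmono : StrictMonoOn f (Set.Ioi 0) := by
    refine strictMonoOn_of_deriv_pos (convex_Ioi 0)
      (fun x hx => (hf x hx).continuousAt.continuousWithinAt) fun x hx => ?_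
    rw [interior_Ioi] at hx
    rw [(hf x hx).deriv]
    exact hpos x hx
  have hx2 := half_pos hx
  refine lt_of_le_of_lt (le_of_tendsto h0 ?_) (hmono hx2 hx (half_lt_self hx))
  filter_upwards [Ioo_mem_nhdsGT hx2] with y hy
  exact (hmono hy.1 hx2 hy.2).le

/-- Integrals over `(0, x)` of the coefficients `1`, `τ`, `h` of a family of lines with respect
to the weight `s e(s)`. -/
structure AverageData (P : Profile) where
  e : ℝ → ℝ
  u : ℝ → ℝ
  v : ℝ → ℝ
  k : ℝ → ℝ
  uInfty : ℝ
  vInfty : ℝ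
  kInfty : ℝ
  e_pos : ∀ x, 0 < x → 0 < e x
  hasDerivAt_u : ∀ x, 0 < x → HasDerivAt u (x * e x) x
  hasDerivAt_v : ∀ x, 0 < x → HasDerivAt v (x * e x * P.tau x) x
  hasDerivAt_k : ∀ x, 0 < x → HasDerivAt k (x * e x * P.h x) x
  tendsto_u_zero : Tendsto u (𝓝[>] 0) (𝓝 0)
  tendsto_v_zero : Tendsto v (𝓝[>] 0) (𝓝 0)
  tendsto_k_zero : Tendsto k (𝓝[>] 0) (𝓝 0)
  tendsto_u_infty : Tendsto u atTop (𝓝 uInfty)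
  tendsto_v_infty : Tendsto v atTop (𝓝 vInfty)
  tendsto_k_infty : Tendsto k atTop (𝓝 kInfty)
  uInfty_ne_zero : uInfty ≠ 0

namespace AverageData

variable {P : Profile} (A : AverageData P)

theorem u_pos {x : ℝ} (hx : 0 < x) : 0 < A.u x :=
  pos_of_hasDerivAt_pos A.hasDerivAt_u (fun x hx => mul_pos hx (A.e_pos x hx)) A.tendsto_u_zero hx

theorem hasDerivAt_den {x : ℝ} (hx : 0 < x) :
    HasDerivAt (fun x => A.v x - P.tau x * A.u x) (-(P.dtau x * A.u x)) x := by
  have := (A.hasDerivAt_v x hx).sub ((P.hasDerivAt_tau x hx).mul (A.hasDerivAt_u x hx))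
  exact this.congr_deriv (by ring)

theorem hasDerivAt_num {x : ℝ} (hx : 0 < x) :
    HasDerivAt (fun x => A.k x - P.h x * A.u x) (-(P.q x * P.dtau x * A.u x)) x := by
  have := (A.hasDerivAt_k x hx).sub ((P.hasDerivAt_h x hx).mul (A.hasDerivAt_u x hx))
  exact this.congr_deriv (by ring)

/-- The average of the decreasing `τ` over `(0, x)` exceeds its final value; hence the averaged `τ`
is again strictly decreasing. -/
theorem den_pos {x : ℝ} (hx : 0 < x) : 0 < A.v x - P.tau x * A.u x := by
  refine pos_of_hasDerivAt_pos (fun x hx => A.hasDerivAt_den hx) (fun x hx => ?_) ?_ hx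
  · exact neg_pos.2 (mul_neg_of_neg_of_pos (P.dtau_neg x hx) (A.u_pos hx))
  · simpa using A.tendsto_v_zero.sub (P.tendsto_tau_zero.mul A.tendsto_u_zero)

/-- By l'Hôpital, so averaging does not change the limiting line at 0. -/
theorem tendsto_div_zero {f f' : ℝ → ℝ} {L : ℝ}
    (hf : ∀ x, 0 < x → HasDerivAt f (x * A.e x * f' x) x) (h0 : Tendsto f (𝓝[>] 0) (𝓝 0))
    (hL : Tendsto f' (𝓝[>] 0) (𝓝 L)) : Tendsto (fun x => f x / A.u x) (𝓝[>] 0) (𝓝 L) := by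
  have hpos : ∀ᶠ x : ℝ in 𝓝[>] 0, 0 < x := self_mem_nhdsWithin
  refine HasDerivAt.lhopital_zero_nhdsGT (hpos.mono hf) (hpos.mono A.hasDerivAt_u)
    (hpos.mono fun x hx => (mul_pos hx (A.e_pos x hx)).ne') h0 A.tendsto_u_zero (hL.congr' ?_)
  filter_upwards [hpos] with x hx
  rw [mul_div_cancel_left₀ _ (mul_pos hx (A.e_pos x hx)).ne']

theorem hasDerivAt_div_u {f f' : ℝ → ℝ} (hf : ∀ x, 0 < x → HasDerivAt f (x * A.e x * f' x) x)
    {x : ℝ} (hx : 0 < x) :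
    HasDerivAt (fun x => f x / A.u x) (-(x * A.e x * (f x - f' x * A.u x) / A.u x ^ 2)) x :=
  ((hf x hx).div (A.hasDerivAt_u x hx) (A.u_pos hx).ne').congr_deriv (by ring)

/-- The family of lines whose coefficients are the weighted averages of those of `P`. -/
noncomputable def profile : Profile where
  tau x := A.v x / A.u x
  dtau x := -(x * A.e x * (A.v x - P.tau x * A.u x) / A.u x ^ 2)
  h x := A.k x / A.u x
  q x := (A.k x - P.h x * A.u x) / (A.v x - P.tau x * A.u x)
  dq x := -(P.dtau x * A.u x *
    (P.q x * (A.v x - P.tau x * A.u x) - (A.k x - P.h x * A.u x))) /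
    (A.v x - P.tau x * A.u x) ^ 2
  tauZero := P.tauZero
  tauInfty := A.vInfty / A.uInfty
  hZero := P.hZero
  hInfty := A.kInfty / A.uInfty
  hasDerivAt_tau x hx := A.hasDerivAt_div_u A.hasDerivAt_v hx
  dtau_neg x hx := neg_neg_of_pos (div_pos (mul_pos (mul_pos hx (A.e_pos x hx)) (A.den_pos hx))
    (pow_pos (A.u_pos hx) 2))
  hasDerivAt_h x hx := by
    refine (A.hasDerivAt_div_u A.hasDerivAt_k hx).congr_deriv ?_
    have h1 := (A.den_pos hx).ne'
    rw [mul_neg, neg_inj, eq_comm, div_mul_div_comm, mul_comm (A.v x - P.tau x * A.u x),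
      mul_comm (A.k x - P.h x * A.u x), mul_right_comm, mul_div_mul_right _ _ h1]
  hasDerivAt_q x hx := by
    refine ((A.hasDerivAt_num hx).div (A.hasDerivAt_den hx) (A.den_pos hx).ne').congr_deriv ?_
    ring
  -- Write `num = k - h u` and `den = v - τ u`. The critical points of `num / den` are the zeros of
  -- `q den - num`, whose derivative collapses to `q' den`; Rolle transfers finiteness from the
  -- critical points of `q`.
  finite_dq := by
    have h1 : {x | 0 < x ∧
        P.q x * (A.v x - P.tau x * A.u x) - (A.k x - P.h x * A.u x) = 0}.Finite := by
      refine finite_zeros_of_finite_deriv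
        (f' := fun x => P.dq x * (A.v x - P.tau x * A.u x)) (fun x hx => ?_) ?_
      · have := ((P.hasDerivAt_q x hx).mul (A.hasDerivAt_den hx)).sub (A.hasDerivAt_num hx)
        exact this.congr_deriv (by ring)
      · refine P.finite_dq.subset fun x hx => ⟨hx.1, ?_⟩
        exact (mul_eq_zero.1 hx.2).resolve_right (A.den_pos hx.1).ne'
    refine h1.subset fun x hx => ⟨hx.1, ?_⟩
    have h2 := (div_eq_zero_iff.1 hx.2).resolve_right (pow_pos (A.den_pos hx.1) 2).ne'
    have h3 : P.dtau x * A.u x ≠ 0 := mul_ne_zero (P.dtau_neg x hx.1).ne (A.u_pos hx.1).ne'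
    exact (mul_eq_zero.1 (neg_eq_zero.1 h2)).resolve_left h3
  tendsto_tau_zero := A.tendsto_div_zero A.hasDerivAt_v A.tendsto_v_zero P.tendsto_tau_zero
  tendsto_tau_infty := A.tendsto_v_infty.div A.tendsto_u_infty A.uInfty_ne_zero
  tendsto_h_zero := A.tendsto_div_zero A.hasDerivAt_k A.tendsto_k_zero P.tendsto_h_zero
  tendsto_h_infty := A.tendsto_k_infty.div A.tendsto_u_infty A.uInfty_ne_zero

end AverageData

/-! ## The forward curve and the yield curve in closed form -/

/-- The function `(1 - e^{-l x}) / l`. -/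
noncomputable def decay (l x : ℝ) : ℝ := (1 - Real.exp (-l * x)) / l

theorem hasDerivAt_exp_mul (l x : ℝ) :
    HasDerivAt (fun x => Real.exp (l * x)) (l * Real.exp (l * x)) x := by
  have := ((hasDerivAt_id x).const_mul l).exp
  simpa [mul_comm] using this

theorem hasDerivAt_decay {l : ℝ} (hl : l ≠ 0) (x : ℝ) :
    HasDerivAt (decay l) (Real.exp (-l * x)) x := by
  have := ((hasDerivAt_exp_mul (-l) x).const_sub 1).div_const l
  exact this.congr_deriv (by field_simp)

theorem decay_zero (l : ℝ) : decay l 0 = 0 := by simp [decay]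

theorem tendsto_exp_neg_mul {l : ℝ} (hl : 0 < l) :
    Tendsto (fun x => Real.exp (-l * x)) atTop (𝓝 0) :=
  Real.tendsto_exp_atBot.comp (tendsto_id.const_mul_atTop_of_neg (neg_neg_of_pos hl))

theorem tendsto_mul_exp_neg_mul {l : ℝ} (hl : 0 < l) :
    Tendsto (fun x => x * Real.exp (-l * x)) atTop (𝓝 0) := by
  have h1 := (Real.tendsto_pow_mul_exp_neg_atTop_nhds_zero 1).comp
    (tendsto_id.const_mul_atTop hl)
  have h2 := h1.const_mul (1 / l)
  rw [mul_zero] at h2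
  refine h2.congr fun x => ?_
  simp only [Function.comp, id, pow_one, neg_mul]
  field_simp

theorem tendsto_decay {l : ℝ} (hl : 0 < l) : Tendsto (decay l) atTop (𝓝 (1 / l)) := by
  have := ((tendsto_exp_neg_mul hl).const_sub 1).div_const l
  rwa [sub_zero] at this

/-! ### Closed formulas for the curves and their profiles -/

namespace Params

variable (p : Params)

theorem lam2_pos : 0 < p.lam2 := p.lam1_pos.trans p.lam1_lt_lam2

/-- The instantaneous variance of the log bond price. -/
noncomputable def varRate (x : ℝ) : ℝ :=
  p.sigma1 ^ 2 * decay p.lam1 x ^ 2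
    + 2 * (p.rho * p.sigma1 * p.sigma2) * (decay p.lam1 x * decay p.lam2 x)
    + p.sigma2 ^ 2 * decay p.lam2 x ^ 2

/-- An antiderivative of `decay l * decay m`. -/
noncomputable def decayInt (l m x : ℝ) : ℝ :=
  (x - decay l x - decay m x + decay (l + m) x) / (l * m)

theorem hasDerivAt_decayInt {l m : ℝ} (hl : 0 < l) (hm : 0 < m) (x : ℝ) :
    HasDerivAt (decayInt l m) (decay l x * decay m x) x := by
  have h1 := ((((hasDerivAt_id x).sub (hasDerivAt_decay hl.ne' x)).sub
    (hasDerivAt_decay hm.ne' x)).add (hasDerivAt_decay (add_pos hl hm).ne' x)).div_const (l * m)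
  refine h1.congr_deriv ?_
  have : Real.exp (-(l + m) * x) = Real.exp (-l * x) * Real.exp (-m * x) := by
    rw [← Real.exp_add]
    ring_nf
  rw [this, decay, decay]
  have := hl.ne'
  have := hm.ne'
  field_simp
  ring

/-- Both terms grow like `x / (l m)` and the growth cancels. The unsimplified limit mirrors the sum
of the limits of the parts. -/
theorem tendsto_decayInt_gap {l m : ℝ} (hl : 0 < l) (hm : 0 < m) :
    Tendsto (fun x => x * (decay l x * decay m x) - decayInt l m x) atTop
      (𝓝 ((0 - 0 - 0 + 1 / l + 1 / m - 1 / (l + m)) / (l * m))) := by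
  have hlm := add_pos hl hm
  have h1 := ((((((tendsto_mul_exp_neg_mul hlm).sub (tendsto_mul_exp_neg_mul hl)).sub
    (tendsto_mul_exp_neg_mul hm)).add (tendsto_decay hl)).add (tendsto_decay hm)).sub
      (tendsto_decay hlm)).div_const (l * m)
  refine h1.congr fun x => ?_
  have he : Real.exp (-(l + m) * x) = Real.exp (-l * x) * Real.exp (-m * x) := by
    rw [← Real.exp_add]
    ring_nf
  simp only [decayInt, decay, he]
  have := hl.ne'
  have := hm.ne'
  have := hlm.ne'
  field_simp
  ring

/-- The variance of the log bond price. -/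
noncomputable def variance (x : ℝ) : ℝ :=
  p.sigma1 ^ 2 * decayInt p.lam1 p.lam1 x
    + 2 * (p.rho * p.sigma1 * p.sigma2) * decayInt p.lam1 p.lam2 x
    + p.sigma2 ^ 2 * decayInt p.lam2 p.lam2 x

theorem hasDerivAt_variance (x : ℝ) : HasDerivAt p.variance (p.varRate x) x := by
  have h1 := hasDerivAt_decayInt p.lam1_pos p.lam1_pos x
  have h2 := hasDerivAt_decayInt p.lam1_pos p.lam2_pos x
  have h3 := hasDerivAt_decayInt p.lam2_pos p.lam2_pos x
  have := ((h1.const_mul (p.sigma1 ^ 2)).add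
    (h2.const_mul (2 * (p.rho * p.sigma1 * p.sigma2)))).add (h3.const_mul (p.sigma2 ^ 2))
  exact this.congr_deriv (by rw [varRate]; ring)

theorem variance_zero : p.variance 0 = 0 := by simp [variance, decayInt, decay_zero]

/-- The negative logarithm of the bond price. -/
noncomputable def negLogPrice (x : ℝ) (z : ℝ × ℝ) : ℝ :=
  (p.kappa + p.theta1 + p.theta2) * x + (z.1 - p.theta1) * decay p.lam1 x
    + (z.2 - p.theta2) * decay p.lam2 x - p.variance x / 2

/-- The forward curve. -/
noncomputable def forward (x : ℝ) (z : ℝ × ℝ) : ℝ :=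
  p.kappa + p.theta1 + p.theta2 + (z.1 - p.theta1) * Real.exp (-p.lam1 * x)
    + (z.2 - p.theta2) * Real.exp (-p.lam2 * x) - p.varRate x / 2

theorem hasDerivAt_negLogPrice (x : ℝ) (z : ℝ × ℝ) :
    HasDerivAt (fun x => p.negLogPrice x z) (p.forward x z) x := by
  have h1 := (hasDerivAt_decay p.lam1_pos.ne' x).const_mul (z.1 - p.theta1)
  have h2 := (hasDerivAt_decay p.lam2_pos.ne' x).const_mul (z.2 - p.theta2)
  have := (((((hasDerivAt_id x).const_mul (p.kappa + p.theta1 + p.theta2)).add h1).add h2).sub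
    ((p.hasDerivAt_variance x).div_const 2))
  exact this.congr_deriv (by rw [forward]; ring)

/-- The exponential `e^{-(λ₂ - λ₁) x}`. -/
noncomputable def ratio (x : ℝ) : ℝ := Real.exp ((p.lam1 - p.lam2) * x)

theorem exp_lam2 (x : ℝ) : Real.exp (-p.lam2 * x) = Real.exp (-p.lam1 * x) * p.ratio x := by
  rw [ratio, ← Real.exp_add]
  ring_nf

/-- The auxiliary exponential `e^{(λ₂ - 2 λ₁) x}`. -/
noncomputable def auxExp (x : ℝ) : ℝ := Real.exp ((p.lam2 - 2 * p.lam1) * x)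

/-- With `exp_lam2`, both exponentials become `auxExp` times powers of `ratio`; this turns
`forwardDQ` into a positive factor times a quadratic in `ratio`, up to a constant. -/
theorem exp_lam1 (x : ℝ) : Real.exp (-p.lam1 * x) = p.auxExp x * p.ratio x := by
  rw [ratio, auxExp, ← Real.exp_add]
  ring_nf

theorem hasDerivAt_ratio (x : ℝ) : HasDerivAt p.ratio ((p.lam1 - p.lam2) * p.ratio x) x :=
  hasDerivAt_exp_mul _ x

/-- The term of the forward curve's family of lines that does not depend on the state. -/
noncomputable def forwardH (x : ℝ) : ℝ :=
  -p.theta1 - p.theta2 * (p.lam2 / p.lam1) * p.ratio x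
    + (p.sigma1 ^ 2 * decay p.lam1 x
      + p.rho * p.sigma1 * p.sigma2 * (decay p.lam2 x + decay p.lam1 x * p.ratio x)
      + p.sigma2 ^ 2 * (decay p.lam2 x * p.ratio x)) / p.lam1

/-- The negative of the second coordinate of the envelope of the forward curve. -/
noncomputable def forwardQ (x : ℝ) : ℝ :=
  -p.theta2 - (p.sigma1 ^ 2 * p.auxExp x
    + p.rho * p.sigma1 * p.sigma2 *
      (2 * Real.exp (-p.lam1 * x) - (p.lam2 - p.lam1) * decay p.lam1 x)
    + p.sigma2 ^ 2 * (Real.exp (-p.lam2 * x) - (p.lam2 - p.lam1) * decay p.lam2 x)) /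
    (p.lam2 * (p.lam2 - p.lam1))

/-- The derivative of `forwardQ`. -/
noncomputable def forwardDQ (x : ℝ) : ℝ :=
  -(p.auxExp x * (p.sigma1 ^ 2 * (p.lam2 - 2 * p.lam1)
    + -(p.rho * p.sigma1 * p.sigma2 * (p.lam1 + p.lam2)) * p.ratio x
    + -(p.sigma2 ^ 2 * (2 * p.lam2 - p.lam1)) * p.ratio x ^ 2) /
    (p.lam2 * (p.lam2 - p.lam1)))

theorem hasDerivAt_forwardH (x : ℝ) : HasDerivAt p.forwardH
    (p.forwardQ x * (p.lam2 / p.lam1 * ((p.lam1 - p.lam2) * p.ratio x))) x := by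
  have hd1 := hasDerivAt_decay p.lam1_pos.ne' x
  have hd2 := hasDerivAt_decay p.lam2_pos.ne' x
  have hr := p.hasDerivAt_ratio x
  have := ((hr.const_mul (p.theta2 * (p.lam2 / p.lam1))).const_sub (-p.theta1)).add
    ((((hd1.const_mul (p.sigma1 ^ 2)).add ((hd2.add (hd1.mul hr)).const_mul
      (p.rho * p.sigma1 * p.sigma2))).add ((hd2.mul hr).const_mul (p.sigma2 ^ 2))).div_const
        p.lam1)
  refine this.congr_deriv ?_
  have h1 := p.lam1_pos.ne'
  have h2 := p.lam2_pos.ne'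
  have h3 : p.lam2 - p.lam1 ≠ 0 := (sub_pos.2 p.lam1_lt_lam2).ne'
  rw [forwardQ, p.exp_lam2, p.exp_lam1]
  field_simp
  ring

theorem hasDerivAt_forwardQ (x : ℝ) : HasDerivAt p.forwardQ (p.forwardDQ x) x := by
  have hd1 := hasDerivAt_decay p.lam1_pos.ne' x
  have hd2 := hasDerivAt_decay p.lam2_pos.ne' x
  have ha := hasDerivAt_exp_mul (p.lam2 - 2 * p.lam1) x
  have he1 := hasDerivAt_exp_mul (-p.lam1) x
  have he2 := hasDerivAt_exp_mul (-p.lam2) x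
  have := (((ha.const_mul (p.sigma1 ^ 2)).add
    (((he1.const_mul 2).sub (hd1.const_mul (p.lam2 - p.lam1))).const_mul
      (p.rho * p.sigma1 * p.sigma2))).add
    ((he2.sub (hd2.const_mul (p.lam2 - p.lam1))).const_mul (p.sigma2 ^ 2))).div_const
      (p.lam2 * (p.lam2 - p.lam1)) |>.const_sub (-p.theta2)
  refine this.congr_deriv ?_
  rw [forwardDQ, p.exp_lam2, p.exp_lam1, auxExp]
  ring

theorem finite_quadratic {a b c : ℝ} (hc : c ≠ 0) : {t : ℝ | a + b * t + c * t ^ 2 = 0}.Finite := by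
  set f : Polynomial ℝ := Polynomial.C a + Polynomial.C b * Polynomial.X
    + Polynomial.C c * Polynomial.X ^ 2 with hf
  have hne : f ≠ 0 := by
    intro h0
    have h1 : f.coeff 2 = c := by
      simp [hf]
    rw [h0, Polynomial.coeff_zero] at h1
    exact hc h1.symm
  refine (Polynomial.finite_setOfPred_isRoot hne).subset fun t ht => ?_
  have ht' : a + b * t + c * t ^ 2 = 0 := ht
  simp [Polynomial.IsRoot, hf, ht']

theorem continuous_decay (l : ℝ) : Continuous (decay l) := by
  unfold decay
  fun_prop

theorem continuous_ratio : Continuous p.ratio := by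
  unfold ratio
  fun_prop

theorem tendsto_ratio : Tendsto p.ratio atTop (𝓝 0) := by
  have := tendsto_exp_neg_mul (sub_pos.2 p.lam1_lt_lam2)
  rwa [neg_sub] at this

theorem ratio_pos (x : ℝ) : 0 < p.ratio x := Real.exp_pos _

/-- The family of lines of the forward curve. -/
noncomputable def forwardProfile : Profile where
  tau x := p.lam2 / p.lam1 * p.ratio x
  dtau x := p.lam2 / p.lam1 * ((p.lam1 - p.lam2) * p.ratio x)
  h := p.forwardH
  q := p.forwardQ
  dq := p.forwardDQ
  tauZero := p.lam2 / p.lam1 * p.ratio 0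
  tauInfty := p.lam2 / p.lam1 * 0
  hZero := p.forwardH 0
  hInfty := -p.theta1 - p.theta2 * (p.lam2 / p.lam1) * 0
    + (p.sigma1 ^ 2 * (1 / p.lam1)
      + p.rho * p.sigma1 * p.sigma2 * (1 / p.lam2 + 1 / p.lam1 * 0)
      + p.sigma2 ^ 2 * (1 / p.lam2 * 0)) / p.lam1
  hasDerivAt_tau x _ := (p.hasDerivAt_ratio x).const_mul _
  dtau_neg x _ := mul_neg_of_pos_of_neg (div_pos p.lam2_pos p.lam1_pos)
    (mul_neg_of_neg_of_pos (sub_neg.2 p.lam1_lt_lam2) (p.ratio_pos x))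
  hasDerivAt_h x _ := p.hasDerivAt_forwardH x
  hasDerivAt_q x _ := p.hasDerivAt_forwardQ x
  -- The quadratic has leading coefficient `-σ₂² (2 λ₂ - λ₁) ≠ 0`, and `ratio` is injective.
  finite_dq := by
    have hc : -(p.sigma2 ^ 2 * (2 * p.lam2 - p.lam1)) ≠ 0 := by
      have h1 : 0 < 2 * p.lam2 - p.lam1 := by linarith [p.lam2_pos, p.lam1_lt_lam2]
      exact (neg_neg_of_pos (mul_pos (pow_pos p.sigma2_pos 2) h1)).ne
    have hinj : Function.Injective p.ratio := by
      intro x y hxy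
      have h1 := Real.exp_injective hxy
      exact mul_left_cancel₀ (sub_neg.2 p.lam1_lt_lam2).ne h1
    refine ((finite_quadratic (a := p.sigma1 ^ 2 * (p.lam2 - 2 * p.lam1))
      (b := -(p.rho * p.sigma1 * p.sigma2 * (p.lam1 + p.lam2))) hc).preimage
        hinj.injOn).subset fun x hx => ?_
    have h1 := (div_eq_zero_iff.1 (neg_eq_zero.1 hx.2)).resolve_right
      (mul_pos p.lam2_pos (sub_pos.2 p.lam1_lt_lam2)).ne'
    exact (mul_eq_zero.1 h1).resolve_left (Real.exp_pos _).ne'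
  tendsto_tau_zero :=
    ((p.continuous_ratio.tendsto 0).const_mul _).mono_left nhdsWithin_le_nhds
  tendsto_tau_infty := p.tendsto_ratio.const_mul _
  tendsto_h_zero :=
    (p.hasDerivAt_forwardH 0).continuousAt.tendsto.mono_left nhdsWithin_le_nhds
  tendsto_h_infty := by
    have h1 := tendsto_decay p.lam1_pos
    have h2 := tendsto_decay p.lam2_pos
    have hr := p.tendsto_ratio
    exact ((hr.const_mul (p.theta2 * (p.lam2 / p.lam1))).const_sub (-p.theta1)).add
      ((((h1.const_mul (p.sigma1 ^ 2)).add ((h2.add (h1.mul hr)).const_mul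
        (p.rho * p.sigma1 * p.sigma2))).add ((h2.mul hr).const_mul (p.sigma2 ^ 2))).div_const
          p.lam1)

theorem hasDerivAt_forward (x : ℝ) (z : ℝ × ℝ) : HasDerivAt (fun x => p.forward x z)
    (-p.lam1 * Real.exp (-p.lam1 * x) * p.forwardProfile.G z x) x := by
  have hd1 := hasDerivAt_decay p.lam1_pos.ne' x
  have hd2 := hasDerivAt_decay p.lam2_pos.ne' x
  have he1 := hasDerivAt_exp_mul (-p.lam1) x
  have he2 := hasDerivAt_exp_mul (-p.lam2) x
  have hv : HasDerivAt p.varRate (2 * (p.sigma1 ^ 2 * decay p.lam1 x * Real.exp (-p.lam1 * x)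
      + p.rho * p.sigma1 * p.sigma2 * (Real.exp (-p.lam1 * x) * decay p.lam2 x
        + decay p.lam1 x * Real.exp (-p.lam2 * x))
      + p.sigma2 ^ 2 * decay p.lam2 x * Real.exp (-p.lam2 * x))) x := by
    have := (((hd1.pow 2).const_mul (p.sigma1 ^ 2)).add
      ((hd1.mul hd2).const_mul (2 * (p.rho * p.sigma1 * p.sigma2)))).add
        ((hd2.pow 2).const_mul (p.sigma2 ^ 2))
    refine this.congr_deriv ?_
    push_cast
    ring
  have := (((he1.const_mul (z.1 - p.theta1)).const_add
    (p.kappa + p.theta1 + p.theta2)).add (he2.const_mul (z.2 - p.theta2))).sub (hv.div_const 2)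
  refine this.congr_deriv ?_
  have h1 := p.lam1_pos.ne'
  simp only [Profile.G, forwardProfile, forwardH, p.exp_lam2]
  field_simp
  ring

/-- The weighted averages of the coefficients of the forward curve's family of lines. -/
noncomputable def averageData : AverageData p.forwardProfile where
  e x := p.lam1 * Real.exp (-p.lam1 * x)
  u x := decay p.lam1 x - x * Real.exp (-p.lam1 * x)
  v x := decay p.lam2 x - x * Real.exp (-p.lam2 * x)
  -- Its derivative is `-x f'(x, 0)`, which is `x e(x) h(x)` because `G 0 = h`. This avoids
  -- integrating `h` explicitly.
  k x := p.negLogPrice x 0 - x * p.forward x 0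
  uInfty := 1 / p.lam1 - 0
  vInfty := 1 / p.lam2 - 0
  kInfty := -p.theta1 * (1 / p.lam1 - 0) + -p.theta2 * (1 / p.lam2 - 0)
    + (p.sigma1 ^ 2 *
        ((0 - 0 - 0 + 1 / p.lam1 + 1 / p.lam1 - 1 / (p.lam1 + p.lam1)) / (p.lam1 * p.lam1))
      + 2 * (p.rho * p.sigma1 * p.sigma2) *
        ((0 - 0 - 0 + 1 / p.lam1 + 1 / p.lam2 - 1 / (p.lam1 + p.lam2)) / (p.lam1 * p.lam2))
      + p.sigma2 ^ 2 *
        ((0 - 0 - 0 + 1 / p.lam2 + 1 / p.lam2 - 1 / (p.lam2 + p.lam2)) / (p.lam2 * p.lam2))) / 2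
  e_pos x _ := mul_pos p.lam1_pos (Real.exp_pos _)
  hasDerivAt_u x _ := by
    have := (hasDerivAt_decay p.lam1_pos.ne' x).sub
      ((hasDerivAt_id x).mul (hasDerivAt_exp_mul (-p.lam1) x))
    exact this.congr_deriv (by simp only [id]; ring)
  hasDerivAt_v x _ := by
    have := (hasDerivAt_decay p.lam2_pos.ne' x).sub
      ((hasDerivAt_id x).mul (hasDerivAt_exp_mul (-p.lam2) x))
    refine this.congr_deriv ?_
    have := p.lam1_pos.ne'
    simp only [id, forwardProfile, p.exp_lam2]
    field_simp
    ring
  hasDerivAt_k x _ := by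
    have := (p.hasDerivAt_negLogPrice x 0).sub
      ((hasDerivAt_id x).mul (p.hasDerivAt_forward x 0))
    refine this.congr_deriv ?_
    simp only [id, Profile.G, Prod.fst_zero, Prod.snd_zero]
    ring
  tendsto_u_zero := by
    have h : Continuous fun x => decay p.lam1 x - x * Real.exp (-p.lam1 * x) := by
      have := continuous_decay p.lam1
      fun_prop
    simpa [decay_zero] using (h.tendsto 0).mono_left (nhdsWithin_le_nhds (s := Set.Ioi 0))
  tendsto_v_zero := by
    have h : Continuous fun x => decay p.lam2 x - x * Real.exp (-p.lam2 * x) := by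
      have := continuous_decay p.lam2
      fun_prop
    simpa [decay_zero] using (h.tendsto 0).mono_left (nhdsWithin_le_nhds (s := Set.Ioi 0))
  tendsto_k_zero := by
    have h : ContinuousAt (fun x => p.negLogPrice x 0 - x * p.forward x 0) 0 :=
      (p.hasDerivAt_negLogPrice 0 0).continuousAt.sub
        (continuousAt_id.mul (p.hasDerivAt_forward 0 0).continuousAt)
    have h0 : p.negLogPrice 0 0 - 0 * p.forward 0 0 = 0 := by
      simp [negLogPrice, decay_zero, p.variance_zero]
    have := h.tendsto.mono_left (nhdsWithin_le_nhds (s := Set.Ioi 0))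
    rwa [h0] at this
  tendsto_u_infty := (tendsto_decay p.lam1_pos).sub (tendsto_mul_exp_neg_mul p.lam1_pos)
  tendsto_v_infty := (tendsto_decay p.lam2_pos).sub (tendsto_mul_exp_neg_mul p.lam2_pos)
  tendsto_k_infty := by
    have h1 := (tendsto_decay p.lam1_pos).sub (tendsto_mul_exp_neg_mul p.lam1_pos)
    have h2 := (tendsto_decay p.lam2_pos).sub (tendsto_mul_exp_neg_mul p.lam2_pos)
    have h3 := (((tendsto_decayInt_gap p.lam1_pos p.lam1_pos).const_mul (p.sigma1 ^ 2)).add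
      ((tendsto_decayInt_gap p.lam1_pos p.lam2_pos).const_mul
        (2 * (p.rho * p.sigma1 * p.sigma2)))).add
      ((tendsto_decayInt_gap p.lam2_pos p.lam2_pos).const_mul (p.sigma2 ^ 2))
    refine (((h1.const_mul (-p.theta1)).add (h2.const_mul (-p.theta2))).add
      (h3.div_const 2)).congr fun x => ?_
    simp only [negLogPrice, forward, variance, varRate, Prod.fst_zero, Prod.snd_zero]
    ring
  uInfty_ne_zero := by simpa using p.lam1_pos.ne'

theorem negLogPrice_sub (x : ℝ) (z : ℝ × ℝ) :
    x * p.forward x z - p.negLogPrice x z =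
      -(z.1 * p.averageData.u x + z.2 * p.averageData.v x + p.averageData.k x) := by
  simp only [averageData, forward, negLogPrice, Prod.fst_zero, Prod.snd_zero]
  ring

/-- By the quotient rule the numerator is `x f + log P`, which is minus the weighted integral of the
lines of the forward curve. -/
theorem hasDerivAt_yield {x : ℝ} (hx : 0 < x) (z : ℝ × ℝ) :
    HasDerivAt (fun x => p.negLogPrice x z / x)
      (-(p.averageData.u x / x ^ 2) * p.averageData.profile.G z x) x := by
  refine ((p.hasDerivAt_negLogPrice x z).div (hasDerivAt_id x) hx.ne').congr_deriv ?_
  have h1 := p.negLogPrice_sub x z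
  have hu := (p.averageData.u_pos hx).ne'
  have h2 : p.averageData.u x * p.averageData.profile.G z x =
      z.1 * p.averageData.u x + z.2 * p.averageData.v x + p.averageData.k x := by
    simp only [Profile.G, AverageData.profile]
    field_simp
  rw [← h2] at h1
  simp only [id]
  field_simp
  linarith

end Params

/-! ## Riemann sums -/

/-- The grid points of the partition of `[0, x]` into `n + 1` intervals of equal length. -/
noncomputable def grid (x : ℝ) (n k : ℕ) : ℝ := x * k / (n + 1)

theorem grid_zero (x : ℝ) (n : ℕ) : grid x n 0 = 0 := by simp [grid]

theorem grid_last (x : ℝ) (n : ℕ) : grid x n (n + 1) = x := by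
  rw [grid]
  push_cast
  rw [mul_div_assoc, div_self (by positivity), mul_one]

theorem grid_succ_sub (x : ℝ) (n k : ℕ) : grid x n (k + 1) - grid x n k = x / (n + 1) := by
  simp only [grid]
  push_cast
  ring

theorem grid_mono {x : ℝ} (hx : 0 ≤ x) (n : ℕ) : Monotone (grid x n) := by
  intro j k hjk
  have : (j : ℝ) ≤ k := by exact_mod_cast hjk
  simp only [grid]
  gcongr

theorem grid_nonneg {x : ℝ} (hx : 0 ≤ x) (n k : ℕ) : 0 ≤ grid x n k := by
  simp only [grid]
  positivity

theorem grid_le {x : ℝ} (hx : 0 ≤ x) {n k : ℕ} (hk : k ≤ n + 1) : grid x n k ≤ x := by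
  have := grid_mono hx n hk
  rwa [grid_last] at this

/-- Riemann sums of a continuous function with a continuous weight converge to the integral. -/
theorem tendsto_riemann_sum {φ b : ℝ → ℝ} (hφ : Continuous φ) (hb : Continuous b) {x : ℝ}
    (hx : 0 < x) {c : ℕ → ℕ → ℝ}
    (hc : ∀ n k, k < n + 1 → c n k ∈ Set.Icc (grid x n k) (grid x n (k + 1))) :
    Tendsto (fun n => ∑ k ∈ Finset.range (n + 1),
      (∫ s in (grid x n k)..(grid x n (k + 1)), φ s) * b (c n k)) atTop
      (𝓝 (∫ s in (0 : ℝ)..x, φ s * b s)) := by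
  obtain ⟨C, hC⟩ := isCompact_Icc.exists_bound_of_continuousOn
    (hφ.continuousOn (s := Set.Icc 0 x))
  have hC0 : 0 ≤ C := (norm_nonneg _).trans (hC 0 (Set.left_mem_Icc.2 hx.le))
  have huc := (isCompact_Icc (a := (0 : ℝ)) (b := x)).uniformContinuousOn_of_continuous
    hb.continuousOn
  rw [Metric.uniformContinuousOn_iff] at huc
  rw [Metric.tendsto_atTop]
  intro ε hε
  -- The total error is at most `C x` times this modulus, which is below `ε`; the `+ 1` covers `C =
  -- 0`.
  have hη : 0 < ε / (C * x + 1) := by positivity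
  obtain ⟨δ, hδ, hδb⟩ := huc _ hη
  obtain ⟨N, hN⟩ := exists_nat_gt (x / δ)
  refine ⟨N, fun n hn => ?_⟩
  have hstep : x / (n + 1) < δ := by
    rw [div_lt_iff₀ (by positivity)]
    rw [div_lt_iff₀ hδ] at hN
    have : (N : ℝ) ≤ n := by exact_mod_cast hn
    nlinarith
  have hint : ∀ k, IntervalIntegrable (fun s => φ s * b s) volume
      (grid x n k) (grid x n (k + 1)) := fun k => (hφ.mul hb).intervalIntegrable _ _
  have hsum : ∫ s in (0 : ℝ)..x, φ s * b s = ∑ k ∈ Finset.range (n + 1),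
      ∫ s in (grid x n k)..(grid x n (k + 1)), φ s * b s := by
    rw [intervalIntegral.sum_integral_adjacent_intervals fun k _ => hint k, grid_zero, grid_last]
  rw [hsum, dist_eq_norm, ← Finset.sum_sub_distrib]
  have hterm : ∀ k ∈ Finset.range (n + 1),
      ‖(∫ s in (grid x n k)..(grid x n (k + 1)), φ s) * b (c n k) -
        ∫ s in (grid x n k)..(grid x n (k + 1)), φ s * b s‖ ≤
      C * (ε / (C * x + 1)) * (x / (n + 1)) := by
    intro k hk
    have hk' := Finset.mem_range.1 hk
    have hle : grid x n k ≤ grid x n (k + 1) := grid_mono hx.le n (Nat.le_succ k)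
    have hint' : IntervalIntegrable (fun s => φ s * b (c n k)) volume
        (grid x n k) (grid x n (k + 1)) := (hφ.mul continuous_const).intervalIntegrable _ _
    rw [← intervalIntegral.integral_mul_const, ← intervalIntegral.integral_sub hint' (hint k),
      ← grid_succ_sub x n k, ← abs_of_nonneg (sub_nonneg.2 hle)]
    refine intervalIntegral.norm_integral_le_of_norm_le_const fun s hs => ?_
    rw [Set.uIoc_of_le hle] at hs
    have h0 := grid_nonneg hx.le n k
    have h1 : grid x n (k + 1) ≤ x := grid_le hx.le hk'
    have hck := hc n k hk'
    have hgs := grid_succ_sub x n k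
    rw [← mul_sub, norm_mul]
    refine mul_le_mul (hC s ⟨h0.trans hs.1.le, hs.2.trans h1⟩) ?_ (norm_nonneg _) hC0
    have := hδb (c n k) ⟨h0.trans hck.1, hck.2.trans h1⟩ s ⟨h0.trans hs.1.le, hs.2.trans h1⟩ (by
      rw [Real.dist_eq, abs_lt]
      constructor <;> linarith [hs.1, hs.2, hck.1, hck.2])
    rw [dist_eq_norm] at this
    exact this.le
  refine (norm_sum_le_of_le _ hterm).trans_lt ?_
  rw [Finset.sum_const, Finset.card_range, nsmul_eq_mul]
  push_cast
  have e1 : ((n : ℝ) + 1) * (C * (ε / (C * x + 1)) * (x / (n + 1))) =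
      ε * (C * x / (C * x + 1)) := by
    field_simp
  rw [e1]
  have h2 : C * x / (C * x + 1) < 1 := by
    rw [div_lt_one (by positivity)]
    linarith
  nlinarith

theorem sum_by_parts (D b : ℕ → ℝ) (N : ℕ) :
    ∑ k ∈ Finset.range N, D k * (b (k + 1) - b k) =
      ∑ k ∈ Finset.range N, (D k - D (k + 1)) * b (k + 1) + D N * b N - D 0 * b 0 := by
  induction N with
  | zero => simp
  | succ N ih =>
    rw [Finset.sum_range_succ, Finset.sum_range_succ, ih]
    ring

theorem integral_exp_eq_decay_sub {l : ℝ} (hl : l ≠ 0) (x u v : ℝ) :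
    ∫ s in u..v, Real.exp (-l * (x - s)) = decay l (x - u) - decay l (x - v) := by
  have hd : ∀ s ∈ Set.uIcc u v, HasDerivAt (fun s => -decay l (x - s))
      (Real.exp (-l * (x - s))) s := by
    intro s _
    have h1 : HasDerivAt (fun s : ℝ => x - s) (-1) s := (hasDerivAt_id s).const_sub x
    have := ((hasDerivAt_decay hl (x - s)).comp s h1).neg
    exact this.congr_deriv (by ring)
  rw [intervalIntegral.integral_eq_sub_of_hasDerivAt hd
    (Continuous.intervalIntegrable (by fun_prop) _ _)]
  ring

/-- The Riemann sums for the stochastic integral of `decay l (x - s)` converge pathwise, by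
partial integration. -/
theorem tendsto_stochastic_sum {l : ℝ} (hl : l ≠ 0) {b : ℝ → ℝ} (hb : Continuous b)
    (hb0 : b 0 = 0) {x : ℝ} (hx : 0 < x) :
    Tendsto (fun n => ∑ k ∈ Finset.range (n + 1),
      decay l (x - grid x n k) * (b (grid x n (k + 1)) - b (grid x n k))) atTop
      (𝓝 (∫ s in (0 : ℝ)..x, Real.exp (-l * (x - s)) * b s)) := by
  have h1 := tendsto_riemann_sum (φ := fun s => Real.exp (-l * (x - s))) (by fun_prop) hb hx
    (c := fun n k => grid x n (k + 1)) fun n k _ =>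
      ⟨grid_mono hx.le n (Nat.le_succ k), le_rfl⟩
  refine h1.congr fun n => ?_
  -- Both boundary terms vanish: `decay l 0 = 0` at the end and `b 0 = 0` at the start. The
  -- differences of `decay` are integrals of the exponential kernel.
  rw [sum_by_parts (fun k => decay l (x - grid x n k)) (fun k => b (grid x n k))]
  simp only [integral_exp_eq_decay_sub hl, grid_last, grid_zero, sub_self, decay_zero, hb0]
  ring

/-! ## Pathwise solution of the factor equation -/

/-- The integral of a solution of the linear equation with additive noise. -/
theorem integral_of_linear_equation {y b : ℝ → ℝ} (hy : Continuous y) (hb : Continuous b)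
    {l θ σ a : ℝ} (hl : l ≠ 0)
    (hsol : ∀ t, 0 ≤ t → y t = a - (∫ s in (0 : ℝ)..t, l * (y s - θ)) + σ * b t) {x : ℝ}
    (hx : 0 ≤ x) :
    ∫ s in (0 : ℝ)..x, y s = θ * x + (a - θ) * decay l x
      + σ * ∫ s in (0 : ℝ)..x, Real.exp (-l * (x - s)) * b s := by
  set I : ℝ → ℝ := fun t => ∫ s in (0 : ℝ)..t, (y s - θ) with hI
  have hI' : ∀ t, HasDerivAt I (y t - θ) t := fun t =>
    intervalIntegral.integral_hasDerivAt_right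
      ((hy.sub continuous_const).intervalIntegrable _ _)
      (hy.sub continuous_const).stronglyMeasurable.stronglyMeasurableAtFilter
      (hy.sub continuous_const).continuousAt
  have hsol' : ∀ t, 0 ≤ t → y t - θ + l * I t = (a - θ) + σ * b t := by
    intro t ht
    have := hsol t ht
    rw [intervalIntegral.integral_const_mul] at this
    simp only [hI]
    linarith
  -- `I` solves `I' + l I = (a - θ) + σ b`; the integrating factor is normalized to be 1 at `t = x`,
  -- so integration over `[0, x]` yields `I x`.
  have hJ : ∀ t ∈ Set.uIcc 0 x, HasDerivAt (fun t => Real.exp (-l * (x - t)) * I t)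
      (Real.exp (-l * (x - t)) * ((a - θ) + σ * b t)) t := by
    intro t ht
    rw [Set.uIcc_of_le hx] at ht
    have h1 : HasDerivAt (fun t : ℝ => x - t) (-1) t := (hasDerivAt_id t).const_sub x
    have h2 : HasDerivAt (fun t : ℝ => Real.exp (-l * (x - t)))
        (Real.exp (-l * (x - t)) * (-l * -1)) t := (h1.const_mul (-l)).exp
    refine (h2.mul (hI' t)).congr_deriv ?_
    rw [← hsol' t ht.1]
    ring
  have hc1 : Continuous fun t => Real.exp (-l * (x - t)) := by fun_prop
  have hc2 : Continuous fun t => Real.exp (-l * (x - t)) * b t := hc1.mul hb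
  have hFTC := intervalIntegral.integral_eq_sub_of_hasDerivAt hJ
    (Continuous.intervalIntegrable (by fun_prop) _ _)
  have hI0 : I 0 = 0 := by simp [hI]
  have e1 : (fun t => Real.exp (-l * (x - t)) * ((a - θ) + σ * b t)) =
      fun t => (a - θ) * Real.exp (-l * (x - t)) + σ * (Real.exp (-l * (x - t)) * b t) := by
    funext t
    ring
  rw [e1, intervalIntegral.integral_add ((hc1.const_mul _).intervalIntegrable _ _)
    ((hc2.const_mul _).intervalIntegrable _ _), intervalIntegral.integral_const_mul,
    intervalIntegral.integral_const_mul, integral_exp_eq_decay_sub hl] at hFTC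
  simp only [sub_zero, sub_self, decay_zero, mul_zero, Real.exp_zero, one_mul, hI0] at hFTC
  have hIx : I x = (∫ s in (0 : ℝ)..x, y s) - θ * x := by
    simp only [hI]
    rw [intervalIntegral.integral_sub (hy.intervalIntegrable _ _)
      (continuous_const.intervalIntegrable _ _), intervalIntegral.integral_const]
    simp [mul_comm]
  linarith

/-! ## Gaussian sums of correlated Brownian increments -/

section Increments

variable {Ω : Type*} [MeasurableSpace Ω] {Q : Measure Ω}

/-- Expanding gives four minima, which cancel for disjoint increments. -/
theorem covariance_increments [IsProbabilityMeasure Q] {X Y : ℝ≥0 → Ω → ℝ}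
    (hX : ∀ t, MemLp (X t) 2 Q)
    (hY : ∀ t, MemLp (Y t) 2 Q) {r : ℝ}
    (hcov : ∀ s t : ℝ≥0, cov[X s, Y t; Q] = r * min (s : ℝ) t) {t : ℕ → ℝ≥0} (ht : Monotone t)
    (j k : ℕ) : cov[X (t (j + 1)) - X (t j), Y (t (k + 1)) - Y (t k); Q] =
      if j = k then r * ((t (k + 1) : ℝ) - t k) else 0 := by
  have hlt : ∀ {j k : ℕ}, j ≤ k → ((t j : ℝ≥0) : ℝ) ≤ t k := fun h => by exact_mod_cast ht h
  rw [covariance_sub_left (hX _) (hX _) ((hY _).sub (hY _)),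
    covariance_sub_right (hX _) (hY _) (hY _), covariance_sub_right (hX _) (hY _) (hY _)]
  simp only [hcov]
  rcases lt_trichotomy j k with h | h | h
  · rw [if_neg h.ne, min_eq_left (hlt (by omega)), min_eq_left (hlt (by omega)),
      min_eq_left (hlt (by omega)), min_eq_left (hlt (by omega))]
    ring
  · subst h
    rw [if_pos rfl, min_self, min_self, min_eq_right (hlt (Nat.le_succ j)),
      min_eq_left (hlt (Nat.le_succ j))]
    ring
  · rw [if_neg h.ne', min_eq_right (hlt (by omega)), min_eq_right (hlt (by omega)),
      min_eq_right (hlt (by omega)), min_eq_right (hlt (by omega))]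
    ring

/-- A weighted sum of the increments of two processes. -/
def incrementSum (B1 B2 : ℝ≥0 → Ω → ℝ) (t : ℕ → ℝ≥0) (a1 a2 : ℕ → ℝ) (N : ℕ) (ω : Ω) : ℝ :=
  ∑ k : Fin N, (a1 k * (B1 (t (k + 1)) ω - B1 (t k) ω) + a2 k * (B2 (t (k + 1)) ω - B2 (t k) ω))

namespace IsCorrelatedBrownian

variable {ρ : ℝ} {B1 B2 : ℝ≥0 → Ω → ℝ}

theorem hasGaussianLaw_incrementSum (hB : IsCorrelatedBrownian Q ρ B1 B2) (t : ℕ → ℝ≥0)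
    (a1 a2 : ℕ → ℝ) (N : ℕ) : HasGaussianLaw (incrementSum B1 B2 t a1 a2 N) Q := by
  -- The index selects the interval, the Brownian motion, and the end point of the interval; the
  -- sign in `c` distinguishes the end points.
  set f : Fin N × Bool × Bool → ℝ≥0 ⊕ ℝ≥0 := fun i =>
    match i with
    | (k, false, e) => .inl (t (k + if e then 1 else 0))
    | (k, true, e) => .inr (t (k + if e then 1 else 0)) with hf
  set c : Fin N × Bool × Bool → ℝ := fun i =>
    (if i.2.1 then a2 i.1 else a1 i.1) * (if i.2.2 then 1 else -1) with hc
  have h1 := ((hB.jointly_gaussian.comp_right f).smul c).hasGaussianLaw_fun_sum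
    (I := Finset.univ)
  refine h1.congr (Eventually.of_forall fun ω => ?_)
  simp only [incrementSum, Fintype.sum_prod_type, Fintype.sum_bool, hf, hc]
  refine Finset.sum_congr rfl fun k _ => ?_
  simp
  ring

theorem memLp_left (hB : IsCorrelatedBrownian Q ρ B1 B2) (t : ℝ≥0) : MemLp (B1 t) 2 Q :=
  (hB.left.isGaussianProcess.hasGaussianLaw_eval t).memLp_two

theorem memLp_right (hB : IsCorrelatedBrownian Q ρ B1 B2) (t : ℝ≥0) : MemLp (B2 t) 2 Q :=
  (hB.right.isGaussianProcess.hasGaussianLaw_eval t).memLp_two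

theorem integral_incrementSum [IsProbabilityMeasure Q]
    (hB : IsCorrelatedBrownian Q ρ B1 B2) (t : ℕ → ℝ≥0)
    (a1 a2 : ℕ → ℝ) (N : ℕ) : ∫ ω, incrementSum B1 B2 t a1 a2 N ω ∂Q = 0 := by
  have i1 : ∀ s, Integrable (fun ω => B1 s ω) Q := hB.left.integrable_eval
  have i2 : ∀ s, Integrable (fun ω => B2 s ω) Q := hB.right.integrable_eval
  have e1 : ∀ s, ∫ ω, B1 s ω ∂Q = 0 := hB.left.integral_eval
  have e2 : ∀ s, ∫ ω, B2 s ω ∂Q = 0 := hB.right.integral_eval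
  have j1 : ∀ a s u, Integrable (fun ω => a * (B1 s ω - B1 u ω)) Q := fun a s u =>
    ((i1 s).sub (i1 u)).const_mul a
  have j2 : ∀ a s u, Integrable (fun ω => a * (B2 s ω - B2 u ω)) Q := fun a s u =>
    ((i2 s).sub (i2 u)).const_mul a
  have j3 : ∀ k : Fin N, Integrable (fun ω => a1 k * (B1 (t (k + 1)) ω - B1 (t k) ω) +
      a2 k * (B2 (t (k + 1)) ω - B2 (t k) ω)) Q := fun k => (j1 _ _ _).add (j2 _ _ _)
  simp only [incrementSum]
  rw [integral_finsetSum _ fun k _ => j3 k]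
  refine Finset.sum_eq_zero fun k _ => ?_
  rw [integral_add (j1 _ _ _) (j2 _ _ _), integral_const_mul, integral_const_mul,
    integral_sub (i1 _) (i1 _), integral_sub (i2 _) (i2 _), e1, e1, e2, e2]
  simp

theorem variance_incrementSum [IsProbabilityMeasure Q]
    (hB : IsCorrelatedBrownian Q ρ B1 B2) {t : ℕ → ℝ≥0}
    (ht : Monotone t) (a1 a2 : ℕ → ℝ) (N : ℕ) : Var[incrementSum B1 B2 t a1 a2 N; Q] =
      ∑ k ∈ Finset.range N, (a1 k ^ 2 + 2 * ρ * (a1 k * a2 k) + a2 k ^ 2) *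
        ((t (k + 1) : ℝ) - t k) := by
  have m1 := hB.memLp_left
  have m2 := hB.memLp_right
  have c11 := covariance_increments (r := 1) m1 m1 (fun s u => by
    rw [hB.left.covariance_eval]
    push_cast
    ring) ht
  have c22 := covariance_increments (r := 1) m2 m2 (fun s u => by
    rw [hB.right.covariance_eval]
    push_cast
    ring) ht
  have c12 := covariance_increments (r := ρ) m1 m2 (fun s u => by
    rw [hB.covariance, NNReal.coe_min]) ht
  have c21 := covariance_increments (r := ρ) m2 m1 (fun s u => by
    rw [covariance_comm, hB.covariance, NNReal.coe_min, min_comm]) ht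
  set Y : Fin N → Ω → ℝ := fun k =>
    a1 k • (B1 (t (k + 1)) - B1 (t k)) + a2 k • (B2 (t (k + 1)) - B2 (t k)) with hY
  have d1 : ∀ k : Fin N, MemLp (a1 k • (B1 (t (k + 1)) - B1 (t k))) 2 Q := fun k =>
    ((m1 _).sub (m1 _)).const_smul _
  have d2 : ∀ k : Fin N, MemLp (a2 k • (B2 (t (k + 1)) - B2 (t k))) 2 Q := fun k =>
    ((m2 _).sub (m2 _)).const_smul _
  have hS : incrementSum B1 B2 t a1 a2 N = fun ω => ∑ k, Y k ω := by
    funext ω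
    simp [incrementSum, hY]
  rw [hS, variance_fun_sum fun k => (d1 k).add (d2 k), Finset.sum_range]
  refine Finset.sum_congr rfl fun j _ => ?_
  have hcov : ∀ k : Fin N, cov[Y j, Y k; Q] = if j = k then
      (a1 k ^ 2 + 2 * ρ * (a1 k * a2 k) + a2 k ^ 2) * ((t (k + 1) : ℝ) - t k) else 0 := by
    intro k
    simp only [hY]
    rw [covariance_add_left (d1 j) (d2 j) ((d1 k).add (d2 k)),
      covariance_add_right (d1 j) (d1 k) (d2 k), covariance_add_right (d2 j) (d1 k) (d2 k)]
    simp only [covariance_smul_left, covariance_smul_right, c11, c12, c21, c22]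
    by_cases hjk : j = k
    · subst hjk
      simp only [if_true]
      ring
    · have : (j : ℕ) ≠ k := fun h => hjk (Fin.ext h)
      simp [hjk, this]
  refine (Finset.sum_congr rfl fun k _ => hcov k).trans ?_
  rw [Finset.sum_ite_eq]
  simp

end IsCorrelatedBrownian

/-- An almost sure limit of centered Gaussian variables with convergent variances is Gaussian. -/
theorem map_eq_gaussianReal_of_tendsto [IsProbabilityMeasure Q]
    {S : ℕ → Ω → ℝ} {W : Ω → ℝ} {v : ℝ}
    (hS : ∀ n, HasGaussianLaw (S n) Q) (h0 : ∀ n, ∫ ω, S n ω ∂Q = 0)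
    (hv : Tendsto (fun n => Var[S n; Q]) atTop (𝓝 v))
    (hW : ∀ᵐ ω ∂Q, Tendsto (fun n => S n ω) atTop (𝓝 (W ω))) :
    0 ≤ v ∧ Q.map W = gaussianReal 0 v.toNNReal := by
  have hmS : ∀ n, AEMeasurable (S n) Q := fun n => (hS n).aemeasurable
  have hmW : AEMeasurable W Q := aemeasurable_of_tendsto_metrizable_ae atTop hmS hW
  have hv0 : 0 ≤ v := ge_of_tendsto' hv fun n => variance_nonneg _ _
  have : IsProbabilityMeasure (Q.map W) := Measure.isProbabilityMeasure_map hmW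
  refine ⟨hv0, Measure.ext_of_charFun (funext fun u => ?_)⟩
  have h1 : ∀ n, charFun (Q.map (S n)) u = Complex.exp (-(Var[S n; Q] : ℂ) * u ^ 2 / 2) := by
    intro n
    rw [(hS n).map_eq_gaussianReal, charFun_gaussianReal, h0,
      Real.coe_toNNReal _ (variance_nonneg _ _)]
    congr 1
    push_cast
    ring
  -- Characteristic functions pass to the almost sure limit by dominated convergence with bound 1,
  -- while the Gaussian formula passes to the limit of the variances.
  have hlim : Tendsto (fun n => charFun (Q.map (S n)) u) atTop (𝓝 (charFun (Q.map W) u)) := by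
    have hc : ∀ X : Ω → ℝ, AEMeasurable X Q →
        charFun (Q.map X) u = ∫ ω, Complex.exp (u * X ω * Complex.I) ∂Q := by
      intro X hX
      rw [charFun_apply_real, integral_map hX (by fun_prop)]
    rw [hc W hmW]
    simp only [fun n => hc (S n) (hmS n)]
    refine tendsto_integral_of_dominated_convergence (fun _ => (1 : ℝ)) (fun n => ?_)
      (integrable_const _) (fun n => ?_) ?_
    · have := hmS n
      exact AEMeasurable.aestronglyMeasurable (by fun_prop)
    · refine Eventually.of_forall fun ω => ?_
      have : (u : ℂ) * (S n ω : ℂ) * Complex.I = ((u * S n ω : ℝ) : ℂ) * Complex.I := by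
        push_cast
        ring
      rw [this, Complex.norm_exp_ofReal_mul_I]
    · filter_upwards [hW] with ω hω
      have hcont : Continuous fun y : ℝ => Complex.exp (u * y * Complex.I) := by fun_prop
      exact (hcont.tendsto _).comp hω
  have hlim2 : Tendsto (fun n => charFun (Q.map (S n)) u) atTop
      (𝓝 (Complex.exp (-(v : ℂ) * u ^ 2 / 2))) := by
    simp only [h1]
    have hcont : Continuous fun y : ℝ => Complex.exp (-(y : ℂ) * u ^ 2 / 2) := by fun_prop
    exact (hcont.tendsto _).comp hv
  rw [tendsto_nhds_unique hlim hlim2, charFun_gaussianReal, Real.coe_toNNReal _ hv0]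
  congr 1
  push_cast
  ring

end Increments

/-! ## The bond price -/

namespace IsCorrelatedBrownian

variable {Ω : Type*} [MeasurableSpace Ω] {Q : Measure Ω} [IsProbabilityMeasure Q]
  {p : Params} {B1 B2 : ℝ≥0 → Ω → ℝ}

/-- The random part of the integrated short rate. -/
noncomputable def noise (p : Params) (B1 B2 : ℝ≥0 → Ω → ℝ) (x : ℝ) (ω : Ω) : ℝ :=
  p.sigma1 * (∫ s in (0 : ℝ)..x, Real.exp (-p.lam1 * (x - s)) * B1 s.toNNReal ω)
    + p.sigma2 * (∫ s in (0 : ℝ)..x, Real.exp (-p.lam2 * (x - s)) * B2 s.toNNReal ω)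

theorem map_noise (hB : IsCorrelatedBrownian Q p.rho B1 B2) {x : ℝ} (hx : 0 < x) :
    0 ≤ p.variance x ∧ Q.map (noise p B1 B2 x) = gaussianReal 0 (p.variance x).toNNReal := by
  set t : ℕ → ℕ → ℝ≥0 := fun n k => (grid x n k).toNNReal with ht
  have htc : ∀ n k, ((t n k : ℝ≥0) : ℝ) = grid x n k := fun n k =>
    Real.coe_toNNReal _ (grid_nonneg hx.le n k)
  have htm : ∀ n, Monotone (t n) := fun n j k hjk =>
    Real.toNNReal_le_toNNReal (grid_mono hx.le n hjk)
  refine map_eq_gaussianReal_of_tendsto (S := fun n => incrementSum B1 B2 (t n)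
      (fun k => p.sigma1 * decay p.lam1 (x - grid x n k))
      (fun k => p.sigma2 * decay p.lam2 (x - grid x n k)) (n + 1))
    (fun n => hB.hasGaussianLaw_incrementSum _ _ _ _)
    (fun n => hB.integral_incrementSum _ _ _ _) ?_ ?_
  -- The variances of the sums are left Riemann sums of `∫₀ˣ varRate (x - s) ds`.
  · have hcont : Continuous fun s => p.varRate (x - s) := by
      have h1 := Params.continuous_decay p.lam1
      have h2 := Params.continuous_decay p.lam2
      unfold Params.varRate
      fun_prop
    have h1 := tendsto_riemann_sum (φ := fun _ => (1 : ℝ)) continuous_const hcont hx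
      (c := fun n k => grid x n k) fun n k _ => ⟨le_rfl, grid_mono hx.le n (Nat.le_succ k)⟩
    have h2 : ∫ s in (0 : ℝ)..x, 1 * p.varRate (x - s) = p.variance x := by
      have hd : ∀ s ∈ Set.uIcc 0 x, HasDerivAt (fun s => -p.variance (x - s))
          (1 * p.varRate (x - s)) s := by
        intro s _
        have h3 : HasDerivAt (fun s : ℝ => x - s) (-1) s := (hasDerivAt_id s).const_sub x
        exact ((p.hasDerivAt_variance (x - s)).comp s h3).neg.congr_deriv (by ring)
      rw [intervalIntegral.integral_eq_sub_of_hasDerivAt hd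
        ((continuous_const.mul hcont).intervalIntegrable _ _)]
      simp [p.variance_zero]
    rw [h2] at h1
    refine h1.congr fun n => ?_
    rw [hB.variance_incrementSum (htm n)]
    refine Finset.sum_congr rfl fun k _ => ?_
    rw [htc, htc, intervalIntegral.integral_const, smul_eq_mul, mul_one, mul_comm, Params.varRate]
    congr 1
    ring
  -- The sums discretize the stochastic integrals of `σᵢ decay λᵢ (x - s)` against `dBⁱ`; pathwise,
  -- these become `noise` after partial integration.
  · filter_upwards [hB.left.cont, hB.right.cont, hB.left.eval_zero_ae_eq_zero,
      hB.right.eval_zero_ae_eq_zero] with ω c1 c2 z1 z2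
    have h1 := tendsto_stochastic_sum p.lam1_pos.ne' (b := fun s => B1 s.toNNReal ω)
      (c1.comp continuous_real_toNNReal) (by simpa using z1) hx
    have h2 := tendsto_stochastic_sum p.lam2_pos.ne' (b := fun s => B2 s.toNNReal ω)
      (c2.comp continuous_real_toNNReal) (by simpa using z2) hx
    refine ((h1.const_mul p.sigma1).add (h2.const_mul p.sigma2)).congr fun n => ?_
    rw [incrementSum, Finset.mul_sum, Finset.mul_sum, ← Finset.sum_add_distrib, Finset.sum_range]
    refine Finset.sum_congr rfl fun k _ => ?_
    simp only [ht]
    ring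

/-- The bond price in closed form. -/
theorem bondPrice_eq (hB : IsCorrelatedBrownian Q p.rho B1 B2)
    {Z : ℝ × ℝ → ℝ≥0 → Ω → ℝ × ℝ} (hZ : ∀ z, IsFactorProcess Q p B1 B2 z (Z z)) {x : ℝ}
    (hx : 0 < x) (z : ℝ × ℝ) : bondPrice Q p Z x z = Real.exp (-p.negLogPrice x z) := by
  set m := (p.kappa + p.theta1 + p.theta2) * x + (z.1 - p.theta1) * decay p.lam1 x
    + (z.2 - p.theta2) * decay p.lam2 x with hm
  have hpath : ∀ᵐ ω ∂Q, Real.exp (-∫ s in (0 : ℝ)..x, shortRate p (Z z) s ω) =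
      Real.exp (-m) * Real.exp (-1 * noise p B1 B2 x ω) := by
    filter_upwards [hB.left.cont, hB.right.cont, (hZ z).continuous_paths, (hZ z).sde_fst,
      (hZ z).sde_snd] with ω c1 c2 cZ s1 s2
    have cy1 : Continuous fun s : ℝ => (Z z s.toNNReal ω).1 :=
      (cZ.comp continuous_real_toNNReal).fst
    have cy2 : Continuous fun s : ℝ => (Z z s.toNNReal ω).2 :=
      (cZ.comp continuous_real_toNNReal).snd
    have e1 := integral_of_linear_equation cy1 (b := fun s => B1 s.toNNReal ω)
      (c1.comp continuous_real_toNNReal) p.lam1_pos.ne' (θ := p.theta1) (σ := p.sigma1)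
      (a := z.1) (fun t ht => by
        have := s1 t.toNNReal
        rwa [Real.coe_toNNReal _ ht] at this) hx.le
    have e2 := integral_of_linear_equation cy2 (b := fun s => B2 s.toNNReal ω)
      (c2.comp continuous_real_toNNReal) p.lam2_pos.ne' (θ := p.theta2) (σ := p.sigma2)
      (a := z.2) (fun t ht => by
        have := s2 t.toNNReal
        rwa [Real.coe_toNNReal _ ht] at this) hx.le
    have e3 : ∫ s in (0 : ℝ)..x, shortRate p (Z z) s ω = m + noise p B1 B2 x ω := by
      have i0 : IntervalIntegrable (fun s : ℝ => p.kappa + (Z z s.toNNReal ω).1) volume 0 x :=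
        (continuous_const.add cy1).intervalIntegrable _ _
      simp only [shortRate]
      rw [intervalIntegral.integral_add i0 (cy2.intervalIntegrable _ _),
        intervalIntegral.integral_add (continuous_const.intervalIntegrable _ _)
          (cy1.intervalIntegrable _ _),
        intervalIntegral.integral_const, e1, e2, hm, noise, smul_eq_mul]
      ring
    rw [e3, ← Real.exp_add]
    congr 1
    ring
  rw [bondPrice, integral_congr_ae hpath, integral_const_mul]
  obtain ⟨hv, hmap⟩ := hB.map_noise hx
  -- The moment generating function of the centered Gaussian noise at -1 supplies the convexity term
  -- `variance / 2`.
  have hmgf := mgf_gaussianReal hmap (-1)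
  rw [mgf] at hmgf
  rw [hmgf, ← Real.exp_add, Real.coe_toNNReal _ hv, Params.negLogPrice]
  congr 1
  rw [hm]
  ring

end IsCorrelatedBrownian

/-! ### The forward and yield curves as families of lines -/

section Curves

variable {Ω : Type*} [MeasurableSpace Ω] {Q : Measure Ω} [IsProbabilityMeasure Q] {p : Params}
  {B1 B2 : ℝ≥0 → Ω → ℝ} {Z : ℝ × ℝ → ℝ≥0 → Ω → ℝ × ℝ}

theorem IsCorrelatedBrownian.log_bondPrice_eq (hB : IsCorrelatedBrownian Q p.rho B1 B2)
    (hZ : ∀ z, IsFactorProcess Q p B1 B2 z (Z z)) {x : ℝ} (hx : 0 < x) (z : ℝ × ℝ) :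
    Real.log (bondPrice Q p Z x z) = -p.negLogPrice x z := by
  rw [hB.bondPrice_eq hZ hx, Real.log_exp]

theorem IsCorrelatedBrownian.forwardCurve_eq (hB : IsCorrelatedBrownian Q p.rho B1 B2)
    (hZ : ∀ z, IsFactorProcess Q p B1 B2 z (Z z)) {x : ℝ} (hx : 0 < x) (z : ℝ × ℝ) :
    forwardCurve Q p Z x z = p.forward x z := by
  have h : (fun y => Real.log (bondPrice Q p Z y z)) =ᶠ[𝓝 x] fun y => -p.negLogPrice y z := by
    filter_upwards [lt_mem_nhds hx] with y hy using hB.log_bondPrice_eq hZ hy z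
  rw [forwardCurve, h.deriv_eq, (p.hasDerivAt_negLogPrice x z).fun_neg.deriv, neg_neg]

theorem IsCorrelatedBrownian.isCurve_forwardCurve (hB : IsCorrelatedBrownian Q p.rho B1 B2)
    (hZ : ∀ z, IsFactorProcess Q p B1 B2 z (Z z)) :
    IsCurve p.forwardProfile (forwardCurve Q p Z) (fun x => -p.lam1 * Real.exp (-p.lam1 * x))
      (fun x => -p.lam1 * (Real.exp (-p.lam1 * x) * -p.lam1)) where
  neg x _ := mul_neg_of_neg_of_pos (neg_neg_of_pos p.lam1_pos) (Real.exp_pos _)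
  hasDerivAt_w x _ := by
    simpa using (((hasDerivAt_id x).const_mul (-p.lam1)).exp.const_mul (-p.lam1))
  hasDerivAt z x hx := by
    refine (p.hasDerivAt_forward x z).congr_of_eventuallyEq ?_
    filter_upwards [lt_mem_nhds hx] with y hy using hB.forwardCurve_eq hZ hy z

theorem IsCorrelatedBrownian.isCurve_yieldCurve (hB : IsCorrelatedBrownian Q p.rho B1 B2)
    (hZ : ∀ z, IsFactorProcess Q p B1 B2 z (Z z)) :
    IsCurve p.averageData.profile (yieldCurve Q p Z) (fun x => -(p.averageData.u x / x ^ 2))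
      (deriv fun x => -(p.averageData.u x / x ^ 2)) where
  neg x hx := neg_neg_of_pos (div_pos (p.averageData.u_pos hx) (pow_pos hx 2))
  hasDerivAt_w x hx :=
    ((p.averageData.hasDerivAt_u x hx).div (hasDerivAt_pow 2 x)
      (pow_pos hx 2).ne').fun_neg.differentiableAt.hasDerivAt
  hasDerivAt z x hx := by
    refine (p.hasDerivAt_yield hx z).congr_of_eventuallyEq ?_
    filter_upwards [lt_mem_nhds hx] with y hy
    rw [yieldCurve, hB.log_bondPrice_eq hZ hy z]
    ring

end Curves

end Vasicek

/-- Both curves satisfy `IsCurve`, with the forward profile and its weighted average respectively,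
so one classification covers both. -/
theorem mainTheorem2 {Ω : Type*} [MeasurableSpace Ω] (Q : Measure Ω) [IsProbabilityMeasure Q]
    (p : Vasicek.Params) (B1 B2 : ℝ≥0 → Ω → ℝ)
    (hB : Vasicek.IsCorrelatedBrownian Q p.rho B1 B2)
    (Z : ℝ × ℝ → ℝ≥0 → Ω → ℝ × ℝ)
    (hZ : ∀ z : ℝ × ℝ, Vasicek.IsFactorProcess Q p B1 B2 z (Z z))
    (g : ℝ → ℝ × ℝ → ℝ)
    (hg : g = Vasicek.forwardCurve Q p Z ∨ g = Vasicek.yieldCurve Q p Z) :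
    ∃ (K : ℕ) (R : Fin K → Set (ℝ × ℝ)) (S : Fin K → Vasicek.Shape),
      Function.Injective R ∧
      Set.range R = Vasicek.regions g ∧
      (∀ i, IsOpen (R i)) ∧
      (∀ i j, i ≠ j → Disjoint (R i) (R j)) ∧
      (⋃ i, R i) =
        (Vasicek.augmentedEnvelope g ∪ Vasicek.lineZero g ∪ Vasicek.lineInfty g)ᶜ ∧
      (∀ i, ∀ z ∈ R i, Vasicek.HasShape (fun x => g x z) (S i)) ∧
      (∀ i j, i ≠ j → Vasicek.ShareCurve (R i) (R j) → (S i).extrema ≠ (S j).extrema) := by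
  rcases hg with rfl | rfl
  · exact (hB.isCurve_forwardCurve hZ).classification
  · exact (hB.isCurve_yieldCurve hZ).classification
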